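/- Fix a commutative ring $\Bbbk$ with unit. **Cubical sets.** Let $\mathbf 2=\{0,1\}$. The cube category $\square$ (with connections) has the posets $\mathbf 2^n$, $n\ge 0$, as objects; its morphisms are the composites of the maps $\delta^{\epsilon}_i\colon\mathbf 2^n\to\mathbf 2^{n+1}$, $t\mapsto(t_1,\dots,t_{i-1},\epsilon,t_i,\dots,t_n)$ ($1\le i\le n+1$, $\epsilon\in\{0,1\}$), $\sigma_i\colon\mathbf 2^{n}\to\mathbf 2^{n-1}$, $t\mapsto(t_1,\dots,t_{i-1},t_{i+1},\dots,t_n)$ ($1\le i\le n$), and $\gamma_i\colon\mathbf 2^{n}\to\mathbf 2^{n-1}$, $t\mapsto(t_1,\dots,t_{i-1},\min(t_i,t_{i+1}),t_{i+2},\dots,t_n)$ ($1\le i<n$). A cubical set is always understood to be a cubical set with connections: sets $Y_n$, $n\ge0$, with face operators $d^0_i,d^1_i\colon Y_n\to Y_{n-1}$ ($1\le i\le n$), degeneracy operators $s_i\colon Y_n\to Y_{n+1}$ ($1\le i\le n+1$) and connection operators $\gamma_i\colon Y_n\to Y_{n+1}$ ($1\le i\le n$) satisfying $$d^{\epsilon}_id^{\epsilon'}_j=d^{\epsilon'}_{j-1}d^{\epsilon}_i\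 (i<j),\qquad s_is_j=s_{j+1}s_i\ (i\le j),\qquad \gamma_i\gamma_j=\gamma_{j+1}\gamma_i\ (i\le j),$$ $$d^{\epsilon}_is_j=\begin{cases}s_{j-1}d^{\epsilon}_i&i<j\\ \mathrm{id}&i=j\\ s_jd^{\epsilon}_{i-1}&i>j\end{cases}\qquad d^{\epsilon}_i\gamma_j=\begin{cases}\gamma_{j-1}d^{\epsilon}_i&i<j\\ s_jd^{0}_j&i\in\{j,j+1\},\ \epsilon=0\\ \mathrm{id}&i\in\{j,j+1\},\ \epsilon=1\\ \gamma_jd^{\epsilon}_{i-1}&i>j+1\end{cases}\qquad \gamma_is_j=\begin{cases}s_{j+1}\gamma_i&i<j\\ s_{i+1}s_i&i=j\\ s_j\gamma_{i-1}&i>j.\end{cases}$$ Here $d^\epsilon_i$, $s_i$ and $\gamma_i$ are the operators induced by $\delta^\epsilon_i$, $\sigma_i$ and $\gamma_i$; for a composite $\lambda$ of generating morphisms we write $\lambda^*$ for the corresponding composite of operators. Morphisms of cubical sets are families of maps commuting with all operators. **Cubical chains.** A dgc is a non-negatively graded, coassociative, counital differential graded coalgebra over $\Bbbk$; a morphism of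 dgcs is a chain map compatible with the diagonals and the augmentations; it is a quasi-isomorphism if it induces an isomorphism in homology. The normalized cubical chains $C(Y)$ form the dgc which in degree $n$ is the free $\Bbbk$-module on $Y_n$ divided by the span of the degenerate cubes $s_iy$ and the folded cubes $\gamma_iy$, with differential $d\,y=\sum_{i=1}^{n}(-1)^{i}(d^0_iy-d^1_iy)$, Serre diagonal $$\Delta y=\sum_{\substack{k+l=n\\(\alpha,\beta)}}(-1)^{(\alpha,\beta)}\,d^0_{\beta_1}\cdots d^0_{\beta_l}\,y\otimes d^1_{\alpha_1}\cdots d^1_{\alpha_k}\,y,$$ summed over all $(k,l)$-shuffles, i.e. partitions $\{1,\dots,n\}=\{\alpha_1<\dots<\alpha_k\}\sqcup\{\beta_1<\dots<\beta_l\}$, where $(-1)^{(\alpha,\beta)}$ is the sign of the permutation $(\alpha_1,\dots,\alpha_k,\beta_1,\dots,\beta_l)$, and augmentation sending every $0$-cube to $1$. **Simplicial chains.** For a simplicial set $X$, the dgc $C(X)$ of normalized simplicial chains is in degree $n$ the free $\Bbbk$-module on $X_n$ modulo degenerate simplices, with $d\,x=\sum_{i=0}^n(-1)^id_ix$, Alexander–Whitney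 diagonal $\Delta x=\sum_{p=0}^n x(0,\dots,p)\otimes x(p,\dots,n)$, and augmentation sending every $0$-simplex to $1$. **Triangulation.** Let $\mathbb I=\Delta^1$ be the simplicial interval, so that the $m$-simplices of $\mathbb I^n$ are the weakly increasing sequences of $m+1$ elements of $\mathbf 2^n$. Every morphism $\lambda\colon\mathbf 2^l\to\mathbf 2^n$ of $\square$ is weakly increasing and thus induces a simplicial map $\lambda_*\colon\mathbb I^l\to\mathbb I^n$. The triangulation of a cubical set $Y$ is the simplicial set $$\mathcal T Y=\bigsqcup_{n\ge0}\ \bigsqcup_{y\in Y_n}\mathbb I^{n}\Bigm/\sim,$$ where $\sim$ is generated by $(\lambda^*y,u)\sim(y,\lambda_*u)$ for all $y\in Y_n$, all morphisms $\lambda\colon\mathbf 2^l\to\mathbf 2^n$ of $\square$ and all simplices $u$ of $\mathbb I^l$. We write $[y,u]$ for the class of $(y,u)$; $\mathcal T$ is a functor by $[y,u]\mapsto[f(y),u]$. For $\pi\in S_n$ let $u_\pi$ be the $n$-simplex of $\mathbb I^n$ whose $j$-th vertex, $0\le j\le n$, has the coordinates $\pi(1),\dots,\pi(j)$ equal to $1$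 and all others equal to $0$. **Proposition.** There is a natural transformation $\mathbf t\colon C(-)\to C(\mathcal T(-))$ between functors from cubical sets to dgcs over $\Bbbk$ which is given, for each cubical set $Y$, by $$\mathbf t_Y\colon C(Y)\to C(\mathcal T Y),\qquad y\mapsto\sum_{\pi\in S_n}\operatorname{sgn}(\pi)\,[y,u_\pi]\qquad\text{for } y\in Y_n,\ n\ge 0.$$ In particular, $\mathbf t_Y$ is a well-defined morphism of dgcs. Moreover, $\mathbf t_Y$ is a quasi-isomorphism for every cubical set $Y$. -/

import Mathlib

open CategoryTheory TensorProduct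

universe u v w

/-! ### Free modules modulo a set of generators -/

/-- The free `k`-module on `A`, divided by the span of the generators that lie in `S`. -/
def NormChains (k : Type v) [CommRing k] {A : Type u} (S : Set A) : Type (max u v) :=
  (A →₀ k) ⧸ Submodule.span k ((fun a => Finsupp.single a (1 : k)) '' S)

namespace NormChains

variable (k : Type v) [CommRing k] {A : Type u} (S : Set A)

noncomputable instance : AddCommGroup (NormChains k S) :=
  inferInstanceAs (AddCommGroup (_ ⧸ Submodule.span k _))

noncomputable instance : Module k (NormChains k S) :=
  inferInstanceAs (Module k (_ ⧸ Submodule.span k _))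

/-- The class of a generator. -/
noncomputable def mk (a : A) : NormChains k S :=
  Submodule.Quotient.mk (Finsupp.single a (1 : k))

variable {k S}

theorem mk_eq_zero {a : A} (ha : a ∈ S) : mk k S a = 0 :=
  (Submodule.Quotient.mk_eq_zero _).2 (Submodule.subset_span ⟨a, ha, rfl⟩)

/-- The linear map with prescribed values on the generators. -/
noncomputable def desc {M : Type*} [AddCommGroup M] [Module k M] (f : A → M)
    (hf : ∀ a ∈ S, f a = 0) : NormChains k S →ₗ[k] M :=
  Submodule.liftQ _ (Finsupp.linearCombination k f) (by
    rw [Submodule.span_le]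
    rintro _ ⟨a, ha, rfl⟩
    simp [hf a ha])

@[simp]
theorem desc_mk {M : Type*} [AddCommGroup M] [Module k M] (f : A → M)
    (hf : ∀ a ∈ S, f a = 0) (a : A) : desc f hf (mk k S a) = f a := by
  simp only [desc, mk]
  erw [Submodule.liftQ_apply]
  simp

theorem hom_ext {M : Type*} [AddCommGroup M] [Module k M] {f g : NormChains k S →ₗ[k] M}
    (h : ∀ a, f (mk k S a) = g (mk k S a)) : f = g := by
  refine Submodule.linearMap_qext _ (Finsupp.lhom_ext' fun a => LinearMap.ext_ring ?_)
  exact h a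

end NormChains

/-! ### Differential graded coalgebras -/

/-- A (non-negatively graded) differential graded coalgebra over `k`. The diagonal is given by its
components `C_n → C_p ⊗ C_q` for `p + q = n`. The tensor product `C ⊗ C` carries the differential
`d (a ⊗ b) = d a ⊗ b + (-1) ^ p • a ⊗ d b` for `a` of degree `p`, and `k` is concentrated in
degree `0`. -/
structure DGCoalgebra (k : Type v) [CommRing k] where
  /-- the homogeneous components -/
  X : ℕ → Type w
  [addCommGroup : ∀ n, AddCommGroup (X n)]
  [module : ∀ n, Module k (X n)]
  /-- the differential -/
  d : ∀ n, X (n + 1) →ₗ[k] X n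
  d_comp_d : ∀ n, d n ∘ₗ d (n + 1) = 0
  /-- the components of the diagonal -/
  comul : ∀ p q n : ℕ, p + q = n → (X n →ₗ[k] X p ⊗[k] X q)
  /-- the augmentation -/
  counit : X 0 →ₗ[k] k
  comul_d : ∀ (p q n : ℕ) (h : p + q = n),
    comul p q n h ∘ₗ d n =
      (d p).rTensor (X q) ∘ₗ comul (p + 1) q (n + 1) (by omega) +
        (-1 : ℤ) ^ p • ((d q).lTensor (X p) ∘ₗ comul p (q + 1) (n + 1) (by omega))
  counit_d : counit ∘ₗ d 0 = 0
  coassoc : ∀ (p q r m m' n : ℕ) (hm : p + q = m) (hm' : q + r = m') (h : m + r = n),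
    (TensorProduct.assoc k (X p) (X q) (X r)).toLinearMap ∘ₗ
        (comul p q m hm).rTensor (X r) ∘ₗ comul m r n h =
      (comul q r m' hm').lTensor (X p) ∘ₗ comul p m' n (by omega)
  counit_comul : ∀ n : ℕ,
    (TensorProduct.lid k (X n)).toLinearMap ∘ₗ counit.rTensor (X n) ∘ₗ
      comul 0 n n (Nat.zero_add n) = LinearMap.id
  comul_counit : ∀ n : ℕ,
    (TensorProduct.rid k (X n)).toLinearMap ∘ₗ counit.lTensor (X n) ∘ₗ
      comul n 0 n (Nat.add_zero n) = LinearMap.id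

namespace DGCoalgebra

variable {k : Type v} [CommRing k]

attribute [instance] DGCoalgebra.addCommGroup DGCoalgebra.module

/-- A morphism of differential graded coalgebras. -/
@[ext]
structure Hom (C D : DGCoalgebra.{v, w} k) where
  /-- the components of the morphism -/
  f : ∀ n, C.X n →ₗ[k] D.X n
  f_d : ∀ n, f n ∘ₗ C.d n = D.d n ∘ₗ f (n + 1)
  comul_f : ∀ (p q n : ℕ) (h : p + q = n),
    D.comul p q n h ∘ₗ f n = TensorProduct.map (f p) (f q) ∘ₗ C.comul p q n h
  counit_f : D.counit ∘ₗ f 0 = C.counit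

instance : Category (DGCoalgebra.{v, w} k) where
  Hom := Hom
  id C := ⟨fun _ => LinearMap.id, fun _ => rfl, fun _ _ _ _ => by
    rw [TensorProduct.map_id, LinearMap.comp_id, LinearMap.id_comp], rfl⟩
  comp a b := ⟨fun n => b.f n ∘ₗ a.f n,
    fun n => by rw [LinearMap.comp_assoc, a.f_d, ← LinearMap.comp_assoc, b.f_d,
      LinearMap.comp_assoc],
    fun p q n h => by rw [← LinearMap.comp_assoc, b.comul_f, LinearMap.comp_assoc, a.comul_f,
      ← LinearMap.comp_assoc, TensorProduct.map_comp],
    by rw [← LinearMap.comp_assoc, b.counit_f, a.counit_f]⟩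

/-- The underlying chain complex. -/
noncomputable def toChainComplex (C : DGCoalgebra.{v, w} k) : ChainComplex (ModuleCat.{w} k) ℕ :=
  ChainComplex.of (fun n => ModuleCat.of k (C.X n)) (fun n => ModuleCat.ofHom (C.d n))
    (fun n => by rw [← ModuleCat.ofHom_comp, C.d_comp_d]; rfl)

theorem toChainComplex_d (C : DGCoalgebra.{v, w} k) (n : ℕ) :
    C.toChainComplex.d (n + 1) n = ModuleCat.ofHom (C.d n) :=
  ChainComplex.of_d (fun n => ModuleCat.of k (C.X n)) (fun n => ModuleCat.ofHom (C.d n)) n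

/-- The chain map underlying a morphism of differential graded coalgebras. -/
noncomputable def toChainMap {C D : DGCoalgebra.{v, w} k} (f : C ⟶ D) :
    C.toChainComplex ⟶ D.toChainComplex :=
  ChainComplex.ofHom (fun n => ModuleCat.ofHom (Hom.f f n)) (fun n => by
    rw [toChainComplex_d, toChainComplex_d]
    exact congrArg ModuleCat.ofHom (Hom.f_d f n).symm)

/-- A morphism of differential graded coalgebras is a quasi-isomorphism if the underlying chain map
induces isomorphisms on homology. -/
def IsQuasiIso {C D : DGCoalgebra.{v, w} k} (f : C ⟶ D) : Prop :=
  QuasiIso (toChainMap f)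

end DGCoalgebra

/-- Double sums with alternating signs cancel if the summands are symmetric with respect to
exchanging the order in which two indices are removed. -/
theorem sum_succAbove_eq_zero {M : Type*} [AddCommGroup M] {n : ℕ}
    (g : Fin (n + 2) → Fin (n + 1) → M)
    (hg : ∀ i j, g (i.succAbove j) (j.predAbove i) = g i j) :
    ∑ i : Fin (n + 2), ∑ j : Fin (n + 1), (-1 : ℤ) ^ (i + j : ℕ) • g i j = 0 := by
  rw [← Finset.sum_product']
  refine Finset.sum_involution (fun a _ => (a.1.succAbove a.2, a.2.predAbove a.1)) ?_ ?_ ?_ ?_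
  · rintro ⟨i, j⟩ -
    rw [hg, Fin.neg_one_pow_succAbove_add_predAbove, neg_smul, add_neg_cancel]
  · rintro ⟨i, j⟩ - - h
    exact Fin.succAbove_ne i j (congrArg Prod.fst h)
  · simp
  · rintro ⟨i, j⟩ -
    simp only [Prod.mk.injEq]
    exact ⟨Fin.succAbove_succAbove_predAbove _ _, by simp [Fin.predAbove_predAbove_succAbove]⟩


/-! ### The normalized chains on a simplicial set -/

namespace SimplicialChains

open Simplicial

variable (k : Type v) [CommRing k] (X : SSet.{u})

theorem map_mem_degenerate {X : SSet.{u}} {n : ℕ} {m : SimplexCategory} (f : ⦋n⦌ ⟶ m)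
    (hf : ¬ Function.Injective f.toOrderHom) (x : X.obj (Opposite.op m)) :
    X.map f.op x ∈ X.degenerate n := by
  cases n with
  | zero => exact absurd (Function.injective_of_subsingleton (α := Fin 1) _) hf
  | succ n =>
    obtain ⟨i, g, rfl⟩ := SimplexCategory.eq_σ_comp_of_not_injective f hf
    exact ⟨n, by omega, SimplexCategory.σ i, X.map g.op x, by simp⟩

theorem exists_eq_σ {X : SSet.{u}} {n : ℕ} {x : X _⦋n + 1⦌} (hx : x ∈ X.degenerate (n + 1)) :
    ∃ (i : Fin (n + 1)) (z : X _⦋n⦌), x = X.σ i z := by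
  rw [SSet.degenerate_eq_iUnion_range_σ] at hx
  simp only [Set.mem_iUnion, Set.mem_range] at hx
  obtain ⟨i, z, rfl⟩ := hx
  exact ⟨i, z, rfl⟩

/-- The differential `d x = ∑ i, (-1) ^ i d_i x`. -/
noncomputable def d (n : ℕ) :
    NormChains k (X.degenerate (n + 1)) →ₗ[k] NormChains k (X.degenerate n) :=
  NormChains.desc (fun x => ∑ i : Fin (n + 2), (-1 : ℤ) ^ (i : ℕ) • NormChains.mk k _ (X.δ i x)) (by
    intro x hx
    obtain ⟨i, z, rfl⟩ := exists_eq_σ hx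
    have key : ∀ j : Fin (n + 2), j ≠ i.castSucc ∧ j ≠ i.succ →
        X.δ j (X.σ i z) ∈ X.degenerate n := by
      rintro j ⟨h1, h2⟩
      have e : X.δ j (X.σ i z) =
          X.map (SimplexCategory.δ j ≫ SimplexCategory.σ i).op z := by
        simp [SimplicialObject.δ, SimplicialObject.σ]
      rw [e]
      apply map_mem_degenerate
      intro hinj
      obtain ⟨a, ha⟩ := Fin.exists_succAbove_eq (Ne.symm h1)
      obtain ⟨b, hb⟩ := Fin.exists_succAbove_eq (Ne.symm h2)
      have : a = b := hinj (by
        change Fin.predAbove i (Fin.succAbove j a) = Fin.predAbove i (Fin.succAbove j b)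
        rw [ha, hb]; simp)
      subst this
      have := ha.symm.trans hb
      simp [Fin.ext_iff] at this
    rw [Fintype.sum_eq_add i.castSucc i.succ (by simp [Fin.ext_iff])
      (fun j hj => by rw [NormChains.mk_eq_zero (key j hj), smul_zero])]
    have e1 : X.δ i.castSucc (X.σ i z) = z := by
      have := SimplicialObject.δ_comp_σ_self X (i := i)
      exact ConcreteCategory.congr_hom this z
    have e2 : X.δ i.succ (X.σ i z) = z := by
      have := SimplicialObject.δ_comp_σ_succ X (i := i)
      exact ConcreteCategory.congr_hom this z
    rw [e1, e2, ← add_smul]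
    simp [pow_succ])

/-- The component `x ↦ x(0 … p) ⊗ x(p … n)` of the diagonal, where `n = p + q`. -/
noncomputable def comul (p q n : ℕ) (h : p + q = n) :
    NormChains k (X.degenerate n) →ₗ[k]
      NormChains k (X.degenerate p) ⊗[k] NormChains k (X.degenerate q) :=
  NormChains.desc (fun x =>
      NormChains.mk k _ (X.map (SimplexCategory.subinterval 0 p (by omega)).op x) ⊗ₜ[k]
        NormChains.mk k _ (X.map (SimplexCategory.subinterval p q (by omega)).op x)) (by
    intro x hx
    cases n with
    | zero => simp at hx
    | succ n =>
      obtain ⟨i, z, rfl⟩ := exists_eq_σ hx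
      have e : ∀ (j l : ℕ) (hjl : j + l ≤ n + 1),
          X.map (SimplexCategory.subinterval j l hjl).op (X.σ i z) =
            X.map (SimplexCategory.subinterval j l hjl ≫ SimplexCategory.σ i).op z := by
        intro j l hjl
        simp [SimplicialObject.σ]
      have key : ∀ (j l : ℕ) (hjl : j + l ≤ n + 1), j ≤ i → (i : ℕ) < j + l →
          X.map (SimplexCategory.subinterval j l hjl).op (X.σ i z) ∈ X.degenerate l := by
        intro j l hjl h1 h2
        rw [e]
        apply map_mem_degenerate
        intro hinj
        have := @hinj ⟨i - j, by simp; omega⟩ ⟨i - j + 1, by simp; omega⟩ (by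
          change Fin.predAbove i ⟨i - j + j, _⟩ = Fin.predAbove i ⟨i - j + 1 + j, _⟩
          have a1 : (⟨i - j + j, by omega⟩ : Fin (n + 2)) = i.castSucc := by
            ext; simp; omega
          have a2 : (⟨i - j + 1 + j, by omega⟩ : Fin (n + 2)) = i.succ := by
            ext; simp; omega
          rw [a1, a2]; simp)
        simp at this
      by_cases hi : (i : ℕ) < p
      · rw [NormChains.mk_eq_zero (key 0 p (by omega) (by omega) (by omega)), zero_tmul]
      · rw [NormChains.mk_eq_zero (key p q (by omega) (by omega) (by omega)), tmul_zero])

/-- The augmentation sends every `0`-simplex to `1`. -/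
noncomputable def counit : NormChains k (X.degenerate 0) →ₗ[k] k :=
  NormChains.desc (fun _ => 1) (by simp)

theorem comul_d (p q n : ℕ) (h : p + q = n) :
    comul k X p q n h ∘ₗ d k X n =
      (d k X p).rTensor _ ∘ₗ comul k X (p + 1) q (n + 1) (by omega) +
        (-1 : ℤ) ^ p • ((d k X q).lTensor _ ∘ₗ comul k X p (q + 1) (n + 1) (by omega)) := by
  refine NormChains.hom_ext fun x => ?_
  subst h
  have hδ : ∀ {m l : ℕ} (f : ⦋l⦌ ⟶ ⦋m⦌) (i : Fin (m + 2)) (x : X _⦋m + 1⦌),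
      X.map f.op (X.δ i x) = X.map (f ≫ SimplexCategory.δ i).op x := by
    intro m l f i x; simp [SimplicialObject.δ]
  have hδ' : ∀ {m l : ℕ} (f : ⦋l + 1⦌ ⟶ ⦋m⦌) (i : Fin (l + 2)) (x : X _⦋m⦌),
      X.δ i (X.map f.op x) = X.map (SimplexCategory.δ i ≫ f).op x := by
    intro m l f i x; simp [SimplicialObject.δ]
  simp only [LinearMap.comp_apply, LinearMap.add_apply, LinearMap.smul_apply, d, comul,
    NormChains.desc_mk, map_sum, map_zsmul, LinearMap.rTensor_tmul, LinearMap.lTensor_tmul, hδ,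
    hδ', TensorProduct.sum_tmul, TensorProduct.tmul_sum, TensorProduct.smul_tmul',
    TensorProduct.tmul_smul, Finset.smul_sum]
  rw [← Equiv.sum_comp (finSumFinEquiv.trans (finCongr (by omega : p + 1 + (q + 1) = p + q + 2))),
    Fintype.sum_sum_type, Fin.sum_univ_castSucc (n := p + 1), Fin.sum_univ_succ (n := q + 1)]
  have s1 : (SimplexCategory.δ (Fin.last (p + 1)) ≫
      SimplexCategory.subinterval 0 (p + 1) (by omega) : ⦋p⦌ ⟶ ⦋p + q + 1⦌) =
      SimplexCategory.subinterval 0 p (by omega) := by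
    ext a : 3
    apply Fin.ext
    change ((Fin.last (p + 1)).succAbove a : ℕ) + 0 = (a : ℕ) + 0
    simp
  have s2 : (SimplexCategory.δ 0 ≫ SimplexCategory.subinterval p (q + 1) (by omega) :
      ⦋q⦌ ⟶ ⦋p + q + 1⦌) = SimplexCategory.subinterval (p + 1) q (by omega) := by
    ext a : 3
    apply Fin.ext
    change (Fin.succAbove 0 a : ℕ) + p = (a : ℕ) + (p + 1)
    simp
    omega
  have t1 : ∀ a : Fin (p + 1), (SimplexCategory.subinterval 0 p (by omega) : ⦋p⦌ ⟶ ⦋p + q⦌) ≫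
      SimplexCategory.δ (finCongr (by omega) (finSumFinEquiv (n := q + 1) (Sum.inl a))) =
      SimplexCategory.δ a.castSucc ≫ SimplexCategory.subinterval 0 (p + 1) (by omega) := by
    intro a
    ext b : 3
    apply Fin.ext
    change (Fin.succAbove (n := p + q + 1) (finCongr _ (finSumFinEquiv (Sum.inl a)))
      ⟨b + 0, _⟩ : ℕ) = (Fin.succAbove a.castSucc b : ℕ) + 0
    simp only [Fin.succAbove, Fin.lt_def, finSumFinEquiv_apply_left]
    simp
    split_ifs <;> simp
  have t2 : ∀ a : Fin (p + 1), (SimplexCategory.subinterval p q (by omega) : ⦋q⦌ ⟶ ⦋p + q⦌) ≫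
      SimplexCategory.δ (finCongr (by omega) (finSumFinEquiv (n := q + 1) (Sum.inl a))) =
      SimplexCategory.subinterval (p + 1) q (by omega) := by
    intro a
    ext b : 3
    apply Fin.ext
    change (Fin.succAbove (n := p + q + 1) (finCongr _ (finSumFinEquiv (Sum.inl a)))
      ⟨b + p, _⟩ : ℕ) = (b : ℕ) + (p + 1)
    have := a.2
    simp only [Fin.succAbove, Fin.lt_def, finSumFinEquiv_apply_left]
    simp
    split_ifs <;> simp <;> omega
  have t3 : ∀ a : Fin (q + 1), (SimplexCategory.subinterval 0 p (by omega) : ⦋p⦌ ⟶ ⦋p + q⦌) ≫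
      SimplexCategory.δ (finCongr (by omega) (finSumFinEquiv (m := p + 1) (Sum.inr a))) =
      SimplexCategory.subinterval 0 p (by omega) := by
    intro a
    ext b : 3
    apply Fin.ext
    change (Fin.succAbove (n := p + q + 1) (finCongr _ (finSumFinEquiv (Sum.inr a)))
      ⟨b + 0, _⟩ : ℕ) = (b : ℕ) + 0
    have : (b : ℕ) < p + 1 := b.2
    simp only [Fin.succAbove, Fin.lt_def, finSumFinEquiv_apply_right]
    simp
    split_ifs <;> simp <;> omega
  have t4 : ∀ a : Fin (q + 1), (SimplexCategory.subinterval p q (by omega) : ⦋q⦌ ⟶ ⦋p + q⦌) ≫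
      SimplexCategory.δ (finCongr (by omega) (finSumFinEquiv (m := p + 1) (Sum.inr a))) =
      SimplexCategory.δ a.succ ≫ SimplexCategory.subinterval p (q + 1) (by omega) := by
    intro a
    ext b : 3
    apply Fin.ext
    change (Fin.succAbove (n := p + q + 1) (finCongr _ (finSumFinEquiv (Sum.inr a)))
      ⟨b + p, _⟩ : ℕ) = (Fin.succAbove a.succ b : ℕ) + p
    simp only [Fin.succAbove, Fin.lt_def, finSumFinEquiv_apply_right]
    simp
    split_ifs <;> simp <;> omega
  have v1 : ∀ a : Fin (p + 1), ((finCongr (by omega : p + 1 + (q + 1) = p + q + 2)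
      (finSumFinEquiv (Sum.inl a)) : Fin (p + q + 2)) : ℕ) = a := by
    intro a; simp
  have v2 : ∀ a : Fin (q + 1), ((finCongr (by omega : p + 1 + (q + 1) = p + q + 2)
      (finSumFinEquiv (Sum.inr a)) : Fin (p + q + 2)) : ℕ) = p + 1 + a := by
    intro a; simp
  simp only [Equiv.trans_apply, t1, t2, t3, t4, v1, v2, s1, s2, Fin.val_castSucc, Fin.val_last,
    Fin.val_zero, Fin.val_succ, pow_zero, one_smul, smul_smul]
  have e : ∀ a : Fin (q + 1), (-1 : ℤ) ^ p * (-1) ^ ((a : ℕ) + 1) = (-1) ^ (p + 1 + (a : ℕ)) := by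
    intro a; ring
  simp only [e, pow_succ (-1 : ℤ) p, mul_neg, mul_one, neg_smul, TensorProduct.neg_tmul]
  abel

theorem d_comp_d (n : ℕ) : d k X n ∘ₗ d k X (n + 1) = 0 := by
  refine NormChains.hom_ext fun x => ?_
  simp only [LinearMap.comp_apply, d, NormChains.desc_mk, map_sum, map_zsmul, Finset.smul_sum,
    smul_smul, ← pow_add, LinearMap.zero_apply]
  refine sum_succAbove_eq_zero (fun i j => NormChains.mk k _ (X.δ j (X.δ i x))) fun i j => ?_
  have e : ∀ (i : Fin (n + 3)) (j : Fin (n + 2)), X.δ j (X.δ i x) =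
      X.map (SimplexCategory.δ j ≫ SimplexCategory.δ i).op x := by
    intro i j; simp [SimplicialObject.δ]
  have e' : SimplexCategory.δ (j.predAbove i) ≫ SimplexCategory.δ (i.succAbove j) =
      SimplexCategory.δ j ≫ SimplexCategory.δ i := by
    ext a : 3
    exact Fin.succAbove_succAbove_succAbove_predAbove i j a
  simp only [e, e']

/-- The normalized chain coalgebra of a simplicial set. -/
noncomputable def coalgebra : DGCoalgebra.{v, max u v} k where
  X n := NormChains k (X.degenerate n)
  d := d k X
  d_comp_d := d_comp_d k X
  comul := comul k X
  counit := counit k X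
  comul_d := comul_d k X
  counit_d := NormChains.hom_ext fun x => by
    simp [d, counit, Fin.sum_univ_two]
  coassoc p q r m m' n hm hm' h := NormChains.hom_ext fun x => by
    subst hm hm' h
    simp only [LinearMap.comp_apply, comul, NormChains.desc_mk, LinearMap.rTensor_tmul,
      LinearMap.lTensor_tmul, LinearEquiv.coe_coe, TensorProduct.assoc_tmul,
      ← Functor.map_comp_apply, ← op_comp]
    have e1 : SimplexCategory.subinterval 0 p (by omega) ≫
        SimplexCategory.subinterval 0 (p + q) (by omega) =
        (SimplexCategory.subinterval 0 p (by omega) : ⦋p⦌ ⟶ ⦋p + q + r⦌) := by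
      ext a : 3
      rfl
    have e2 : SimplexCategory.subinterval p q (by omega) ≫
        SimplexCategory.subinterval 0 (p + q) (by omega) =
        SimplexCategory.subinterval 0 q (by omega) ≫
        (SimplexCategory.subinterval p (q + r) (by omega) : ⦋q + r⦌ ⟶ ⦋p + q + r⦌) := by
      ext a : 3
      apply Fin.ext
      change (a : ℕ) + p + 0 = (a : ℕ) + 0 + p
      omega
    have e3 : SimplexCategory.subinterval q r (by omega) ≫
        SimplexCategory.subinterval p (q + r) (by omega) =
        (SimplexCategory.subinterval (p + q) r (by omega) : ⦋r⦌ ⟶ ⦋p + q + r⦌) := by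
      ext a : 3
      apply Fin.ext
      change (a : ℕ) + q + p = (a : ℕ) + (p + q)
      omega
    simp only [e1, e2, e3]
  counit_comul n := NormChains.hom_ext fun x => by
    have e : SimplexCategory.subinterval 0 n (by omega) = 𝟙 (⦋n⦌ : SimplexCategory) := rfl
    simp [comul, counit, e]
  comul_counit n := NormChains.hom_ext fun x => by
    have e : SimplexCategory.subinterval 0 n (by omega) = 𝟙 (⦋n⦌ : SimplexCategory) := rfl
    simp [comul, counit, e]

variable {X} in
theorem app_mem_degenerate {Y : SSet.{u}} (f : X ⟶ Y) {n : ℕ} {x : X _⦋n⦌}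
    (hx : x ∈ X.degenerate n) : f.app _ x ∈ Y.degenerate n := by
  obtain ⟨m, hm, g, z, rfl⟩ := hx
  exact ⟨m, hm, g, f.app _ z, by simp⟩

/-- The map induced on normalized chains by a simplicial map. -/
noncomputable def map {X Y : SSet.{u}} (f : X ⟶ Y) (n : ℕ) :
    NormChains k (X.degenerate n) →ₗ[k] NormChains k (Y.degenerate n) :=
  NormChains.desc (fun x => NormChains.mk k _ (f.app _ x))
    fun _ hx => NormChains.mk_eq_zero (app_mem_degenerate f hx)

/-- The morphism of coalgebras induced by a simplicial map. -/
noncomputable def coalgebraMap {X Y : SSet.{u}} (f : X ⟶ Y) :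
    DGCoalgebra.Hom (coalgebra k X) (coalgebra k Y) where
  f := map k f
  f_d n := by
    change map k f n ∘ₗ d k X n = d k Y n ∘ₗ map k f (n + 1)
    refine NormChains.hom_ext fun x => ?_
    simp [map, d, SimplicialObject.δ]
  comul_f p q n h := by
    change comul k Y p q n h ∘ₗ map k f n =
      TensorProduct.map (map k f p) (map k f q) ∘ₗ comul k X p q n h
    refine NormChains.hom_ext fun x => ?_
    simp [map, comul]
  counit_f := by
    change counit k Y ∘ₗ map k f 0 = counit k X
    refine NormChains.hom_ext fun x => ?_
    simp [map, counit]

/-- The functor of normalized simplicial chains, with values in differential graded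
coalgebras. -/
noncomputable def functor : SSet.{u} ⥤ DGCoalgebra.{v, max u v} k where
  obj X := coalgebra k X
  map f := coalgebraMap k f
  map_id X := DGCoalgebra.Hom.ext (funext fun n => by
    change map k (𝟙 X) n = LinearMap.id
    refine NormChains.hom_ext fun x => ?_
    simp [map])
  map_comp f g := DGCoalgebra.Hom.ext (funext fun n => by
    change map k (f ≫ g) n = map k g n ∘ₗ map k f n
    refine NormChains.hom_ext fun x => ?_
    simp [map])

end SimplicialChains


/-! ### Cubical sets -/

/-- A cubical set (with connections). The directions `1, …, n` of an `n`-cube are numbered as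
`0, …, n - 1`, so that `d ε i`, `s i` and `conn i` are the operators usually denoted by
`d^ε_{i+1}`, `s_{i+1}` and `γ_{i+1}`. Accordingly, the identities are stated with their indices
shifted, with one identity for each case. -/
structure CubicalSet where
  /-- the `n`-cubes -/
  cube : ℕ → Type u
  /-- face operators -/
  d : ∀ {n : ℕ}, Fin 2 → Fin (n + 1) → cube (n + 1) → cube n
  /-- degeneracy operators -/
  s : ∀ {n : ℕ}, Fin (n + 1) → cube n → cube (n + 1)
  /-- connection operators -/
  conn : ∀ {n : ℕ}, Fin (n + 1) → cube (n + 1) → cube (n + 2)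
  d_d : ∀ {n : ℕ} (ε ε' : Fin 2) (i j : Fin (n + 1)) (y : cube (n + 2)), i ≤ j →
    d ε i (d ε' j.succ y) = d ε' j (d ε i.castSucc y)
  s_s : ∀ {n : ℕ} (i j : Fin (n + 1)) (y : cube n), i ≤ j →
    s i.castSucc (s j y) = s j.succ (s i y)
  d_s_of_lt : ∀ {n : ℕ} (ε : Fin 2) (i j : Fin (n + 1)) (y : cube (n + 1)), i ≤ j →
    d ε i.castSucc (s j.succ y) = s j (d ε i y)
  d_s_self : ∀ {n : ℕ} (ε : Fin 2) (i : Fin (n + 1)) (y : cube n), d ε i (s i y) = y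
  d_s_of_gt : ∀ {n : ℕ} (ε : Fin 2) (i j : Fin (n + 1)) (y : cube (n + 1)), j ≤ i →
    d ε i.succ (s j.castSucc y) = s j (d ε i y)
  conn_conn : ∀ {n : ℕ} (i j : Fin (n + 1)) (y : cube (n + 1)), i ≤ j →
    conn i.castSucc (conn j y) = conn j.succ (conn i y)
  d_conn_of_lt : ∀ {n : ℕ} (ε : Fin 2) (i j : Fin (n + 1)) (y : cube (n + 2)), i ≤ j →
    d ε i.castSucc.castSucc (conn j.succ y) = conn j (d ε i.castSucc y)
  d_zero_castSucc_conn : ∀ {n : ℕ} (j : Fin (n + 1)) (y : cube (n + 1)),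
    d 0 j.castSucc (conn j y) = s j (d 0 j y)
  d_zero_succ_conn : ∀ {n : ℕ} (j : Fin (n + 1)) (y : cube (n + 1)),
    d 0 j.succ (conn j y) = s j (d 0 j y)
  d_one_castSucc_conn : ∀ {n : ℕ} (j : Fin (n + 1)) (y : cube (n + 1)),
    d 1 j.castSucc (conn j y) = y
  d_one_succ_conn : ∀ {n : ℕ} (j : Fin (n + 1)) (y : cube (n + 1)), d 1 j.succ (conn j y) = y
  d_conn_of_gt : ∀ {n : ℕ} (ε : Fin 2) (i j : Fin (n + 1)) (y : cube (n + 2)), j ≤ i →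
    d ε i.succ.succ (conn j.castSucc y) = conn j (d ε i.succ y)
  conn_s_of_lt : ∀ {n : ℕ} (i j : Fin (n + 1)) (y : cube (n + 1)), i ≤ j →
    conn i.castSucc (s j.succ y) = s j.succ.succ (conn i y)
  conn_s_self : ∀ {n : ℕ} (i : Fin (n + 1)) (y : cube n), conn i (s i y) = s i.succ (s i y)
  conn_s_of_gt : ∀ {n : ℕ} (i j : Fin (n + 1)) (y : cube (n + 1)), j ≤ i →
    conn i.succ (s j.castSucc y) = s j.castSucc.castSucc (conn i y)

namespace CubicalSet

/-- A morphism of cubical sets: a family of maps commuting with all operators. -/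
@[ext]
structure Hom (Y Z : CubicalSet.{u}) where
  /-- the map on `n`-cubes -/
  app : ∀ n, Y.cube n → Z.cube n
  app_d : ∀ {n : ℕ} (ε : Fin 2) (i : Fin (n + 1)) (y : Y.cube (n + 1)),
    app n (Y.d ε i y) = Z.d ε i (app (n + 1) y)
  app_s : ∀ {n : ℕ} (i : Fin (n + 1)) (y : Y.cube n), app (n + 1) (Y.s i y) = Z.s i (app n y)
  app_conn : ∀ {n : ℕ} (i : Fin (n + 1)) (y : Y.cube (n + 1)),
    app (n + 2) (Y.conn i y) = Z.conn i (app (n + 1) y)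

instance : Category CubicalSet.{u} where
  Hom := Hom
  id Y := ⟨fun _ y => y, fun _ _ _ => rfl, fun _ _ => rfl, fun _ _ => rfl⟩
  comp f g := ⟨fun n y => g.app n (f.app n y), fun _ _ _ => by rw [f.app_d, g.app_d],
    fun _ _ => by rw [f.app_s, g.app_s], fun _ _ => by rw [f.app_conn, g.app_conn]⟩

variable (Y : CubicalSet.{u})

/-- The cubes that are degenerate or folded (in the image of a connection). -/
inductive Thin : ∀ {n : ℕ}, Y.cube n → Prop
  | s {n : ℕ} (i : Fin (n + 1)) (y : Y.cube n) : Thin (Y.s i y)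
  | conn {n : ℕ} (i : Fin (n + 1)) (y : Y.cube (n + 1)) : Thin (Y.conn i y)

/-- The set of `n`-cubes that are degenerate or folded. -/
def thin (n : ℕ) : Set (Y.cube n) := {y | Y.Thin y}

theorem d_s_of_ne {n : ℕ} (ε : Fin 2) (m : Fin (n + 2)) (i : Fin (n + 1)) (y : Y.cube (n + 1)) :
    ∃ m', Y.d ε m (Y.s (m.succAbove i) y) = Y.s i (Y.d ε m' y) := by
  rcases Fin.lt_or_ge i.castSucc m with h | h
  · rw [Fin.succAbove_of_castSucc_lt _ _ h]
    obtain ⟨m', rfl⟩ := Fin.eq_succ_of_ne_zero (Fin.ne_zero_of_lt h)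
    exact ⟨m', Y.d_s_of_gt _ _ _ _ (Fin.castSucc_lt_succ_iff.1 h)⟩
  · rw [Fin.succAbove_of_le_castSucc _ _ h]
    have hm : m ≠ Fin.last _ := Fin.ne_last_of_lt (lt_of_le_of_lt h (Fin.castSucc_lt_last i))
    obtain ⟨m', rfl⟩ := Fin.exists_castSucc_eq.2 hm
    exact ⟨m', Y.d_s_of_lt _ _ _ _ (Fin.castSucc_le_castSucc_iff.1 h)⟩

theorem thin_d_s {n : ℕ} (ε : Fin 2) (m i : Fin (n + 1)) (h : m ≠ i) (y : Y.cube n) :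
    Y.Thin (Y.d ε m (Y.s i y)) := by
  cases n with
  | zero => exact absurd (Subsingleton.elim (α := Fin 1) m i) h
  | succ n =>
    obtain ⟨i, rfl⟩ := Fin.exists_succAbove_eq (Ne.symm h)
    obtain ⟨m', e⟩ := Y.d_s_of_ne ε m i y
    rw [e]
    exact .s _ _

theorem d_conn_of_ne {n : ℕ} (ε : Fin 2) (m : Fin (n + 3)) (i : Fin (n + 2)) (y : Y.cube (n + 2))
    (h1 : m ≠ i.castSucc) (h2 : m ≠ i.succ) :
    ∃ (m' : Fin (n + 2)) (i' : Fin (n + 1)), i.castSucc = m.succAbove i'.castSucc ∧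
      i.succ = m.succAbove i'.succ ∧ Y.d ε m (Y.conn i y) = Y.conn i' (Y.d ε m' y) := by
  rcases lt_or_gt_of_ne h1 with h | h
  · obtain ⟨i, rfl⟩ := Fin.eq_succ_of_ne_zero (i := i) (by
      rintro rfl; simp at h)
    have hm : (m : ℕ) ≤ i := by
      have := Fin.lt_def.1 h
      simp at this
      omega
    obtain ⟨a, rfl⟩ : ∃ a : Fin (n + 1), m = a.castSucc.castSucc :=
      ⟨⟨m, by omega⟩, rfl⟩
    refine ⟨a.castSucc, i, ?_, ?_, Y.d_conn_of_lt _ _ _ _ (Fin.le_def.2 hm)⟩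
    · rw [Fin.succAbove_of_le_castSucc]
      · ext; simp
      · exact Fin.le_def.2 (by simpa using hm)
    · rw [Fin.succAbove_of_le_castSucc]
      exact Fin.le_def.2 (by simp at hm ⊢; omega)
  · have hm : (i : ℕ) + 1 < m := by
      have a1 := Fin.lt_def.1 h
      have a2 : (m : ℕ) ≠ i + 1 := fun e => h2 (Fin.ext (by simpa using e))
      simp at a1
      omega
    obtain ⟨a, rfl⟩ : ∃ a : Fin (n + 1), m = a.succ.succ :=
      ⟨⟨m - 2, by omega⟩, Fin.ext (by simp; omega)⟩
    simp at hm
    obtain ⟨i, rfl⟩ : ∃ b : Fin (n + 1), i = b.castSucc := ⟨⟨i, by omega⟩, rfl⟩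
    simp at hm
    refine ⟨a.succ, i, ?_, ?_, Y.d_conn_of_gt _ _ _ _ (Fin.le_def.2 (by omega))⟩
    · rw [Fin.succAbove_of_castSucc_lt]
      exact Fin.lt_def.2 (by simp; omega)
    · rw [Fin.succAbove_of_castSucc_lt]
      · ext; simp
      · exact Fin.lt_def.2 (by simp; omega)

theorem d_d_succAbove {n : ℕ} (ε ε' : Fin 2) (i : Fin (n + 2)) (j : Fin (n + 1))
    (y : Y.cube (n + 2)) :
    Y.d ε' (j.predAbove i) (Y.d ε (i.succAbove j) y) = Y.d ε j (Y.d ε' i y) := by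
  rcases Fin.lt_or_ge j.castSucc i with h | h
  · rw [Fin.succAbove_of_castSucc_lt _ _ h, Fin.predAbove_of_castSucc_lt _ _ h]
    obtain ⟨i, rfl⟩ := Fin.eq_succ_of_ne_zero (Fin.ne_zero_of_lt h)
    rw [Fin.pred_succ, Y.d_d _ _ _ _ _ (Fin.castSucc_lt_succ_iff.1 h)]
  · rw [Fin.succAbove_of_le_castSucc _ _ h, Fin.predAbove_of_le_castSucc _ _ h]
    have hi : i ≠ Fin.last _ := Fin.ne_last_of_lt (lt_of_le_of_lt h (Fin.castSucc_lt_last j))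
    obtain ⟨i, rfl⟩ := Fin.exists_castSucc_eq.2 hi
    rw [Fin.castPred_castSucc, Y.d_d _ _ _ _ _ (Fin.castSucc_le_castSucc_iff.1 h)]

/-! ### Iterated faces -/

end CubicalSet

/-- An increasing map that omits the value `i`, with `i` removed from its range. -/
def eraseEmb {p n : ℕ} (α : Fin p ↪o Fin (n + 1)) (i : Fin (n + 1)) (hi : i ∉ Set.range α) :
    Fin p ↪o Fin n :=
  OrderEmbedding.ofStrictMono
    (fun j => (finSuccAboveOrderIso i).symm ⟨α j, fun e => hi ⟨j, e⟩⟩)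
    (fun _ _ h => (finSuccAboveOrderIso i).symm.strictMono (Subtype.mk_lt_mk.2 (α.strictMono h)))

theorem succAbove_eraseEmb {p n : ℕ} (α : Fin p ↪o Fin (n + 1)) (i : Fin (n + 1))
    (hi : i ∉ Set.range α) (j : Fin p) : i.succAbove (eraseEmb α i hi j) = α j := by
  have := (finSuccAboveOrderIso i).apply_symm_apply ⟨α j, fun e => hi ⟨j, e⟩⟩
  exact congrArg Subtype.val this

theorem eraseEmb_eq {p n : ℕ} {α : Fin p ↪o Fin (n + 1)} {i : Fin (n + 1)}
    (hi : i ∉ Set.range α) {β : Fin p ↪o Fin n} (h : ∀ j, i.succAbove (β j) = α j) :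
    eraseEmb α i hi = β := by
  ext j : 1
  exact Fin.succAbove_right_injective ((succAbove_eraseEmb α i hi j).trans (h j).symm)

theorem eq_of_range_eq_univ {p n : ℕ} (α : Fin p ↪o Fin n) (h : ∀ i, i ∈ Set.range α) : p = n := by
  simpa using Fintype.card_congr (Equiv.ofBijective α ⟨α.injective, h⟩)

namespace CubicalSet

variable (Y : CubicalSet.{u})

open Classical in
/-- The iterated face of an `n`-cube `y` that keeps the directions in the range of `α` and sets each
other direction `i` to the end point `c i`: the face operators `d (c i) i` for all `i` outside the
range of `α` are applied to `y`, starting with the largest such `i`. -/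
noncomputable def iterFace : ∀ {n p : ℕ}, (Fin p ↪o Fin n) → (Fin n → Fin 2) →
    Y.cube n → Y.cube p
  | 0, _, α, _, y => cast (congrArg Y.cube (eq_of_range_eq_univ α fun i => i.elim0).symm) y
  | n + 1, _, α, c, y =>
    if h : (Finset.univ.filter fun i : Fin (n + 1) => i ∉ Set.range α).Nonempty then
      iterFace (eraseEmb α (Finset.max' _ h) (Finset.mem_filter.1 (Finset.max'_mem _ h)).2)
        (fun j => c ((Finset.max' _ h).succAbove j)) (Y.d (c (Finset.max' _ h)) (Finset.max' _ h) y)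
    else cast (congrArg Y.cube (eq_of_range_eq_univ α fun i => by
      by_contra hi
      exact h ⟨i, Finset.mem_filter.2 ⟨Finset.mem_univ _, hi⟩⟩).symm) y

theorem orderEmb_eq_refl {n : ℕ} (α : Fin n ↪o Fin n) : α = RelEmbedding.refl _ := by
  have h : Set.range α = Set.range (RelEmbedding.refl (· ≤ ·) : Fin n ↪o Fin n) := by
    rw [(Finite.injective_iff_surjective.1 α.injective).range_eq]
    simp
  ext i : 1
  exact congrFun (StrictMono.range_inj α.strictMono
    (OrderEmbedding.strictMono (RelEmbedding.refl (· ≤ ·) : Fin n ↪o Fin n)) |>.1 h) i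

theorem iterFace_id {n : ℕ} (α : Fin n ↪o Fin n) (c : Fin n → Fin 2) (y : Y.cube n) :
    Y.iterFace α c y = y := by
  obtain rfl := orderEmb_eq_refl α
  cases n with
  | zero => simp [iterFace]
  | succ n =>
    rw [iterFace, dif_neg]
    · simp
    · rintro ⟨i, hi⟩
      simp at hi

theorem exists_iterFace_eq {n p : ℕ} (α : Fin p ↪o Fin (n + 1)) (c : Fin (n + 1) → Fin 2)
    (y : Y.cube (n + 1)) (i : Fin (n + 1)) (hi : i ∉ Set.range α) :
    ∃ (m : Fin (n + 1)) (hm : m ∉ Set.range α),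
      Y.iterFace α c y = Y.iterFace (eraseEmb α m hm) (fun j => c (m.succAbove j))
        (Y.d (c m) m y) := by
  classical
  have h : (Finset.univ.filter fun i : Fin (n + 1) => i ∉ Set.range α).Nonempty :=
    ⟨i, Finset.mem_filter.2 ⟨Finset.mem_univ _, hi⟩⟩
  refine ⟨_, (Finset.mem_filter.1 (Finset.max'_mem _ h)).2, ?_⟩
  rw [iterFace, dif_pos]

theorem iterFace_of_notMem {n : ℕ} : ∀ {p : ℕ} (α : Fin p ↪o Fin (n + 1)) (c : Fin (n + 1) → Fin 2)
    (y : Y.cube (n + 1)) (i : Fin (n + 1)) (hi : i ∉ Set.range α),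
    Y.iterFace α c y =
      Y.iterFace (eraseEmb α i hi) (fun j => c (i.succAbove j)) (Y.d (c i) i y) := by
  induction n with
  | zero =>
    intro p α c y i hi
    obtain ⟨m, hm, e⟩ := Y.exists_iterFace_eq α c y i hi
    obtain rfl : m = i := Subsingleton.elim (α := Fin 1) _ _
    exact e
  | succ n ih =>
    intro p α c y i hi
    obtain ⟨m, hm, e⟩ := Y.exists_iterFace_eq α c y i hi
    rw [e]
    clear e
    by_cases hmi : m = i
    · subst hmi; rfl
    obtain ⟨i', rfl⟩ := Fin.exists_succAbove_eq (Ne.symm hmi)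
    have h1 : i' ∉ Set.range (eraseEmb α m hm) := by
      rintro ⟨j, rfl⟩
      exact hi ⟨j, (succAbove_eraseEmb _ _ _ _).symm⟩
    have h2 : i'.predAbove m ∉ Set.range (eraseEmb α (m.succAbove i') hi) := by
      rintro ⟨j, hj⟩
      refine hm ⟨j, ?_⟩
      rw [← succAbove_eraseEmb α (m.succAbove i') hi, hj, Fin.succAbove_succAbove_predAbove]
    rw [ih _ _ _ i' h1, ih _ _ _ (i'.predAbove m) h2]
    simp only [Fin.succAbove_succAbove_predAbove, Fin.succAbove_succAbove_succAbove_predAbove]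
    rw [Y.d_d_succAbove]
    congr 1
    refine eraseEmb_eq _ fun j => Fin.succAbove_right_injective (p := m) ?_
    rw [succAbove_eraseEmb, ← Fin.succAbove_succAbove_succAbove_predAbove, succAbove_eraseEmb,
      succAbove_eraseEmb]

theorem iterFace_congr {n p : ℕ} (α : Fin p ↪o Fin n) (c c' : Fin n → Fin 2)
    (h : ∀ i, i ∉ Set.range α → c i = c' i) (y : Y.cube n) :
    Y.iterFace α c y = Y.iterFace α c' y := by
  induction n with
  | zero => congr 1; funext i; exact i.elim0
  | succ n ih =>
    by_cases hs : ∀ i, i ∈ Set.range α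
    · obtain rfl := eq_of_range_eq_univ α hs
      rw [iterFace_id, iterFace_id]
    · push Not at hs
      obtain ⟨i, hi⟩ := hs
      rw [Y.iterFace_of_notMem _ _ _ i hi, Y.iterFace_of_notMem _ _ _ i hi, h i hi]
      refine ih _ _ _ (fun j hj => h _ ?_) _
      rintro ⟨x, hx⟩
      exact hj ⟨x, Fin.succAbove_right_injective ((succAbove_eraseEmb α i hi x).trans hx)⟩

theorem iterFace_iterFace {n p q : ℕ} (α : Fin p ↪o Fin n) (β : Fin q ↪o Fin p)
    (γ : Fin q ↪o Fin n) (c c'' : Fin n → Fin 2) (c' : Fin p → Fin 2)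
    (hγ : ∀ j, γ j = α (β j)) (h : ∀ i, i ∉ Set.range α → c'' i = c i)
    (h' : ∀ i, i ∉ Set.range β → c'' (α i) = c' i) (y : Y.cube n) :
    Y.iterFace β c' (Y.iterFace α c y) = Y.iterFace γ c'' y := by
  have key : ∀ (n : ℕ) (α : Fin p ↪o Fin n) (γ : Fin q ↪o Fin n) (c c'' : Fin n → Fin 2)
      (_ : ∀ j, γ j = α (β j)) (_ : ∀ i, i ∉ Set.range α → c'' i = c i)
      (_ : ∀ i, i ∉ Set.range β → c'' (α i) = c' i) (y : Y.cube n) (_ : ∀ i, i ∈ Set.range α),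
      Y.iterFace β c' (Y.iterFace α c y) = Y.iterFace γ c'' y := by
    intro n α γ c c'' hγ h h' y hs
    obtain rfl := eq_of_range_eq_univ α hs
    rw [iterFace_id]
    obtain rfl := orderEmb_eq_refl α
    obtain rfl : γ = β := by ext j : 1; exact hγ j
    exact Y.iterFace_congr _ _ _ (fun i hi => (h' i hi).symm) _
  induction n with
  | zero => exact key 0 α γ c c'' hγ h h' y fun i => i.elim0
  | succ n ih =>
    by_cases hs : ∀ i, i ∈ Set.range α
    · exact key _ α γ c c'' hγ h h' y hs
    · push Not at hs
      obtain ⟨i, hi⟩ := hs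
      have hi' : i ∉ Set.range γ := by
        rintro ⟨j, rfl⟩
        exact hi ⟨β j, (hγ j).symm⟩
      rw [Y.iterFace_of_notMem α _ _ i hi, Y.iterFace_of_notMem γ _ _ i hi', h i hi]
      refine ih _ _ _ _ (fun j => ?_) (fun j hj => h _ ?_) (fun j hj => ?_) _
      · apply Fin.succAbove_right_injective (p := i)
        rw [succAbove_eraseEmb, succAbove_eraseEmb, hγ]
      · rintro ⟨x, hx⟩
        exact hj ⟨x, Fin.succAbove_right_injective ((succAbove_eraseEmb α i hi x).trans hx)⟩
      · rw [succAbove_eraseEmb]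
        exact h' j hj

theorem iterFace_succAbove {n : ℕ} (i : Fin (n + 1)) (c : Fin (n + 1) → Fin 2)
    (y : Y.cube (n + 1)) : Y.iterFace i.succAboveOrderEmb c y = Y.d (c i) i y := by
  rw [Y.iterFace_of_notMem _ _ _ i (by
    rintro ⟨j, hj⟩
    exact Fin.succAbove_ne i j hj), iterFace_id]

theorem thin_iterFace_s {n p : ℕ} (α : Fin p ↪o Fin (n + 1)) (c : Fin (n + 1) → Fin 2)
    (i : Fin (n + 1)) (hi : i ∈ Set.range α) (y : Y.cube n) :
    Y.Thin (Y.iterFace α c (Y.s i y)) := by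
  induction n with
  | zero =>
    have hs : ∀ i, i ∈ Set.range α := fun j => (Subsingleton.elim (α := Fin 1) i j) ▸ hi
    obtain rfl := eq_of_range_eq_univ α hs
    rw [iterFace_id]
    exact .s _ _
  | succ n ih =>
    by_cases hs : ∀ i, i ∈ Set.range α
    · obtain rfl := eq_of_range_eq_univ α hs
      rw [iterFace_id]
      exact .s _ _
    · push Not at hs
      obtain ⟨m, hm⟩ := hs
      rw [Y.iterFace_of_notMem _ _ _ m hm]
      obtain ⟨j, rfl⟩ := hi
      rw [← succAbove_eraseEmb α m hm j]
      obtain ⟨m', e⟩ := Y.d_s_of_ne (c m) m (eraseEmb α m hm j) y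
      rw [e]
      exact ih _ _ _ ⟨j, rfl⟩ _

theorem thin_iterFace_conn {n p : ℕ} (α : Fin p ↪o Fin (n + 2)) (c : Fin (n + 2) → Fin 2)
    (i : Fin (n + 1))
    (h : i.castSucc ∈ Set.range α ∧ i.succ ∈ Set.range α ∨
      i.castSucc ∈ Set.range α ∧ c i.succ = 0 ∨ i.succ ∈ Set.range α ∧ c i.castSucc = 0)
    (y : Y.cube (n + 1)) : Y.Thin (Y.iterFace α c (Y.conn i y)) := by
  by_cases h1 : i.castSucc ∈ Set.range α
  swap
  · have hc : i.succ ∈ Set.range α ∧ c i.castSucc = 0 := by tauto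
    rw [Y.iterFace_of_notMem _ _ _ _ h1, hc.2, Y.d_zero_castSucc_conn]
    refine Y.thin_iterFace_s _ _ _ ?_ _
    obtain ⟨⟨j, hj⟩, -⟩ := hc
    refine ⟨j, Fin.succAbove_right_injective (p := i.castSucc) ?_⟩
    rw [succAbove_eraseEmb, hj, Fin.succAbove_castSucc_self]
  by_cases h2 : i.succ ∈ Set.range α
  swap
  · have hc : c i.succ = 0 := by tauto
    rw [Y.iterFace_of_notMem _ _ _ _ h2, hc, Y.d_zero_succ_conn]
    refine Y.thin_iterFace_s _ _ _ ?_ _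
    obtain ⟨j, hj⟩ := h1
    refine ⟨j, Fin.succAbove_right_injective (p := i.succ) ?_⟩
    rw [succAbove_eraseEmb, hj, Fin.succAbove_succ_self]
  clear h
  induction n with
  | zero =>
    have hs : ∀ i, i ∈ Set.range α := by
      intro j
      obtain rfl : i = 0 := Subsingleton.elim (α := Fin 1) _ _
      fin_cases j
      · exact h1
      · exact h2
    obtain rfl := eq_of_range_eq_univ α hs
    rw [iterFace_id]
    exact .conn _ _
  | succ n ih =>
    by_cases hs : ∀ i, i ∈ Set.range α
    · obtain rfl := eq_of_range_eq_univ α hs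
      rw [iterFace_id]
      exact .conn _ _
    · push Not at hs
      obtain ⟨m, hm⟩ := hs
      rw [Y.iterFace_of_notMem _ _ _ m hm]
      obtain ⟨m', i', e1, e2, e3⟩ := Y.d_conn_of_ne (c m) m i y (fun e => hm (e ▸ h1))
        (fun e => hm (e ▸ h2))
      rw [e3]
      obtain ⟨j1, hj1⟩ := h1
      obtain ⟨j2, hj2⟩ := h2
      refine ih _ _ _ _ ⟨j1, Fin.succAbove_right_injective (p := m) ?_⟩
        ⟨j2, Fin.succAbove_right_injective (p := m) ?_⟩
      · rw [succAbove_eraseEmb, hj1, e1]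
      · rw [succAbove_eraseEmb, hj2, e2]

end CubicalSet


/-! ### Shuffles -/

/-- A `(p, q)`-shuffle of `{0, …, n - 1}`: a partition into the images of the increasing sequences
`α` of length `p` and `β` of length `q` (so that `n = p + q`). -/
@[ext]
structure Shuffle (p q n : ℕ) where
  /-- the first part, in increasing order -/
  α : Fin p ↪o Fin n
  /-- the second part, in increasing order -/
  β : Fin q ↪o Fin n
  disjoint : ∀ i j, α i ≠ β j
  cover : ∀ x, x ∈ Set.range α ∨ x ∈ Set.range β

/-- `(-1) ^ m`, where `m` is the number of pairs `(i, j)` with `α i > β j`. -/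
def inversionSign {p q n : ℕ} (α : Fin p ↪o Fin n) (β : Fin q ↪o Fin n) : ℤ :=
  ∏ i, ∏ j, if β j < α i then -1 else 1

namespace Shuffle

variable {p q r n : ℕ}

theorem toFun_injective : Function.Injective
    (fun S : Shuffle p q n => ((fun i => S.α i, fun j => S.β j) : (Fin p → Fin n) × (Fin q → Fin n))) := by
  intro S T h
  simp only [Prod.mk.injEq] at h
  ext i : 3
  · exact congrArg Fin.val (congrFun h.1 i)
  · exact congrArg Fin.val (congrFun h.2 i)

noncomputable instance : Fintype (Shuffle p q n) :=
  Fintype.ofInjective _ toFun_injective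

/-- The sign of the permutation that sends `(0, …, n - 1)` to `(α₀, …, α_{p-1}, β₀, …, β_{q-1})`,
computed from its number of inversions. -/
def sign (S : Shuffle p q n) : ℤ := inversionSign S.α S.β

theorem mem_range_β (S : Shuffle p q n) {x : Fin n} : x ∈ Set.range S.β ↔ x ∉ Set.range S.α :=
  ⟨by rintro ⟨j, rfl⟩ ⟨i, hi⟩; exact S.disjoint i j hi, (S.cover x).resolve_left⟩

theorem mem_range_α (S : Shuffle p q n) {x : Fin n} : x ∈ Set.range S.α ↔ x ∉ Set.range S.β := by
  rw [S.mem_range_β, not_not]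

end Shuffle

theorem orderEmb_ext_range {p n : ℕ} {α β : Fin p ↪o Fin n} (h : Set.range α = Set.range β) :
    α = β := by
  ext i : 1
  exact congrFun ((StrictMono.range_inj α.strictMono β.strictMono).1 h) i

theorem exists_orderEmb_union {p q n : ℕ} (a : Fin p ↪o Fin n) (b : Fin q ↪o Fin n)
    (h : ∀ i j, a i ≠ b j) : ∃ α : Fin (p + q) ↪o Fin n,
      Set.range α = Set.range a ∪ Set.range b := by
  classical
  have hd : Disjoint (Finset.univ.map a.toEmbedding) (Finset.univ.map b.toEmbedding) := by
    rw [Finset.disjoint_left]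
    simp only [Finset.mem_map, Finset.mem_univ, true_and, not_exists]
    rintro x ⟨i, rfl⟩ j hj
    exact h i j hj.symm
  refine ⟨(Finset.disjUnion _ _ hd).orderEmbOfFin (by
    rw [Finset.card_disjUnion]; simp), ?_⟩
  rw [Finset.range_orderEmbOfFin]
  ext x
  simp

theorem exists_orderEmb_factor {p m n : ℕ} (α : Fin m ↪o Fin n) (a : Fin p ↪o Fin n)
    (h : Set.range a ⊆ Set.range α) : ∃ a' : Fin p ↪o Fin m, a'.trans α = a := by
  choose f hf using fun i => h ⟨i, rfl⟩
  refine ⟨OrderEmbedding.ofStrictMono f fun i j hij => ?_, ?_⟩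
  · rw [← α.lt_iff_lt, hf, hf]
    exact a.strictMono hij
  · ext i : 1
    exact hf i

theorem trans_left_cancel {p m n : ℕ} {α : Fin m ↪o Fin n} {a b : Fin p ↪o Fin m}
    (h : a.trans α = b.trans α) : a = b := by
  ext i : 1
  exact α.injective (DFunLike.congr_fun h i)

/-- The one-element sequence with value `i`. -/
def constEmb {n : ℕ} (i : Fin n) : Fin 1 ↪o Fin n :=
  OrderEmbedding.ofStrictMono (fun _ => i) (fun a b h => absurd h (by simp [Subsingleton.elim a b]))

/-- Partitions of `{0, …, n - 1}` into three parts. -/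
@[ext]
structure TriShuffle (p q r n : ℕ) where
  /-- the first part -/
  a : Fin p ↪o Fin n
  /-- the second part -/
  b : Fin q ↪o Fin n
  /-- the third part -/
  c : Fin r ↪o Fin n
  hab : ∀ i j, a i ≠ b j
  hac : ∀ i j, a i ≠ c j
  hbc : ∀ i j, b i ≠ c j
  cover : ∀ x, x ∈ Set.range a ∨ x ∈ Set.range b ∨ x ∈ Set.range c

namespace TriShuffle

variable {p q r n : ℕ}

noncomputable instance : Fintype (TriShuffle p q r n) :=
  Fintype.ofInjective (fun T : TriShuffle p q r n =>
    ((fun i => T.a i, fun i => T.b i, fun i => T.c i) :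
      (Fin p → Fin n) × (Fin q → Fin n) × (Fin r → Fin n))) (by
    intro S T h
    simp only [Prod.mk.injEq] at h
    ext i : 3
    · exact congrArg Fin.val (congrFun h.1 i)
    · exact congrArg Fin.val (congrFun h.2.1 i)
    · exact congrArg Fin.val (congrFun h.2.2 i))

theorem sum_left {M : Type*} [AddCommMonoid M] {m : ℕ} (hm : p + q = m)
    (F : (Fin p ↪o Fin n) → (Fin q ↪o Fin n) → (Fin r ↪o Fin n) → M) :
    ∑ S : Shuffle m r n, ∑ S' : Shuffle p q m,
      F (S'.α.trans S.α) (S'.β.trans S.α) S.β = ∑ T : TriShuffle p q r n, F T.a T.b T.c := by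
  subst hm
  rw [← Finset.sum_product', Finset.univ_product_univ]
  let e : Shuffle (p + q) r n × Shuffle p q (p + q) → TriShuffle p q r n := fun S =>
    { a := S.2.α.trans S.1.α
      b := S.2.β.trans S.1.α
      c := S.1.β
      hab := fun i j h => S.2.disjoint i j (S.1.α.injective h)
      hac := fun i j => S.1.disjoint _ _
      hbc := fun i j => S.1.disjoint _ _
      cover := fun x => by
        rcases S.1.cover x with ⟨y, rfl⟩ | h
        · rcases S.2.cover y with ⟨z, rfl⟩ | ⟨z, rfl⟩
          · exact Or.inl ⟨z, rfl⟩
          · exact Or.inr (Or.inl ⟨z, rfl⟩)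
        · exact Or.inr (Or.inr h) }
  refine Fintype.sum_bijective e ⟨?_, ?_⟩ _ _ fun _ => rfl
  · rintro ⟨S, S'⟩ ⟨T, T'⟩ h
    have h1 : S'.α.trans S.α = T'.α.trans T.α := congrArg TriShuffle.a h
    have h2 : S'.β.trans S.α = T'.β.trans T.α := congrArg TriShuffle.b h
    have h3 : S.β = T.β := congrArg TriShuffle.c h
    obtain rfl : S = T := Shuffle.ext (orderEmb_ext_range (by
      ext x; rw [S.mem_range_α, T.mem_range_α, h3])) h3
    obtain rfl : S' = T' := Shuffle.ext (trans_left_cancel h1) (trans_left_cancel h2)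
    rfl
  · intro T
    obtain ⟨α, hα⟩ := exists_orderEmb_union T.a T.b T.hab
    obtain ⟨a, ha⟩ := exists_orderEmb_factor α T.a (by rw [hα]; exact Set.subset_union_left)
    obtain ⟨b, hb⟩ := exists_orderEmb_factor α T.b (by rw [hα]; exact Set.subset_union_right)
    have ha' : ∀ i, α (a i) = T.a i := fun i => DFunLike.congr_fun ha i
    have hb' : ∀ i, α (b i) = T.b i := fun i => DFunLike.congr_fun hb i
    refine ⟨(⟨α, T.c, ?_, ?_⟩, ⟨a, b, ?_, ?_⟩), TriShuffle.ext ha hb rfl⟩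
    · intro i j h
      have : α i ∈ Set.range T.a ∪ Set.range T.b := hα ▸ ⟨i, rfl⟩
      rcases this with ⟨x, hx⟩ | ⟨x, hx⟩
      · exact T.hac x j (hx.trans h)
      · exact T.hbc x j (hx.trans h)
    · intro x
      rw [hα]
      rcases T.cover x with h | h | h
      · exact Or.inl (Or.inl h)
      · exact Or.inl (Or.inr h)
      · exact Or.inr h
    · intro i j h
      exact T.hab i j (by rw [← ha', ← hb', h])
    · intro x
      have : α x ∈ Set.range T.a ∪ Set.range T.b := hα ▸ ⟨x, rfl⟩
      rcases this with ⟨y, hy⟩ | ⟨y, hy⟩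
      · exact Or.inl ⟨y, α.injective ((ha' y).trans hy)⟩
      · exact Or.inr ⟨y, α.injective ((hb' y).trans hy)⟩

theorem sum_right {M : Type*} [AddCommMonoid M] {m : ℕ} (hm : q + r = m)
    (F : (Fin p ↪o Fin n) → (Fin q ↪o Fin n) → (Fin r ↪o Fin n) → M) :
    ∑ S : Shuffle p m n, ∑ S' : Shuffle q r m,
      F S.α (S'.α.trans S.β) (S'.β.trans S.β) = ∑ T : TriShuffle p q r n, F T.a T.b T.c := by
  subst hm
  rw [← Finset.sum_product', Finset.univ_product_univ]
  let e : Shuffle p (q + r) n × Shuffle q r (q + r) → TriShuffle p q r n := fun S =>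
    { a := S.1.α
      b := S.2.α.trans S.1.β
      c := S.2.β.trans S.1.β
      hab := fun i j => S.1.disjoint _ _
      hac := fun i j => S.1.disjoint _ _
      hbc := fun i j h => S.2.disjoint i j (S.1.β.injective h)
      cover := fun x => by
        rcases S.1.cover x with h | ⟨y, rfl⟩
        · exact Or.inl h
        · rcases S.2.cover y with ⟨z, rfl⟩ | ⟨z, rfl⟩
          · exact Or.inr (Or.inl ⟨z, rfl⟩)
          · exact Or.inr (Or.inr ⟨z, rfl⟩) }
  refine Fintype.sum_bijective e ⟨?_, ?_⟩ _ _ fun _ => rfl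
  · rintro ⟨S, S'⟩ ⟨T, T'⟩ h
    have h1 : S.α = T.α := congrArg TriShuffle.a h
    have h2 : S'.α.trans S.β = T'.α.trans T.β := congrArg TriShuffle.b h
    have h3 : S'.β.trans S.β = T'.β.trans T.β := congrArg TriShuffle.c h
    obtain rfl : S = T := Shuffle.ext h1 (orderEmb_ext_range (by
      ext x; rw [S.mem_range_β, T.mem_range_β, h1]))
    obtain rfl : S' = T' := Shuffle.ext (trans_left_cancel h2) (trans_left_cancel h3)
    rfl
  · intro T
    obtain ⟨β, hβ⟩ := exists_orderEmb_union T.b T.c T.hbc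
    obtain ⟨a, ha⟩ := exists_orderEmb_factor β T.b (by rw [hβ]; exact Set.subset_union_left)
    obtain ⟨b, hb⟩ := exists_orderEmb_factor β T.c (by rw [hβ]; exact Set.subset_union_right)
    have ha' : ∀ i, β (a i) = T.b i := fun i => DFunLike.congr_fun ha i
    have hb' : ∀ i, β (b i) = T.c i := fun i => DFunLike.congr_fun hb i
    refine ⟨(⟨T.a, β, ?_, ?_⟩, ⟨a, b, ?_, ?_⟩), TriShuffle.ext rfl ha hb⟩
    · intro i j h
      have : β j ∈ Set.range T.b ∪ Set.range T.c := hβ ▸ ⟨j, rfl⟩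
      rcases this with ⟨x, hx⟩ | ⟨x, hx⟩
      · exact T.hab i x (h.trans hx.symm)
      · exact T.hac i x (h.trans hx.symm)
    · intro x
      rw [hβ]
      exact T.cover x
    · intro i j h
      exact T.hbc i j (by rw [← ha', ← hb', h])
    · intro x
      have : β x ∈ Set.range T.b ∪ Set.range T.c := hβ ▸ ⟨x, rfl⟩
      rcases this with ⟨y, hy⟩ | ⟨y, hy⟩
      · exact Or.inl ⟨y, β.injective ((ha' y).trans hy)⟩
      · exact Or.inr ⟨y, β.injective ((hb' y).trans hy)⟩

theorem sum_middle {M : Type*} [AddCommMonoid M]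
    (F : (Fin p ↪o Fin (n + 1)) → (Fin 1 ↪o Fin (n + 1)) → (Fin r ↪o Fin (n + 1)) → M) :
    ∑ i : Fin (n + 1), ∑ S : Shuffle p r n,
      F (S.α.trans i.succAboveOrderEmb) (constEmb i) (S.β.trans i.succAboveOrderEmb) =
        ∑ T : TriShuffle p 1 r (n + 1), F T.a T.b T.c := by
  rw [← Finset.sum_product', Finset.univ_product_univ]
  let e : Fin (n + 1) × Shuffle p r n → TriShuffle p 1 r (n + 1) := fun S =>
    { a := S.2.α.trans S.1.succAboveOrderEmb
      b := constEmb S.1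
      c := S.2.β.trans S.1.succAboveOrderEmb
      hab := fun i j => Fin.succAbove_ne _ _
      hac := fun i j h => S.2.disjoint i j (Fin.succAbove_right_injective h)
      hbc := fun i j => (Fin.succAbove_ne _ _).symm
      cover := fun x => by
        by_cases hx : x = S.1
        · exact Or.inr (Or.inl ⟨0, hx.symm⟩)
        · obtain ⟨y, rfl⟩ := Fin.exists_succAbove_eq hx
          rcases S.2.cover y with ⟨z, rfl⟩ | ⟨z, rfl⟩
          · exact Or.inl ⟨z, rfl⟩
          · exact Or.inr (Or.inr ⟨z, rfl⟩) }
  refine Fintype.sum_bijective e ⟨?_, ?_⟩ _ _ fun _ => rfl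
  · rintro ⟨i, S⟩ ⟨j, T⟩ h
    obtain rfl : i = j := DFunLike.congr_fun (congrArg TriShuffle.b h) 0
    obtain rfl : S = T := Shuffle.ext (trans_left_cancel (congrArg TriShuffle.a h))
      (trans_left_cancel (congrArg TriShuffle.c h))
    rfl
  · intro T
    have h1 : Set.range (T.b 0).succAboveOrderEmb = {T.b 0}ᶜ := Fin.range_succAbove _
    obtain ⟨a, ha⟩ := exists_orderEmb_factor (T.b 0).succAboveOrderEmb T.a (by
      rw [h1]; rintro _ ⟨i, rfl⟩; exact T.hab i 0)
    obtain ⟨c, hc⟩ := exists_orderEmb_factor (T.b 0).succAboveOrderEmb T.c (by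
      rw [h1]; rintro _ ⟨i, rfl⟩; exact (T.hbc 0 i).symm)
    have ha' : ∀ i, (T.b 0).succAbove (a i) = T.a i := fun i => DFunLike.congr_fun ha i
    have hc' : ∀ i, (T.b 0).succAbove (c i) = T.c i := fun i => DFunLike.congr_fun hc i
    refine ⟨(T.b 0, ⟨a, c, ?_, ?_⟩), TriShuffle.ext ha ?_ hc⟩
    · intro i j h
      exact T.hac i j (by rw [← ha', ← hc', h])
    · intro x
      rcases T.cover ((T.b 0).succAbove x) with ⟨y, hy⟩ | ⟨y, hy⟩ | ⟨y, hy⟩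
      · exact Or.inl ⟨y, Fin.succAbove_right_injective ((ha' y).trans hy)⟩
      · rw [Subsingleton.elim y 0] at hy
        exact absurd hy.symm (Fin.succAbove_ne _ _)
      · exact Or.inr ⟨y, Fin.succAbove_right_injective ((hc' y).trans hy)⟩
    · ext i : 1
      rw [Subsingleton.elim i 0]
      rfl

end TriShuffle

namespace Shuffle

variable {p q r n : ℕ}

/-- The shuffle that puts one element last. -/
def single (i : Fin (n + 1)) : Shuffle n 1 (n + 1) where
  α := i.succAboveOrderEmb
  β := constEmb i
  disjoint _ _ := Fin.succAbove_ne _ _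
  cover x := by
    by_cases hx : x = i
    · exact Or.inr ⟨0, hx.symm⟩
    · exact Or.inl (Fin.exists_succAbove_eq hx)

/-- The shuffle that exchanges the two parts. -/
def swap (S : Shuffle p q n) : Shuffle q p n where
  α := S.β
  β := S.α
  disjoint i j := (S.disjoint j i).symm
  cover x := (S.cover x).symm

theorem single_bijective : Function.Bijective (single (n := n)) := by
  refine ⟨fun i j h => DFunLike.congr_fun (congrArg Shuffle.β h) 0, fun S => ⟨S.β 0, ?_⟩⟩
  have h : (single (S.β 0)).β = S.β := by
    ext i : 1
    rw [Subsingleton.elim i 0]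
    rfl
  refine Shuffle.ext (orderEmb_ext_range ?_) h
  ext x
  rw [mem_range_α, mem_range_α, h]

theorem sum_single {M : Type*} [AddCommMonoid M]
    (F : (Fin n ↪o Fin (n + 1)) → (Fin 1 ↪o Fin (n + 1)) → M) :
    ∑ S : Shuffle n 1 (n + 1), F S.α S.β =
      ∑ i : Fin (n + 1), F i.succAboveOrderEmb (constEmb i) :=
  (Fintype.sum_bijective single single_bijective _ _ fun _ => rfl).symm

theorem sum_single' {M : Type*} [AddCommMonoid M]
    (F : (Fin 1 ↪o Fin (n + 1)) → (Fin n ↪o Fin (n + 1)) → M) :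
    ∑ S : Shuffle 1 n (n + 1), F S.α S.β =
      ∑ i : Fin (n + 1), F (constEmb i) i.succAboveOrderEmb :=
  (Fintype.sum_bijective (fun i => (single i).swap)
    (Function.Bijective.comp (g := swap) ⟨fun _ _ h => Shuffle.ext (congrArg Shuffle.β h)
      (congrArg Shuffle.α h), fun S => ⟨S.swap, rfl⟩⟩ single_bijective) _ _ fun _ => rfl).symm

theorem sum_left_single {M : Type*} [AddCommMonoid M]
    (F : (Fin p ↪o Fin n) → (Fin 1 ↪o Fin n) → (Fin r ↪o Fin n) → M) :
    ∑ S : Shuffle (p + 1) r n, ∑ j : Fin (p + 1),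
      F (j.succAboveOrderEmb.trans S.α) ((constEmb j).trans S.α) S.β =
        ∑ T : TriShuffle p 1 r n, F T.a T.b T.c := by
  rw [← TriShuffle.sum_left rfl F]
  exact Finset.sum_congr rfl fun S _ =>
    (sum_single (fun a b => F (a.trans S.α) (b.trans S.α) S.β)).symm

theorem sum_right_single {M : Type*} [AddCommMonoid M]
    (F : (Fin p ↪o Fin n) → (Fin 1 ↪o Fin n) → (Fin r ↪o Fin n) → M) :
    ∑ S : Shuffle p (r + 1) n, ∑ j : Fin (r + 1),
      F S.α ((constEmb j).trans S.β) (j.succAboveOrderEmb.trans S.β) =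
        ∑ T : TriShuffle p 1 r n, F T.a T.b T.c := by
  rw [← TriShuffle.sum_right (Nat.add_comm 1 r) F]
  exact Finset.sum_congr rfl fun S _ =>
    (sum_single' (fun b c => F S.α (b.trans S.β) (c.trans S.β))).symm

theorem prod_eq {M : Type*} [CommMonoid M] (S : Shuffle p q n) (g : Fin n → M) :
    ∏ x, g x = (∏ i, g (S.α i)) * ∏ j, g (S.β j) := by
  have := Fintype.prod_sum_type (fun x : Fin p ⊕ Fin q => g (Sum.elim S.α S.β x))
  simp only [Sum.elim_inl, Sum.elim_inr] at this
  rw [← this]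
  refine (Fintype.prod_bijective (Sum.elim S.α S.β) ⟨?_, ?_⟩ _ _ fun _ => rfl).symm
  · exact Function.Injective.sumElim S.α.injective S.β.injective S.disjoint
  · intro x
    rcases S.cover x with ⟨i, rfl⟩ | ⟨i, rfl⟩
    · exact ⟨Sum.inl i, rfl⟩
    · exact ⟨Sum.inr i, rfl⟩

theorem inversionSign_left {m : ℕ} (S : Shuffle p q m) (α : Fin m ↪o Fin n) (β : Fin r ↪o Fin n) :
    inversionSign α β = inversionSign (S.α.trans α) β * inversionSign (S.β.trans α) β :=
  S.prod_eq _

theorem inversionSign_right {m : ℕ} (S : Shuffle p q m) (α : Fin r ↪o Fin n) (β : Fin m ↪o Fin n) :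
    inversionSign α β = inversionSign α (S.α.trans β) * inversionSign α (S.β.trans β) := by
  unfold inversionSign
  rw [← Finset.prod_mul_distrib]
  exact Finset.prod_congr rfl fun i _ => S.prod_eq _

end Shuffle

theorem inversionSign_trans {p q m n : ℕ} (a : Fin p ↪o Fin m) (b : Fin q ↪o Fin m)
    (α : Fin m ↪o Fin n) : inversionSign (a.trans α) (b.trans α) = inversionSign a b := by
  simp [inversionSign]

theorem neg_one_pow_eq_inversionSign {n : ℕ} (i : Fin (n + 1)) :
    (-1 : ℤ) ^ (i : ℕ) = inversionSign (constEmb i) i.succAboveOrderEmb := by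
  have h : ∀ j : Fin n, i.succAbove j < i ↔ (j : ℕ) < i := fun j => by
    rw [Fin.succAbove_lt_iff_castSucc_lt, Fin.lt_def]; rfl
  have h' : inversionSign (constEmb i) i.succAboveOrderEmb =
      ∏ j : Fin n, if (j : ℕ) < i then -1 else 1 := by
    rw [inversionSign, Finset.univ_unique, Finset.prod_singleton]
    exact Finset.prod_congr rfl fun j _ => if_congr (h j) rfl rfl
  rw [h', Finset.prod_ite, Finset.prod_const, Finset.prod_const_one, mul_one,
    Fin.card_filter_val_lt, min_eq_right (Nat.le_of_lt_succ i.2)]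

theorem inversionSign_comm {p n : ℕ} (a : Fin p ↪o Fin n) (b : Fin 1 ↪o Fin n)
    (h : ∀ i j, a i ≠ b j) : (-1 : ℤ) ^ p * inversionSign a b = inversionSign b a := by
  have h1 : (-1 : ℤ) ^ p = ∏ _i : Fin p, (-1 : ℤ) := by simp
  have h2 : ∀ f : Fin 1 → ℤ, ∏ j, f j = f 0 := fun f => by simp
  simp only [inversionSign, h2]
  rw [h1, ← Finset.prod_mul_distrib]
  refine Finset.prod_congr rfl fun i _ => ?_
  rcases lt_or_gt_of_ne (h i 0) with hi | hi
  · simp [hi, hi.le.not_gt]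
  · simp [hi, hi.le.not_gt]


/-! ### The normalized chains on a cubical set -/

namespace CubicalChains

variable (k : Type v) [CommRing k] (Y : CubicalSet.{u})

variable {Y} in
theorem mk_thin {n : ℕ} {y : Y.cube n} (h : Y.Thin y) : NormChains.mk k (Y.thin n) y = 0 :=
  NormChains.mk_eq_zero h

/-- The value `ε` at `i`, and `e` elsewhere. -/
def endPoint {n : ℕ} (e : Fin 2) (i : Fin n) (ε : Fin 2) : Fin n → Fin 2 :=
  fun x => if x = i then ε else e

/-- The differential `d y = ∑ i, (-1) ^ i (d^0_i y - d^1_i y)`, with directions numbered from `1`. -/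
noncomputable def d (n : ℕ) :
    NormChains k (Y.thin (n + 1)) →ₗ[k] NormChains k (Y.thin n) :=
  NormChains.desc (fun y => ∑ i : Fin (n + 1), (-1 : ℤ) ^ ((i : ℕ) + 1) •
      (NormChains.mk k (Y.thin n) (Y.d 0 i y) - NormChains.mk k (Y.thin n) (Y.d 1 i y))) (by
    rintro _ (⟨i, y⟩ | ⟨i, y⟩)
    · refine Finset.sum_eq_zero fun j _ => ?_
      by_cases h : j = i
      · subst h
        rw [Y.d_s_self, Y.d_s_self, sub_self, smul_zero]
      · rw [mk_thin k (Y.thin_d_s _ _ _ h _), mk_thin k (Y.thin_d_s _ _ _ h _), sub_zero,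
          smul_zero]
    · rename_i n
      rw [Fintype.sum_eq_add i.castSucc i.succ (by simp [Fin.ext_iff]) ?_]
      · rw [Y.d_zero_castSucc_conn, Y.d_one_castSucc_conn, Y.d_zero_succ_conn, Y.d_one_succ_conn,
          ← add_smul]
        simp [pow_succ]
      · rintro j ⟨h1, h2⟩
        cases n with
        | zero =>
          obtain rfl : i = 0 := Subsingleton.elim (α := Fin 1) _ _
          fin_cases j
          · exact absurd rfl h1
          · exact absurd rfl h2
        | succ n =>
          obtain ⟨_, _, -, -, ha⟩ := Y.d_conn_of_ne 0 j i y h1 h2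
          obtain ⟨_, _, -, -, hb⟩ := Y.d_conn_of_ne 1 j i y h1 h2
          rw [ha, hb, mk_thin k (CubicalSet.Thin.conn _ _),
            mk_thin k (CubicalSet.Thin.conn _ _), sub_zero, smul_zero])

/-- The component of the Serre diagonal: the sum over all shuffles `(α, β)` of
`(-1)^(α, β) d^0_β y ⊗ d^1_α y`. -/
noncomputable def comul (p q n : ℕ) :
    NormChains k (Y.thin n) →ₗ[k] NormChains k (Y.thin p) ⊗[k] NormChains k (Y.thin q) :=
  NormChains.desc (fun y => ∑ S : Shuffle p q n, S.sign •
      (NormChains.mk k (Y.thin p) (Y.iterFace S.α (fun _ => 0) y) ⊗ₜ[k]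
        NormChains.mk k (Y.thin q) (Y.iterFace S.β (fun _ => 1) y))) (by
    intro y hy
    refine Finset.sum_eq_zero fun S _ => ?_
    suffices h : Y.Thin (Y.iterFace S.α (fun _ => 0) y) ∨ Y.Thin (Y.iterFace S.β (fun _ => 1) y) by
      rcases h with h | h
      · rw [mk_thin k h, zero_tmul, smul_zero]
      · rw [mk_thin k h, tmul_zero, smul_zero]
    rcases hy with ⟨i, y⟩ | ⟨i, y⟩
    · exact (S.cover i).imp (fun h => Y.thin_iterFace_s _ _ _ h _)
        (fun h => Y.thin_iterFace_s _ _ _ h _)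
    · rcases S.cover i.castSucc with h1 | h1
      · exact Or.inl (Y.thin_iterFace_conn _ _ _ (Or.inr (Or.inl ⟨h1, rfl⟩)) _)
      · rcases S.cover i.succ with h2 | h2
        · exact Or.inl (Y.thin_iterFace_conn _ _ _ (Or.inr (Or.inr ⟨h2, rfl⟩)) _)
        · exact Or.inr (Y.thin_iterFace_conn _ _ _ (Or.inl ⟨h1, h2⟩) _))

/-- The augmentation sends every `0`-cube to `1`. -/
noncomputable def counit : NormChains k (Y.thin 0) →ₗ[k] k :=
  NormChains.desc (fun _ => 1) (fun _ h => by
    exfalso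
    generalize hn : (0 : ℕ) = n at *
    cases h <;> omega)

theorem d_comp_d (n : ℕ) : d k Y n ∘ₗ d k Y (n + 1) = 0 := by
  refine NormChains.hom_ext fun y => ?_
  simp only [LinearMap.comp_apply, d, NormChains.desc_mk, map_sum, map_zsmul, map_sub,
    Finset.smul_sum, smul_smul, LinearMap.zero_apply, ← Finset.sum_sub_distrib, ← smul_sub]
  have := sum_succAbove_eq_zero (n := n) (fun i j =>
    NormChains.mk k (Y.thin n) (Y.d 0 j (Y.d 0 i y)) -
      NormChains.mk k (Y.thin n) (Y.d 1 j (Y.d 0 i y)) -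
      (NormChains.mk k (Y.thin n) (Y.d 0 j (Y.d 1 i y)) -
        NormChains.mk k (Y.thin n) (Y.d 1 j (Y.d 1 i y)))) (fun i j => by
    simp only [Y.d_d_succAbove]
    abel)
  rw [← this]
  refine Finset.sum_congr rfl fun i _ => Finset.sum_congr rfl fun j _ => ?_
  congr 1
  ring

theorem d_iterFace {n p : ℕ} (α : Fin (p + 1) ↪o Fin n) (e ε : Fin 2) (j : Fin (p + 1))
    (y : Y.cube n) : Y.d ε j (Y.iterFace α (fun _ => e) y) =
      Y.iterFace (j.succAboveOrderEmb.trans α) (endPoint e (α j) ε) y := by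
  have h := Y.iterFace_succAbove j (fun _ => ε) (Y.iterFace α (fun _ => e) y)
  rw [← h]
  refine Y.iterFace_iterFace _ _ _ _ _ _ (fun _ => rfl) (fun i hi => ?_) (fun i hi => ?_) y
  · exact if_neg fun h => hi ⟨j, h.symm⟩
  · refine if_pos (congrArg α ?_)
    by_contra hij
    exact hi (Fin.exists_succAbove_eq hij)

theorem iterFace_d {n p : ℕ} (α : Fin p ↪o Fin n) (e ε : Fin 2) (i : Fin (n + 1))
    (y : Y.cube (n + 1)) : Y.iterFace α (fun _ => e) (Y.d ε i y) =
      Y.iterFace (α.trans i.succAboveOrderEmb) (endPoint e i ε) y := by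
  have h := Y.iterFace_succAbove i (endPoint e i ε) y
  rw [show endPoint e i ε i = ε from if_pos rfl] at h
  rw [← h]
  exact Y.iterFace_iterFace _ _ _ _ _ _ (fun _ => rfl) (fun _ _ => rfl)
    (fun j _ => if_neg (Fin.succAbove_ne i j)) y

theorem iterFace_endPoint {n p : ℕ} (α : Fin p ↪o Fin n) (e : Fin 2) (i : Fin n) (y : Y.cube n) :
    Y.iterFace α (fun _ => e) y = Y.iterFace α (endPoint e i e) y := by
  congr 1
  funext x
  simp [endPoint]

/-- The summands in the proof that the diagonal is a chain map. -/
noncomputable def term {p q n : ℕ} (y : Y.cube n) (ε ε' : Fin 2) (a : Fin p ↪o Fin n)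
    (b : Fin 1 ↪o Fin n) (c : Fin q ↪o Fin n) :
    NormChains k (Y.thin p) ⊗[k] NormChains k (Y.thin q) :=
  (-(inversionSign b a * inversionSign b c * inversionSign a c)) •
    (NormChains.mk k (Y.thin p) (Y.iterFace a (endPoint 0 (b 0) ε) y) ⊗ₜ[k]
      NormChains.mk k (Y.thin q) (Y.iterFace c (endPoint 1 (b 0) ε') y))

theorem comul_d (p q n : ℕ) :
    comul k Y p q n ∘ₗ d k Y n =
      (d k Y p).rTensor _ ∘ₗ comul k Y (p + 1) q (n + 1) +
        (-1 : ℤ) ^ p • ((d k Y q).lTensor _ ∘ₗ comul k Y p (q + 1) (n + 1)) := by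
  refine NormChains.hom_ext fun y => ?_
  simp only [LinearMap.comp_apply, LinearMap.add_apply, LinearMap.smul_apply, d, comul,
    NormChains.desc_mk, map_sum, map_zsmul, map_sub, LinearMap.rTensor_tmul, LinearMap.lTensor_tmul,
    TensorProduct.sum_tmul, TensorProduct.tmul_sum]
  have h1 : ∀ (i : Fin (n + 1)) (S : Shuffle p q n) (ε : Fin 2),
      (-1 : ℤ) ^ ((i : ℕ) + 1) • S.sign •
        (NormChains.mk k (Y.thin p) (Y.iterFace S.α (fun _ => 0) (Y.d ε i y)) ⊗ₜ[k]
          NormChains.mk k (Y.thin q) (Y.iterFace S.β (fun _ => 1) (Y.d ε i y))) =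
      term k Y y ε ε (S.α.trans i.succAboveOrderEmb) (constEmb i)
        (S.β.trans i.succAboveOrderEmb) := by
    intro i S ε
    rw [term, iterFace_d, iterFace_d, inversionSign_trans, smul_smul, pow_succ,
      neg_one_pow_eq_inversionSign, S.inversionSign_right, Shuffle.sign]
    congr 1
    ring
  have h2 : ∀ (S : Shuffle (p + 1) q (n + 1)) (j : Fin (p + 1)) (ε : Fin 2),
      S.sign • (-1 : ℤ) ^ ((j : ℕ) + 1) •
        (NormChains.mk k (Y.thin p) (Y.d ε j (Y.iterFace S.α (fun _ => 0) y)) ⊗ₜ[k]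
          NormChains.mk k (Y.thin q) (Y.iterFace S.β (fun _ => 1) y)) =
      term k Y y ε 1 (j.succAboveOrderEmb.trans S.α) ((constEmb j).trans S.α) S.β := by
    intro S j ε
    rw [term, d_iterFace, iterFace_endPoint Y S.β 1 (S.α j), inversionSign_trans, smul_smul,
      pow_succ, neg_one_pow_eq_inversionSign, Shuffle.sign,
      (Shuffle.single j).inversionSign_left S.α S.β]
    congr 1
    simp only [Shuffle.single]
    ring
  have h3 : ∀ (S : Shuffle p (q + 1) (n + 1)) (j : Fin (q + 1)) (ε : Fin 2),
      (-1 : ℤ) ^ p • S.sign • (-1 : ℤ) ^ ((j : ℕ) + 1) •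
        (NormChains.mk k (Y.thin p) (Y.iterFace S.α (fun _ => 0) y) ⊗ₜ[k]
          NormChains.mk k (Y.thin q) (Y.d ε j (Y.iterFace S.β (fun _ => 1) y))) =
      term k Y y 0 ε S.α ((constEmb j).trans S.β) (j.succAboveOrderEmb.trans S.β) := by
    intro S j ε
    rw [term, d_iterFace, iterFace_endPoint Y S.α 0 (S.β j), inversionSign_trans,
      ← inversionSign_comm S.α ((constEmb j).trans S.β) (fun _ _ => S.disjoint _ _), smul_smul,
      smul_smul, pow_succ, neg_one_pow_eq_inversionSign, Shuffle.sign,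
      (Shuffle.single j).inversionSign_right S.α S.β]
    congr 1
    simp only [Shuffle.single]
    ring
  simp only [smul_sub, Finset.smul_sum, Finset.sum_sub_distrib, TensorProduct.smul_tmul',
    TensorProduct.sub_tmul, TensorProduct.tmul_sub, TensorProduct.tmul_smul] at h1 h2 h3 ⊢
  simp only [h1, h2, h3]
  rw [TriShuffle.sum_middle (term k Y y 0 0), TriShuffle.sum_middle (term k Y y 1 1),
    Shuffle.sum_left_single (term k Y y 0 1), Shuffle.sum_left_single (term k Y y 1 1),
    Shuffle.sum_right_single (term k Y y 0 0), Shuffle.sum_right_single (term k Y y 0 1)]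
  abel

open Classical in
/-- The summands in the proof of coassociativity. -/
noncomputable def triTerm {p q r n : ℕ} (y : Y.cube n) (a : Fin p ↪o Fin n) (b : Fin q ↪o Fin n)
    (c : Fin r ↪o Fin n) :
    NormChains k (Y.thin p) ⊗[k] (NormChains k (Y.thin q) ⊗[k] NormChains k (Y.thin r)) :=
  (inversionSign a b * inversionSign a c * inversionSign b c) •
    (NormChains.mk k (Y.thin p) (Y.iterFace a (fun _ => 0) y) ⊗ₜ[k]
      (NormChains.mk k (Y.thin q)
        (Y.iterFace b (fun x => if x ∈ Set.range a then 1 else 0) y) ⊗ₜ[k]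
        NormChains.mk k (Y.thin r) (Y.iterFace c (fun _ => 1) y)))

theorem coassoc (p q r m m' n : ℕ) (hm : p + q = m) (hm' : q + r = m') :
    (TensorProduct.assoc k (NormChains k (Y.thin p)) (NormChains k (Y.thin q))
      (NormChains k (Y.thin r))).toLinearMap ∘ₗ (comul k Y p q m).rTensor _ ∘ₗ comul k Y m r n =
      (comul k Y q r m').lTensor _ ∘ₗ comul k Y p m' n := by
  classical
  refine NormChains.hom_ext fun y => ?_
  simp only [LinearMap.comp_apply, comul, NormChains.desc_mk, map_sum, map_zsmul,
    LinearMap.rTensor_tmul, LinearMap.lTensor_tmul, TensorProduct.sum_tmul, TensorProduct.tmul_sum,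
    ← TensorProduct.smul_tmul', TensorProduct.tmul_smul, LinearEquiv.coe_coe, Finset.smul_sum]
  have e3 : ∀ (z : ℤ) (t : (NormChains k (Y.thin p) ⊗[k] NormChains k (Y.thin q)) ⊗[k]
      NormChains k (Y.thin r)), TensorProduct.assoc k _ _ _ (z • t) =
        z • TensorProduct.assoc k _ _ _ t := fun z t => map_zsmul _ _ _
  refine Eq.trans ?_ ((TriShuffle.sum_left hm (triTerm k Y y)).trans
    ((TriShuffle.sum_right hm' (triTerm k Y y)).symm.trans ?_))
  · refine Finset.sum_congr rfl fun S _ => Finset.sum_congr rfl fun S' _ => ?_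
    have e1 := Y.iterFace_iterFace S.α S'.α (S'.α.trans S.α) (fun _ => 0) (fun _ => 0) (fun _ => 0)
      (fun _ => rfl) (fun _ _ => rfl) (fun _ _ => rfl) y
    have e2 := Y.iterFace_iterFace S.α S'.β (S'.β.trans S.α) (fun _ => 0)
      (fun x => if x ∈ Set.range (S'.α.trans S.α) then 1 else 0) (fun _ => 1)
      (fun _ => rfl) (fun x hx => if_neg (by
        rintro ⟨i, rfl⟩
        exact hx ⟨S'.α i, rfl⟩)) (fun i hi => if_pos (by
        obtain ⟨j, rfl⟩ := S'.mem_range_α.2 hi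
        exact ⟨j, rfl⟩)) y
    rw [triTerm, e1, e2, inversionSign_trans]
    erw [e3]
    rw [TensorProduct.assoc_tmul, smul_smul,
      Shuffle.sign, Shuffle.sign, S'.inversionSign_left S.α S.β]
    congr 1
    ring
  · refine Finset.sum_congr rfl fun S _ => Finset.sum_congr rfl fun S' _ => ?_
    have e1 := Y.iterFace_iterFace S.β S'.β (S'.β.trans S.β) (fun _ => 1) (fun _ => 1) (fun _ => 1)
      (fun _ => rfl) (fun _ _ => rfl) (fun _ _ => rfl) y
    have e2 := Y.iterFace_iterFace S.β S'.α (S'.α.trans S.β) (fun _ => 1)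
      (fun x => if x ∈ Set.range S.α then 1 else 0) (fun _ => 0)
      (fun _ => rfl) (fun x hx => if_pos (S.mem_range_α.2 hx)) (fun i _ => if_neg (by
        rintro ⟨j, hj⟩
        exact S.disjoint _ _ hj)) y
    rw [triTerm, e1, e2, inversionSign_trans, smul_smul, Shuffle.sign, Shuffle.sign,
      S'.inversionSign_right S.α S.β]

theorem counit_comul (n : ℕ) :
    (TensorProduct.lid k _).toLinearMap ∘ₗ (counit k Y).rTensor _ ∘ₗ comul k Y 0 n n =
      LinearMap.id := by
  refine NormChains.hom_ext fun y => ?_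
  let S₀ : Shuffle 0 n n := ⟨⟨⟨Fin.elim0, fun i => i.elim0⟩, fun {i} => i.elim0⟩,
    RelEmbedding.refl _, fun i => i.elim0, fun x => Or.inr ⟨x, rfl⟩⟩
  have h : ∀ S : Shuffle 0 n n, S = S₀ := fun S =>
    Shuffle.ext (by ext i : 1; exact i.elim0)
      ((CubicalSet.orderEmb_eq_refl S.β).trans (CubicalSet.orderEmb_eq_refl S₀.β).symm)
  have hu : (Finset.univ : Finset (Shuffle 0 n n)) = {S₀} := by
    ext S; simp [h S]
  simp [comul, counit, hu, Shuffle.sign, inversionSign, Y.iterFace_id]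

theorem comul_counit (n : ℕ) :
    (TensorProduct.rid k _).toLinearMap ∘ₗ (counit k Y).lTensor _ ∘ₗ comul k Y n 0 n =
      LinearMap.id := by
  refine NormChains.hom_ext fun y => ?_
  let S₀ : Shuffle n 0 n := ⟨RelEmbedding.refl _, ⟨⟨Fin.elim0, fun i => i.elim0⟩,
    fun {i} => i.elim0⟩, fun _ i => i.elim0, fun x => Or.inl ⟨x, rfl⟩⟩
  have h : ∀ S : Shuffle n 0 n, S = S₀ := fun S =>
    Shuffle.ext ((CubicalSet.orderEmb_eq_refl S.α).trans (CubicalSet.orderEmb_eq_refl S₀.α).symm)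
      (by ext i : 1; exact i.elim0)
  have hu : (Finset.univ : Finset (Shuffle n 0 n)) = {S₀} := by
    ext S; simp [h S]
  simp [comul, counit, hu, Shuffle.sign, inversionSign, Y.iterFace_id]

/-- The normalized chain coalgebra of a cubical set. -/
noncomputable def coalgebra : DGCoalgebra.{v, max u v} k where
  X n := NormChains k (Y.thin n)
  d := d k Y
  d_comp_d := d_comp_d k Y
  comul p q n _ := comul k Y p q n
  counit := counit k Y
  comul_d p q n _ := comul_d k Y p q n
  counit_d := NormChains.hom_ext fun y => by
    simp [d, counit]
  coassoc p q r m m' n hm hm' _ := coassoc k Y p q r m m' n hm hm'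
  counit_comul := counit_comul k Y
  comul_counit := comul_counit k Y

/-- The map induced on normalized chains by a morphism of cubical sets. -/
noncomputable def map {Y Z : CubicalSet.{u}} (f : Y ⟶ Z) (n : ℕ) :
    NormChains k (Y.thin n) →ₗ[k] NormChains k (Z.thin n) :=
  NormChains.desc (fun y => NormChains.mk k (Z.thin n) (CubicalSet.Hom.app f n y))
    fun _ hy => mk_thin k (by
      rcases hy with ⟨i, y⟩ | ⟨i, y⟩
      · rw [CubicalSet.Hom.app_s]; exact .s _ _
      · rw [CubicalSet.Hom.app_conn]; exact .conn _ _)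

theorem app_iterFace {Y Z : CubicalSet.{u}} (f : CubicalSet.Hom Y Z) {n p : ℕ} (α : Fin p ↪o Fin n)
    (c : Fin n → Fin 2) (y : Y.cube n) :
    f.app p (Y.iterFace α c y) = Z.iterFace α c (f.app n y) := by
  have key : ∀ (n : ℕ) (α : Fin p ↪o Fin n) (c : Fin n → Fin 2) (y : Y.cube n)
      (_ : ∀ i, i ∈ Set.range α), f.app p (Y.iterFace α c y) = Z.iterFace α c (f.app n y) := by
    intro n α c y hs
    obtain rfl := eq_of_range_eq_univ α hs
    rw [Y.iterFace_id, Z.iterFace_id]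
  induction n with
  | zero => exact key 0 α c y fun i => i.elim0
  | succ n ih =>
    by_cases hs : ∀ i, i ∈ Set.range α
    · exact key _ α c y hs
    · push Not at hs
      obtain ⟨i, hi⟩ := hs
      rw [Y.iterFace_of_notMem α _ _ i hi, Z.iterFace_of_notMem α _ _ i hi, ih, f.app_d]

/-- The morphism of coalgebras induced by a morphism of cubical sets. -/
noncomputable def coalgebraMap {Y Z : CubicalSet.{u}} (f : Y ⟶ Z) :
    DGCoalgebra.Hom (coalgebra k Y) (coalgebra k Z) where
  f := map k f
  f_d n := by
    change map k f n ∘ₗ d k Y n = d k Z n ∘ₗ map k f (n + 1)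
    refine NormChains.hom_ext fun y => ?_
    simp [map, d, CubicalSet.Hom.app_d]
  comul_f p q n h := by
    change comul k Z p q n ∘ₗ map k f n =
      TensorProduct.map (map k f p) (map k f q) ∘ₗ comul k Y p q n
    refine NormChains.hom_ext fun y => ?_
    simp [map, comul, app_iterFace]
  counit_f := by
    change counit k Z ∘ₗ map k f 0 = counit k Y
    refine NormChains.hom_ext fun y => ?_
    simp [map, counit]

/-- The functor of normalized cubical chains, with values in differential graded coalgebras. -/
noncomputable def functor : CubicalSet.{u} ⥤ DGCoalgebra.{v, max u v} k where
  obj Y := coalgebra k Y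
  map f := coalgebraMap k f
  map_id Y := DGCoalgebra.Hom.ext (funext fun n => by
    change map k (𝟙 Y) n = LinearMap.id
    refine NormChains.hom_ext fun y => ?_
    exact NormChains.desc_mk _ _ _)
  map_comp f g := DGCoalgebra.Hom.ext (funext fun n => by
    change map k (f ≫ g) n = map k g n ∘ₗ map k f n
    refine NormChains.hom_ext fun y => ?_
    simp only [map, LinearMap.comp_apply, NormChains.desc_mk]
    rfl)

end CubicalChains


/-! ### The cube category and the triangulation of a cubical set -/

namespace CubeMap

/-- The coface `δ^ε_i : 2^n → 2^{n+1}`, which inserts `ε` in position `i`. -/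
def δ {n : ℕ} (ε : Fin 2) (i : Fin (n + 1)) : (Fin n → Fin 2) →o (Fin (n + 1) → Fin 2) where
  toFun t := Fin.insertNth i ε t
  monotone' t t' h := by
    intro j
    rcases Fin.eq_self_or_eq_succAbove i j with rfl | ⟨j, rfl⟩
    · simp
    · simpa using h j

/-- The codegeneracy `σ_i : 2^{n+1} → 2^n`, which omits the coordinate `i`. -/
def σ {n : ℕ} (i : Fin (n + 1)) : (Fin (n + 1) → Fin 2) →o (Fin n → Fin 2) where
  toFun t j := t (i.succAbove j)
  monotone' _ _ h j := h (i.succAbove j)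

/-- The coconnection `γ_i : 2^{n+2} → 2^{n+1}`, which replaces the coordinates `i` and `i + 1` by
their minimum. -/
def γ {n : ℕ} (i : Fin (n + 1)) : (Fin (n + 2) → Fin 2) →o (Fin (n + 1) → Fin 2) where
  toFun t j :=
    if j < i then t j.castSucc
    else if j = i then min (t i.castSucc) (t i.succ)
    else t j.succ
  monotone' t t' h j := by
    dsimp only
    split_ifs
    · exact h _
    · exact min_le_min (h _) (h _)
    · exact h _

end CubeMap

namespace CubicalSet

/-- `Y.Pullback f y y'` says that `f : 2^m → 2^n` is a morphism of the cube category (a composite of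
cofaces, codegeneracies and coconnections), that `y` is an `n`-cube, and that `y'` is the `m`-cube
`f^* y`. -/
inductive Pullback (Y : CubicalSet.{u}) : ∀ {m n : ℕ}, ((Fin m → Fin 2) →o (Fin n → Fin 2)) →
    Y.cube n → Y.cube m → Prop
  | id {n : ℕ} (y : Y.cube n) : Pullback Y OrderHom.id y y
  | δ {n : ℕ} (ε : Fin 2) (i : Fin (n + 1)) (y : Y.cube (n + 1)) :
      Pullback Y (CubeMap.δ ε i) y (Y.d ε i y)
  | σ {n : ℕ} (i : Fin (n + 1)) (y : Y.cube n) : Pullback Y (CubeMap.σ i) y (Y.s i y)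
  | γ {n : ℕ} (i : Fin (n + 1)) (y : Y.cube (n + 1)) : Pullback Y (CubeMap.γ i) y (Y.conn i y)
  | comp {l m n : ℕ} {f : (Fin m → Fin 2) →o (Fin n → Fin 2)}
      {g : (Fin l → Fin 2) →o (Fin m → Fin 2)} {y : Y.cube n} {y' : Y.cube m} {y'' : Y.cube l} :
      Pullback Y f y y' → Pullback Y g y' y'' → Pullback Y (f.comp g) y y''

/-- The simplices `(y, u)` of the disjoint union of the simplicial cubes `𝕀_y`, where `y` runs
through the cubes of `Y`. An `m`-simplex of `𝕀^n` is a weakly increasing sequence of length `m + 1`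
in `2^n`. -/
abbrev PreTriangulation (Y : CubicalSet.{u}) (m : ℕ) : Type u :=
  Σ n : ℕ, Y.cube n × (Fin (m + 1) →o (Fin n → Fin 2))

/-- The relation `(f^* y, u) ∼ (y, f_* u)`, for all morphisms `f` of the cube category. -/
inductive TriangulationRel (Y : CubicalSet.{u}) (m : ℕ) :
    Y.PreTriangulation m → Y.PreTriangulation m → Prop
  | pullback {l n : ℕ} {f : (Fin l → Fin 2) →o (Fin n → Fin 2)} {y : Y.cube n} {y' : Y.cube l}
      (h : Y.Pullback f y y') (u : Fin (m + 1) →o (Fin l → Fin 2)) :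
      TriangulationRel Y m ⟨l, y', u⟩ ⟨n, y, f.comp u⟩

/-- The triangulation of a cubical set. -/
def triangulation (Y : CubicalSet.{u}) : SSet.{u} where
  obj Δ := Quot (Y.TriangulationRel Δ.unop.len)
  map θ := TypeCat.ofHom (Quot.map (fun x => ⟨x.1, x.2.1, x.2.2.comp θ.unop.toOrderHom⟩) (by
    rintro _ _ ⟨h, u⟩
    exact .pullback h (u.comp θ.unop.toOrderHom)))
  map_id _ := by
    ext x
    obtain ⟨x, rfl⟩ := Quot.exists_rep x
    rfl
  map_comp _ _ := by
    ext x
    obtain ⟨x, rfl⟩ := Quot.exists_rep x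
    rfl

open Simplicial in
/-- The simplex `[y, u]` of the triangulation. -/
def triangulationMk (Y : CubicalSet.{u}) {m n : ℕ} (y : Y.cube n)
    (u : Fin (m + 1) →o (Fin n → Fin 2)) : Y.triangulation _⦋m⦌ :=
  Quot.mk _ ⟨n, y, u⟩

theorem Pullback.map {Y Z : CubicalSet.{u}} (g : Hom Y Z) {m n : ℕ}
    {f : (Fin m → Fin 2) →o (Fin n → Fin 2)} {y : Y.cube n} {y' : Y.cube m}
    (h : Y.Pullback f y y') : Z.Pullback f (g.app n y) (g.app m y') := by
  induction h with
  | id y => exact .id _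
  | δ ε i y => rw [g.app_d]; exact .δ _ _ _
  | σ i y => rw [g.app_s]; exact .σ _ _
  | γ i y => rw [g.app_conn]; exact .γ _ _
  | comp _ _ ih ih' => exact .comp ih ih'

/-- The triangulation functor. -/
def triangulationFunctor : CubicalSet.{u} ⥤ SSet.{u} where
  obj Y := Y.triangulation
  map {Y Z} g :=
    { app := fun Δ => TypeCat.ofHom (Quot.map (fun x => ⟨x.1, Hom.app g x.1 x.2.1, x.2.2⟩) (by
        rintro _ _ ⟨h, u⟩
        exact .pullback (h.map g) u))
      naturality := by
        intro Δ Δ' θ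
        ext x
        obtain ⟨x, rfl⟩ := Quot.exists_rep x
        rfl }
  map_id Y := by
    ext Δ x
    obtain ⟨x, rfl⟩ := Quot.exists_rep x
    rfl
  map_comp f g := by
    ext Δ x
    obtain ⟨x, rfl⟩ := Quot.exists_rep x
    rfl

end CubicalSet

/-- The non-degenerate `n`-simplex `u_π = (∅, π(1), …, π(n), ∅)` of `𝕀^n`: going from its vertex
`j` to its vertex `j + 1`, the coordinate `π j` changes from `0` to `1`. In other words, the
coordinate `i` of the vertex `j` is `1` if and only if `π⁻¹ i < j`. -/
def permSimplex {n : ℕ} (π : Equiv.Perm (Fin n)) : Fin (n + 1) →o (Fin n → Fin 2) where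
  toFun j i := if (π.symm i : ℕ) < j then 1 else 0
  monotone' j j' h i := by
    have h' : (j : ℕ) ≤ j' := h
    dsimp only
    split_ifs
    · exact le_rfl
    · omega
    · exact Fin.zero_le _
    · exact le_rfl

/-!
The shuffle map `t` has a natural left inverse, and the composition in the other order is naturally
homotopic to the identity.

The shuffle map `sh` is well-defined because exchanging two folded coordinates changes the sign of
a permutation `π`, but not the simplex `[γ_i y, u_π]` (`shSum_thin`). In the boundary of the
simplices `u_π` the inner faces cancel in pairs, and the first and the last faces form the image of
the boundary of the cube (`d_sh`). The compatibility with the diagonals (`comul_sh`) says that a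
permutation of `n = p + q` elements consists of a `(p, q)`-shuffle and permutations of its two
parts.

The left inverse `awMap` is an iterated Alexander–Whitney map. To a simplex `u` of the triangulated
`n`-cube and an `n`-cube `y` it assigns a cubical chain on `Y` by recursion on `n`, where the first
direction of `y` is put aside by passing to the path object of `Y`. It is compatible with faces
(`d_aw`) and with the relation that defines the triangulation (`aw_pullback`). On `u_π`, it gives
`y` if `π = 1`, and `0` otherwise, so that it is a left inverse of `sh` (`awMap_sh`).

The homotopy is constructed by the method of acyclic models, with the simplicial cubes as models.
By naturality, `sh ∘ awMap` is given on every simplicial cube of a triangulation by one and the same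
endomorphism `cubeProj` (`charMap_cubeProj`), which is the identity in degree `0`. A simplex `u`
with top vertex `v` lies in the face `{x | x ≤ v}`. This face can be contracted to `v` by appending
the vertex `v` to a simplex (`d_cone`), and the homotopy `cubeHomotopy` on `u` is the contraction of
`u - cubeProj u - h (d u)`. All morphisms of the cube category preserve minima, and
`x ↦ min x v` is one of them. Therefore the contraction is natural (`cone_map`), the chain above
does lie in the face below `v` (`d_cubeHomotopy_of_cycle`), and the homotopies on the simplicial
cubes fit together to a homotopy on the triangulation (`triHomotopy`).
-/

/-! ### The path object of a cubical set -/

namespace CubicalSet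

/-- The path object (décalage) of a cubical set: its `n`-cubes are the `(n + 1)`-cubes of `Y`, and
the direction `0` of `Y` is put aside. -/
abbrev pathObj (Y : CubicalSet.{u}) : CubicalSet.{u} where
  cube n := Y.cube (n + 1)
  d ε i := Y.d ε i.succ
  s i := Y.s i.succ
  conn i := Y.conn i.succ
  d_d ε ε' i j y h := Y.d_d ε ε' i.succ j.succ y (Fin.succ_le_succ_iff.2 h)
  s_s i j y h := Y.s_s i.succ j.succ y (Fin.succ_le_succ_iff.2 h)
  d_s_of_lt ε i j y h := Y.d_s_of_lt ε i.succ j.succ y (Fin.succ_le_succ_iff.2 h)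
  d_s_self ε i y := Y.d_s_self ε i.succ y
  d_s_of_gt ε i j y h := Y.d_s_of_gt ε i.succ j.succ y (Fin.succ_le_succ_iff.2 h)
  conn_conn i j y h := Y.conn_conn i.succ j.succ y (Fin.succ_le_succ_iff.2 h)
  d_conn_of_lt ε i j y h := Y.d_conn_of_lt ε i.succ j.succ y (Fin.succ_le_succ_iff.2 h)
  d_zero_castSucc_conn j y := Y.d_zero_castSucc_conn j.succ y
  d_zero_succ_conn j y := Y.d_zero_succ_conn j.succ y
  d_one_castSucc_conn j y := Y.d_one_castSucc_conn j.succ y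
  d_one_succ_conn j y := Y.d_one_succ_conn j.succ y
  d_conn_of_gt ε i j y h := Y.d_conn_of_gt ε i.succ j.succ y (Fin.succ_le_succ_iff.2 h)
  conn_s_of_lt i j y h := Y.conn_s_of_lt i.succ j.succ y (Fin.succ_le_succ_iff.2 h)
  conn_s_self i y := Y.conn_s_self i.succ y
  conn_s_of_gt i j y h := Y.conn_s_of_gt i.succ j.succ y (Fin.succ_le_succ_iff.2 h)

/-- The functoriality of the path object. -/
def Hom.path {Y Z : CubicalSet.{u}} (f : Hom Y Z) : Hom Y.pathObj Z.pathObj where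
  app n := f.app (n + 1)
  app_d ε i y := f.app_d ε i.succ y
  app_s i y := f.app_s i.succ y
  app_conn i y := f.app_conn i.succ y

/-- The evaluation of a path at one of its end points. -/
def pathEnd (Y : CubicalSet.{u}) (ε : Fin 2) : Hom Y.pathObj Y where
  app _ y := Y.d ε 0 y
  app_d ε' i y := Y.d_d ε ε' 0 i y (Fin.zero_le _)
  app_s i y := Y.d_s_of_lt ε 0 i y (Fin.zero_le _)
  app_conn i y := Y.d_conn_of_lt ε 0 i y (Fin.zero_le _)

/-- The constant paths. -/
def constPath (Y : CubicalSet.{u}) : Hom Y Y.pathObj where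
  app _ y := Y.s 0 y
  app_d ε i y := (Y.d_s_of_gt ε i 0 y (Fin.zero_le _)).symm
  app_s i y := Y.s_s 0 i y (Fin.zero_le _)
  app_conn i y := (Y.conn_s_of_gt i 0 y (Fin.zero_le _)).symm

/-- The connection operator in the first direction. It commutes with all operators that leave the
two new directions alone, so that it is a morphism to the twofold path object. -/
def connPath (Y : CubicalSet.{u}) : Hom Y.pathObj Y.pathObj.pathObj where
  app _ y := Y.conn 0 y
  app_d ε i y := (Y.d_conn_of_gt ε i 0 y (Fin.zero_le _)).symm
  app_s i y := Y.conn_s_of_lt 0 i y (Fin.zero_le _)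
  app_conn i y := Y.conn_conn 0 i.succ y (Fin.zero_le _)

end CubicalSet

namespace CubicalChains

open CubicalSet

variable (k : Type v) [CommRing k]

theorem map_mk {Y Z : CubicalSet.{u}} (f : Hom Y Z) (n : ℕ) (y : Y.cube n) :
    map k (Y := Y) (Z := Z) f n (NormChains.mk k (Y.thin n) y) =
      NormChains.mk k (Z.thin n) (f.app n y) :=
  NormChains.desc_mk _ _ _

theorem thin_of_path {Y : CubicalSet.{u}} {n : ℕ} {y : Y.pathObj.cube n} (h : Y.pathObj.Thin y) :
    Y.Thin (n := n + 1) y := by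
  rcases h with ⟨i, y⟩ | ⟨i, y⟩
  · exact .s _ _
  · exact .conn _ _

/-- The map `C_n(PY) → C_{n+1}(Y)` that views an `n`-cube of the path object `PY` as an
`(n + 1)`-cube of `Y`. -/
noncomputable def ofPath (Y : CubicalSet.{u}) (n : ℕ) :
    NormChains k (Y.pathObj.thin n) →ₗ[k] NormChains k (Y.thin (n + 1)) :=
  NormChains.desc (fun y => NormChains.mk k (Y.thin (n + 1)) y)
    fun _ h => mk_thin k (thin_of_path h)

theorem ofPath_mk {Y : CubicalSet.{u}} {n : ℕ} (y : Y.pathObj.cube n) :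
    ofPath k Y n (NormChains.mk k _ y) = NormChains.mk k (Y.thin (n + 1)) y :=
  NormChains.desc_mk _ _ _

theorem ofPath_constPath (Y : CubicalSet.{u}) (n : ℕ) (c : NormChains k (Y.thin n)) :
    ofPath k Y n (map k (Y := Y) (Z := Y.pathObj) Y.constPath n c) = 0 := by
  suffices h : ofPath k Y n ∘ₗ map k (Y := Y) (Z := Y.pathObj) Y.constPath n = 0 from
    LinearMap.congr_fun h c
  refine NormChains.hom_ext fun y => ?_
  rw [LinearMap.comp_apply, map_mk, ofPath_mk]
  exact mk_thin k (Thin.s _ _)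

theorem ofPath_connPath (Y : CubicalSet.{u}) (n : ℕ) (c : NormChains k (Y.pathObj.thin n)) :
    ofPath k Y (n + 1) (ofPath k Y.pathObj n
      (map k (Y := Y.pathObj) (Z := Y.pathObj.pathObj) Y.connPath n c)) = 0 := by
  suffices h : ofPath k Y (n + 1) ∘ₗ ofPath k Y.pathObj n ∘ₗ
      map k (Y := Y.pathObj) (Z := Y.pathObj.pathObj) Y.connPath n = 0 from
    LinearMap.congr_fun h c
  refine NormChains.hom_ext fun y => ?_
  rw [LinearMap.comp_apply, LinearMap.comp_apply, map_mk, ofPath_mk, ofPath_mk]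
  exact mk_thin k (Thin.conn _ _)

theorem ofPath_map {Y Z : CubicalSet.{u}} (f : Hom Y Z) (n : ℕ)
    (c : NormChains k (Y.pathObj.thin n)) :
    ofPath k Z n (map k (Y := Y.pathObj) (Z := Z.pathObj) f.path n c) =
      map k (Y := Y) (Z := Z) f (n + 1) (ofPath k Y n c) := by
  suffices h : ofPath k Z n ∘ₗ map k (Y := Y.pathObj) (Z := Z.pathObj) f.path n =
      map k (Y := Y) (Z := Z) f (n + 1) ∘ₗ ofPath k Y n from LinearMap.congr_fun h c
  refine NormChains.hom_ext fun y => ?_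
  rw [LinearMap.comp_apply, LinearMap.comp_apply, map_mk, ofPath_mk, ofPath_mk, map_mk]
  rfl

theorem d_mk {Y : CubicalSet.{u}} (n : ℕ) (y : Y.cube (n + 1)) :
    d k Y n (NormChains.mk k (Y.thin (n + 1)) y) = ∑ i : Fin (n + 1), (-1 : ℤ) ^ ((i : ℕ) + 1) •
      (NormChains.mk k (Y.thin n) (Y.d 0 i y) - NormChains.mk k (Y.thin n) (Y.d 1 i y)) :=
  NormChains.desc_mk _ _ _

theorem d_ofPath_zero (Y : CubicalSet.{u}) (c : NormChains k (Y.pathObj.thin 0)) :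
    d k Y 0 (ofPath k Y 0 c) = map k (Y := Y.pathObj) (Z := Y) (Y.pathEnd 1) 0 c -
      map k (Y := Y.pathObj) (Z := Y) (Y.pathEnd 0) 0 c := by
  suffices h : d k Y 0 ∘ₗ ofPath k Y 0 = map k (Y := Y.pathObj) (Z := Y) (Y.pathEnd 1) 0 -
      map k (Y := Y.pathObj) (Z := Y) (Y.pathEnd 0) 0 from LinearMap.congr_fun h c
  refine NormChains.hom_ext fun y => ?_
  rw [LinearMap.comp_apply, LinearMap.sub_apply, map_mk, map_mk, ofPath_mk, d_mk]
  simp [pathEnd]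

theorem d_ofPath_succ (Y : CubicalSet.{u}) (n : ℕ) (c : NormChains k (Y.pathObj.thin (n + 1))) :
    d k Y (n + 1) (ofPath k Y (n + 1) c) =
      map k (Y := Y.pathObj) (Z := Y) (Y.pathEnd 1) (n + 1) c -
        map k (Y := Y.pathObj) (Z := Y) (Y.pathEnd 0) (n + 1) c -
          ofPath k Y n (d k Y.pathObj n c) := by
  suffices h : d k Y (n + 1) ∘ₗ ofPath k Y (n + 1) =
      map k (Y := Y.pathObj) (Z := Y) (Y.pathEnd 1) (n + 1) -
      map k (Y := Y.pathObj) (Z := Y) (Y.pathEnd 0) (n + 1) - ofPath k Y n ∘ₗ d k Y.pathObj n from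
    LinearMap.congr_fun h c
  refine NormChains.hom_ext fun y => ?_
  rw [LinearMap.comp_apply, LinearMap.sub_apply, LinearMap.sub_apply, LinearMap.comp_apply, map_mk,
    map_mk, ofPath_mk, d_mk, d_mk, Fin.sum_univ_succ, map_sum, sub_eq_add_neg _ (Finset.sum _ _),
    ← Finset.sum_neg_distrib]
  congr 1
  · simp [pathEnd]
  · refine Finset.sum_congr rfl fun i _ => ?_
    rw [map_zsmul, map_sub, ofPath_mk, ofPath_mk, Fin.val_succ, pow_succ _ ((i : ℕ) + 1),
      mul_neg_one, neg_smul]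

/-! ### The Alexander–Whitney map of a cube -/

/-- The omission of the first coordinate. -/
def tailSimplex {m n : ℕ} (u : Fin (m + 1) →o (Fin (n + 1) → Fin 2)) :
    Fin (m + 1) →o (Fin n → Fin 2) :=
  (CubeMap.σ 0).comp u

/-- The omission of the first vertex. -/
def dropSimplex {m : ℕ} {P : Type*} [Preorder P] (u : Fin (m + 2) →o P) : Fin (m + 1) →o P :=
  u.comp (Fin.succOrderEmb (m + 1)).toOrderHom

/-- The iterated Alexander–Whitney map: the cubical chain on `Y` assigned to the simplex `[y, u]` of
the triangulation, where `y` is an `n`-cube and `u` an `m`-simplex of the triangulated `n`-cube. It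
is defined by recursion on `n`, which separates the first coordinate. The first summand takes place
in the face of `y` determined by the first coordinate of the vertex `0`. The second one occurs if
the first coordinate jumps between the vertices `0` and `1`; the vertices of positive index then define
a simplex in the direction of the remaining coordinates, that is, in the path object. Later jumps
of the first coordinate do not contribute, as the jumps must occur in the order of the
coordinates. -/
noncomputable def aw : ∀ (n : ℕ) (Y : CubicalSet.{u}) {m : ℕ} (_ : Y.cube n)
    (_ : Fin (m + 1) →o (Fin n → Fin 2)), NormChains k (Y.thin m)
  | 0, Y, 0, y, _ => NormChains.mk k (Y.thin 0) y
  | 0, _, _ + 1, _, _ => 0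
  | n + 1, Y, 0, y, u => aw n Y (Y.d (u 0 0) 0 y) (tailSimplex u)
  | n + 1, Y, m + 1, y, u => aw n Y (Y.d (u 0 0) 0 y) (tailSimplex u) +
      if u 0 0 = 0 ∧ u 1 0 = 1 then
        ofPath k Y m (aw n Y.pathObj (m := m) y (tailSimplex (dropSimplex u))) else 0

/-- The Alexander–Whitney map is natural with respect to morphisms of cubical sets. -/
theorem aw_nat {n : ℕ} : ∀ {Y Z : CubicalSet.{u}} (f : Hom Y Z) {m : ℕ} (y : Y.cube n)
    (u : Fin (m + 1) →o (Fin n → Fin 2)),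
    aw k n Z (f.app n y) u = map k (Y := Y) (Z := Z) f m (aw k n Y y u) := by
  induction n with
  | zero =>
    intro Y Z f m y u
    cases m with
    | zero => simp only [aw, map_mk]
    | succ m => simp only [aw, map_zero]
  | succ n ih =>
    intro Y Z f m y u
    have h1 : aw k n Z (Z.d (u 0 0) 0 (f.app (n + 1) y)) (tailSimplex u) =
      map k (Y := Y) (Z := Z) f m (aw k n Y (Y.d (u 0 0) 0 y) (tailSimplex u)) := by
      rw [← f.app_d, ih]
    cases m with
    | zero => simp only [aw, h1]
    | succ m =>
      simp only [aw, h1, map_add]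
      congr 1
      split_ifs
      · rw [← ofPath_map, ← ih f.path]
        rfl
      · rw [map_zero]

theorem aw_eq_zero_of_degenerate {n : ℕ} : ∀ {Y : CubicalSet.{u}} {m : ℕ} (y : Y.cube n)
    (u : Fin (m + 2) →o (Fin n → Fin 2)) (i : Fin (m + 1)), u i.castSucc = u i.succ →
    aw k n Y y u = 0 := by
  induction n with
  | zero => intro Y m y u i h; simp only [aw]
  | succ n ih =>
    intro Y m y u i h
    have h1 : ∀ y : Y.cube n, aw k n Y y (tailSimplex u) = 0 := fun y =>
      ih y _ i (congrArg (CubeMap.σ 0) h)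
    rw [aw, h1, zero_add]
    refine ite_eq_right_iff.2 fun hj => ?_
    rcases Fin.eq_zero_or_eq_succ i with rfl | ⟨i, rfl⟩
    · have := congrFun h 0
      simp only [Fin.castSucc_zero, Fin.succ_zero_eq_one] at this
      rw [hj.1, hj.2] at this
      exact absurd this (by decide)
    · cases m with
      | zero => exact i.elim0
      | succ m =>
        have h2 : aw k n Y.pathObj (m := m + 1) y (tailSimplex (dropSimplex u)) = 0 :=
          ih (Y := Y.pathObj) y _ i (congrArg (CubeMap.σ 0) h)
        rw [h2, map_zero]

theorem aw_eq_zero_of_lt {n : ℕ} : ∀ {Y : CubicalSet.{u}} {m : ℕ} (_ : n < m) (y : Y.cube n)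
    (u : Fin (m + 1) →o (Fin n → Fin 2)), aw k n Y y u = 0 := by
  induction n with
  | zero =>
    intro Y m h y u
    obtain ⟨m, rfl⟩ := Nat.exists_eq_succ_of_ne_zero h.ne'
    simp only [aw]
  | succ n ih =>
    intro Y m h y u
    obtain ⟨m, rfl⟩ := Nat.exists_eq_succ_of_ne_zero (Nat.ne_zero_of_lt h)
    have h2 : aw k n Y.pathObj (m := m) y (tailSimplex (dropSimplex u)) = 0 :=
      ih (Y := Y.pathObj) (by omega) _ _
    rw [aw, ih (by omega : n < m + 1), h2, LinearMap.map_zero, ite_self, zero_add]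

/-- On the simplex of maximal dimension along which the coordinates jump in their natural order, the
Alexander–Whitney map gives the cube itself. Together with `aw_eq_zero_of_exists`, this makes it a
left inverse of the shuffle map. -/
theorem aw_eq_mk {n : ℕ} : ∀ {Y : CubicalSet.{u}} (y : Y.cube n)
    (u : Fin (n + 1) →o (Fin n → Fin 2)) (_ : ∀ i, u i.castSucc i = 0 ∧ u i.succ i = 1),
    aw k n Y y u = NormChains.mk k (Y.thin n) y := by
  induction n with
  | zero => intro Y y u h; simp only [aw]
  | succ n ih =>
    intro Y y u h
    have h2 : aw k n Y.pathObj (m := n) y (tailSimplex (dropSimplex u)) =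
        NormChains.mk k _ y :=
      ih (Y := Y.pathObj) _ _ fun i => h i.succ
    rw [aw, aw_eq_zero_of_lt k (by omega), h2, zero_add, ofPath_mk]
    exact if_pos (h 0)

theorem aw_eq_zero_of_exists {n : ℕ} : ∀ {Y : CubicalSet.{u}} (y : Y.cube n)
    (u : Fin (n + 1) →o (Fin n → Fin 2)) (i : Fin n) (_ : ¬ (u i.castSucc i = 0 ∧ u i.succ i = 1)),
    aw k n Y y u = 0 := by
  induction n with
  | zero => intro Y y u i h; exact i.elim0
  | succ n ih =>
    intro Y y u i h
    rw [aw, aw_eq_zero_of_lt k (by omega), zero_add]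
    refine ite_eq_right_iff.2 fun hj => ?_
    rcases Fin.eq_zero_or_eq_succ i with rfl | ⟨i, rfl⟩
    · exact absurd hj h
    · have h2 : aw k n Y.pathObj (m := n) y (tailSimplex (dropSimplex u)) = 0 :=
        ih (Y := Y.pathObj) y _ i h
      rw [h2, map_zero]

/-! ### The Alexander–Whitney map is a chain map -/

/-- The omission of the vertex `j`. -/
def faceSimplex {m : ℕ} {P : Type*} [Preorder P] (j : Fin (m + 2)) (u : Fin (m + 2) →o P) :
    Fin (m + 1) →o P :=
  u.comp j.succAboveOrderEmb.toOrderHom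

theorem faceSimplex_zero {m : ℕ} {P : Type*} [Preorder P] (u : Fin (m + 2) →o P) :
    faceSimplex 0 u = dropSimplex u := by
  ext i : 2
  change u (Fin.succAbove 0 i) = u i.succ
  rw [Fin.succAbove_zero]

theorem faceSimplex_succ_zero {m : ℕ} {P : Type*} [Preorder P] (j : Fin (m + 1))
    (u : Fin (m + 2) →o P) : faceSimplex j.succ u 0 = u 0 := by
  change u (Fin.succAbove j.succ 0) = u 0
  rw [Fin.succ_succAbove_zero]

theorem dropSimplex_faceSimplex_succ {m : ℕ} {P : Type*} [Preorder P] (j : Fin (m + 2))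
    (u : Fin (m + 3) →o P) :
    dropSimplex (faceSimplex j.succ u) = faceSimplex j (dropSimplex u) := by
  ext i : 2
  change u (Fin.succAbove j.succ i.succ) = u (j.succAbove i).succ
  rw [Fin.succ_succAbove_succ]

theorem aw_succ_zero {n : ℕ} {Y : CubicalSet.{u}} (y : Y.cube (n + 1))
    (u : Fin 1 →o (Fin (n + 1) → Fin 2)) :
    aw k (n + 1) Y y u = aw k n Y (Y.d (u 0 0) 0 y) (tailSimplex u) := by
  rw [aw]

theorem aw_succ_succ {n : ℕ} {Y : CubicalSet.{u}} {m : ℕ} (y : Y.cube (n + 1))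
    (u : Fin (m + 2) →o (Fin (n + 1) → Fin 2)) :
    aw k (n + 1) Y y u = aw k n Y (Y.d (u 0 0) 0 y) (tailSimplex u) +
      if u 0 0 = 0 ∧ u 1 0 = 1 then
        ofPath k Y m (aw k n Y.pathObj (m := m) y (tailSimplex (dropSimplex u))) else 0 := by
  rw [aw]

theorem map_pathEnd_aw {n : ℕ} {Y : CubicalSet.{u}} {m : ℕ} (ε : Fin 2) (y : Y.cube (n + 1))
    (u : Fin (m + 1) →o (Fin n → Fin 2)) :
    map k (Y := Y.pathObj) (Z := Y) (Y.pathEnd ε) m (aw k n Y.pathObj (m := m) y u) =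
      aw k n Y (Y.d ε 0 y) u :=
  (aw_nat k (Y.pathEnd ε) _ u).symm

theorem fin_two_cases (a b : Fin 2) (h : a ≤ b) :
    a = 0 ∧ b = 1 ∨ a = b ∧ ¬ (a = 0 ∧ b = 1) := by
  revert a b; decide

/-- The Alexander–Whitney map is a chain map. By `d_ofPath_succ`, the boundary of the summand in the
path object consists of its two ends, which account for the change of the first coordinate of the
vertex `0` under the face operator `0`, and of the remaining faces. -/
theorem d_aw {n : ℕ} : ∀ {Y : CubicalSet.{u}} {m : ℕ} (y : Y.cube n)
    (u : Fin (m + 2) →o (Fin n → Fin 2)),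
    d k Y m (aw k n Y y u) =
      ∑ j : Fin (m + 2), (-1 : ℤ) ^ (j : ℕ) • aw k n Y y (faceSimplex j u) := by
  induction n with
  | zero =>
    intro Y m y u
    cases m with
    | zero => simp [aw, Fin.sum_univ_two]
    | succ m => simp [aw]
  | succ n ih =>
    intro Y m y u
    have mono : ∀ i j, i ≤ j → u i 0 ≤ u j 0 := fun i j h => u.monotone h 0
    cases m with
    | zero =>
      rw [aw_succ_succ, map_add, ih, Fin.sum_univ_two, Fin.sum_univ_two, aw_succ_zero, aw_succ_zero]
      have e0 : tailSimplex (faceSimplex 0 u) = faceSimplex 0 (tailSimplex u) := rfl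
      have e1 : tailSimplex (faceSimplex 1 u) = faceSimplex 1 (tailSimplex u) := rfl
      have e2 : tailSimplex (dropSimplex u) = faceSimplex 0 (tailSimplex u) :=
        (faceSimplex_zero (tailSimplex u)).symm
      have f0 : faceSimplex 0 u 0 0 = u 1 0 := rfl
      have f1 : faceSimplex 1 u 0 0 = u 0 0 := rfl
      rw [f0, f1, e0, e1, e2]
      rcases fin_two_cases _ _ (mono 0 1 (by decide)) with h | h
      · rw [if_pos h, d_ofPath_zero, map_pathEnd_aw, map_pathEnd_aw, h.1, h.2]
        simp
        abel
      · rw [if_neg h.2, h.1]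
        simp
    | succ m =>
      rw [aw_succ_succ, map_add, ih]
      simp only [aw_succ_succ, smul_add, Finset.sum_add_distrib]
      have e : ∀ j, tailSimplex (faceSimplex j u) = faceSimplex j (tailSimplex u) := fun _ => rfl
      have e2 : tailSimplex (dropSimplex u) = faceSimplex 0 (tailSimplex u) :=
        (faceSimplex_zero (tailSimplex u)).symm
      have f0 : faceSimplex 0 u 0 0 = u 1 0 := rfl
      -- the first vertex changes only under the face operator `0`
      have hA : ∑ j : Fin (m + 3), (-1 : ℤ) ^ (j : ℕ) •
          aw k n Y (Y.d (faceSimplex j u 0 0) 0 y) (tailSimplex (faceSimplex j u)) =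
          ∑ j : Fin (m + 3), (-1 : ℤ) ^ (j : ℕ) •
            aw k n Y (Y.d (u 0 0) 0 y) (faceSimplex j (tailSimplex u)) +
          (aw k n Y (Y.d (u 1 0) 0 y) (faceSimplex 0 (tailSimplex u)) -
            aw k n Y (Y.d (u 0 0) 0 y) (faceSimplex 0 (tailSimplex u))) := by
        rw [Fin.sum_univ_succ, Fin.sum_univ_succ (n := m + 2)]
        simp only [faceSimplex_succ_zero, f0, e]
        simp
        abel
      rw [hA]
      refine Eq.trans ?_ (add_assoc _ _ _).symm
      congr 1
      obtain ⟨b, hb⟩ : ∃ b : (Fin (m + 2) →o (Fin (n + 1) → Fin 2)) → NormChains k (Y.thin (m + 1)),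
          ∀ v, ofPath k Y m (aw k n Y.pathObj (m := m) y (tailSimplex (dropSimplex v))) = b v :=
        ⟨_, fun _ => rfl⟩
      have b01 : b (faceSimplex 1 u) = b (faceSimplex 0 u) := by
        have := dropSimplex_faceSimplex_succ (0 : Fin (m + 2)) u
        rw [← hb, ← hb, ← Fin.succ_zero_eq_one, this, faceSimplex_zero, faceSimplex_zero]
      have hB : ofPath k Y m (d k Y.pathObj m (aw k n Y.pathObj (m := m + 1) y
          (tailSimplex (dropSimplex u)))) =
          b (faceSimplex 0 u) - ∑ j : Fin (m + 1), (-1 : ℤ) ^ (j : ℕ) •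
            b (faceSimplex j.succ.succ u) := by
        rw [ih (Y := Y.pathObj), map_sum, Fin.sum_univ_succ, sub_eq_add_neg,
          ← Finset.sum_neg_distrib]
        congr 1
        · simp only [← hb, Fin.val_zero, pow_zero, one_smul, faceSimplex_zero]
          rw [← faceSimplex_zero (tailSimplex (dropSimplex u)), ← faceSimplex_zero (dropSimplex u)]
          rfl
        · refine Finset.sum_congr rfl fun j _ => ?_
          rw [← hb, dropSimplex_faceSimplex_succ, Fin.val_succ, pow_succ, mul_neg_one, neg_smul,
            map_neg, map_zsmul]
          rfl
      rw [Fin.sum_univ_succ (n := m + 2), Fin.sum_univ_succ (n := m + 1)]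
      have g1 : faceSimplex (Fin.succ 0) u 0 0 = u 0 0 := rfl
      have g2 : faceSimplex (Fin.succ 0) u 1 0 = u 2 0 := rfl
      have g3 : faceSimplex 0 u 1 0 = u 2 0 := rfl
      have g4 : ∀ j : Fin (m + 1), faceSimplex j.succ.succ u 0 0 = u 0 0 := fun j => by
        rw [faceSimplex_succ_zero]
      have g5 : ∀ j : Fin (m + 1), faceSimplex j.succ.succ u 1 0 = u 1 0 := fun j => by
        change dropSimplex (faceSimplex j.succ.succ u) 0 0 = u 1 0
        rw [dropSimplex_faceSimplex_succ, faceSimplex_succ_zero]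
        rfl
      simp only [f0, g1, g2, g3, g4, g5]
      simp only [hb, Fin.val_zero, Fin.val_succ, Fin.succ_zero_eq_one]
      rw [b01]
      rcases fin_two_cases _ _ (mono 0 1 (Fin.zero_le _)) with h | h
      · have h2 : u 2 0 = 1 := le_antisymm (Fin.le_last _) (by
          rw [← h.2]; exact mono 1 2 (Fin.le_def.2 (by rw [Fin.val_one, Fin.val_two]; omega)))
        rw [if_pos h, d_ofPath_succ, map_pathEnd_aw, map_pathEnd_aw, hB, e2, h.1, h.2, h2]
        simp [pow_succ]
        abel
      · have h2 : ¬ (u 1 0 = 0 ∧ u 1 0 = 1) := fun h => absurd (h.1.symm.trans h.2) (by decide)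
        rw [if_neg h.2, h.1]
        simp only [if_neg h2]
        simp
        split_ifs <;> simp

end CubicalChains

/-! ### The Alexander–Whitney map on the triangulation -/

namespace CubeMap

theorem δ_succ_apply_zero {n : ℕ} (ε : Fin 2) (i : Fin (n + 1)) (t : Fin (n + 1) → Fin 2) :
    δ ε i.succ t 0 = t 0 := by
  change Fin.insertNth (α := fun _ => Fin 2) i.succ ε t 0 = t 0
  have := Fin.insertNth_apply_succAbove (α := fun _ => Fin 2) i.succ ε t 0
  rwa [Fin.succ_succAbove_zero] at this

theorem tail_δ_succ {n : ℕ} (ε : Fin 2) (i : Fin (n + 1)) (t : Fin (n + 1) → Fin 2) :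
    σ 0 (δ ε i.succ t) = δ ε i (σ 0 t) := by
  funext j
  change Fin.insertNth (α := fun _ => Fin 2) i.succ ε t (Fin.succAbove 0 j) =
    Fin.insertNth (α := fun _ => Fin 2) i ε (fun j => t (Fin.succAbove 0 j)) j
  rw [Fin.succAbove_zero]
  rcases Fin.eq_self_or_eq_succAbove i j with rfl | ⟨j, rfl⟩
  · simp
  · have := Fin.insertNth_apply_succAbove (α := fun _ => Fin 2) i.succ ε t j.succ
    rw [Fin.succ_succAbove_succ] at this
    rw [this]
    simp

theorem σ_succ_apply_zero {n : ℕ} (i : Fin (n + 1)) (t : Fin (n + 2) → Fin 2) :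
    σ i.succ t 0 = t 0 := by
  change t (i.succ.succAbove 0) = t 0
  rw [Fin.succ_succAbove_zero]

theorem tail_σ_succ {n : ℕ} (i : Fin (n + 1)) (t : Fin (n + 2) → Fin 2) :
    σ 0 (σ i.succ t) = σ i (σ 0 t) := by
  funext j
  change t (i.succ.succAbove (Fin.succAbove 0 j)) = t (Fin.succAbove 0 (i.succAbove j))
  rw [Fin.succAbove_zero, Fin.succAbove_zero, Fin.succ_succAbove_succ]

theorem tail_γ_zero {n : ℕ} (t : Fin (n + 2) → Fin 2) : σ 0 (γ 0 t) = σ 0 (σ 0 t) := by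
  funext j
  rfl

theorem γ_succ_apply_zero {n : ℕ} (i : Fin (n + 1)) (t : Fin (n + 3) → Fin 2) :
    γ i.succ t 0 = t 0 := by
  change (if (0 : Fin (n + 2)) < i.succ then t (Fin.castSucc 0) else if (0 : Fin (n + 2)) = i.succ
    then min (t i.succ.castSucc) (t i.succ.succ) else t (Fin.succ 0)) = t 0
  rw [if_pos (Fin.succ_pos i), Fin.castSucc_zero]

theorem tail_γ_succ {n : ℕ} (i : Fin (n + 1)) (t : Fin (n + 3) → Fin 2) :
    σ 0 (γ i.succ t) = γ i (σ 0 t) := by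
  funext j
  change γ i.succ t (Fin.succAbove 0 j) = γ i (fun j => t (Fin.succAbove 0 j)) j
  simp only [Fin.succAbove_zero]
  change (if j.succ < i.succ then t j.succ.castSucc else if j.succ = i.succ then
      min (t i.succ.castSucc) (t i.succ.succ) else t j.succ.succ) =
    if j < i then t j.castSucc.succ else if j = i then
      min (t i.castSucc.succ) (t i.succ.succ) else t j.succ.succ
  simp only [Fin.succ_lt_succ_iff, Fin.succ_inj, Fin.succ_castSucc]

end CubeMap

namespace CubicalChains

open CubicalSet

variable (k : Type v) [CommRing k]

/-- The induction step for the compatibility of the Alexander–Whitney map with a map of cubes `F`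
that is the product of the identity in the first coordinate and a map `f` of the other coordinates.
-/
theorem aw_lift {a b : ℕ} {Y : CubicalSet.{u}} (y' : Y.cube (a + 1)) (y : Y.cube (b + 1))
    (f : (Fin a → Fin 2) →o (Fin b → Fin 2)) (F : (Fin (a + 1) → Fin 2) →o (Fin (b + 1) → Fin 2))
    (h0 : ∀ t, F t 0 = t 0) (h1 : ∀ t, CubeMap.σ 0 (F t) = f (CubeMap.σ 0 t))
    (hd : ∀ (ε : Fin 2) (m : ℕ) (u : Fin (m + 1) →o (Fin a → Fin 2)),
      aw k a Y (Y.d ε 0 y') u = aw k b Y (Y.d ε 0 y) (f.comp u))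
    (hp : ∀ (m : ℕ) (u : Fin (m + 1) →o (Fin a → Fin 2)),
      aw k a Y.pathObj (m := m) y' u = aw k b Y.pathObj (m := m) y (f.comp u))
    {m : ℕ} (u : Fin (m + 1) →o (Fin (a + 1) → Fin 2)) :
    aw k (a + 1) Y y' u = aw k (b + 1) Y y (F.comp u) := by
  have ht : ∀ {m : ℕ} (u : Fin (m + 1) →o (Fin (a + 1) → Fin 2)),
      tailSimplex (F.comp u) = f.comp (tailSimplex u) := fun u => OrderHom.ext _ _ (funext fun i =>
    h1 (u i))
  cases m with
  | zero =>
    rw [aw_succ_zero, aw_succ_zero, hd, ht, OrderHom.comp_coe, Function.comp_apply, h0]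
  | succ m =>
    have hd' : dropSimplex (F.comp u) = F.comp (dropSimplex u) := rfl
    rw [aw_succ_succ, aw_succ_succ, hd, hp, hd', ht, ht, OrderHom.comp_coe, Function.comp_apply,
      Function.comp_apply, h0, h0]

theorem aw_δ {n : ℕ} : ∀ {Y : CubicalSet.{u}} {m : ℕ} (ε : Fin 2) (i : Fin (n + 1))
    (y : Y.cube (n + 1)) (u : Fin (m + 1) →o (Fin n → Fin 2)),
    aw k n Y (Y.d ε i y) u = aw k (n + 1) Y y ((CubeMap.δ ε i).comp u) := by
  have h0 : ∀ (n : ℕ) {Y : CubicalSet.{u}} {m : ℕ} (ε : Fin 2)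
    (y : Y.cube (n + 1)) (u : Fin (m + 1) →o (Fin n → Fin 2)),
    aw k n Y (Y.d ε 0 y) u = aw k (n + 1) Y y ((CubeMap.δ ε 0).comp u) := by
    intro n Y m ε y u
    cases m with
    | zero => rw [aw_succ_zero]; rfl
    | succ m =>
      rw [aw_succ_succ, if_neg, add_zero]
      · rfl
      · rintro ⟨h1, h2⟩
        exact absurd (h1.symm.trans h2 : (0 : Fin 2) = 1) (by decide)
  induction n with
  | zero =>
    intro Y m ε i y u
    obtain rfl : i = 0 := Subsingleton.elim (α := Fin 1) _ _
    exact h0 0 ε y u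
  | succ n ih =>
    intro Y m ε i y u
    rcases Fin.eq_zero_or_eq_succ i with rfl | ⟨i, rfl⟩
    · exact h0 _ ε y u
    · refine aw_lift k _ _ (CubeMap.δ ε i) _ (CubeMap.δ_succ_apply_zero ε i)
        (CubeMap.tail_δ_succ ε i) (fun ε' m u => ?_) (fun m u => ?_) u
      · rw [← ih, Y.d_d ε' ε 0 i y (Fin.zero_le _)]
        rfl
      · exact ih (Y := Y.pathObj) ε i y u

theorem ofPath_aw_s {n : ℕ} {Y : CubicalSet.{u}} {m : ℕ} (y : Y.cube n)
    (u : Fin (m + 1) →o (Fin n → Fin 2)) :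
    ofPath k Y m (aw k n Y.pathObj (m := m) (Y.s 0 y) u) = 0 := by
  have := aw_nat k Y.constPath y u
  rw [← ofPath_constPath k Y m (aw k n Y y u), ← this]
  rfl

theorem aw_σ_zero {n : ℕ} {Y : CubicalSet.{u}} {m : ℕ} (y : Y.cube n)
    (u : Fin (m + 1) →o (Fin (n + 1) → Fin 2)) :
    aw k (n + 1) Y (Y.s 0 y) u = aw k n Y y ((CubeMap.σ 0).comp u) := by
  cases m with
  | zero => rw [aw_succ_zero, Y.d_s_self]; rfl
  | succ m => rw [aw_succ_succ, Y.d_s_self, ofPath_aw_s, ite_self, add_zero]; rfl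

theorem aw_σ {n : ℕ} : ∀ {Y : CubicalSet.{u}} {m : ℕ} (i : Fin (n + 1))
    (y : Y.cube n) (u : Fin (m + 1) →o (Fin (n + 1) → Fin 2)),
    aw k (n + 1) Y (Y.s i y) u = aw k n Y y ((CubeMap.σ i).comp u) := by
  induction n with
  | zero =>
    intro Y m i y u
    obtain rfl : i = 0 := Subsingleton.elim (α := Fin 1) _ _
    exact aw_σ_zero k y u
  | succ n ih =>
    intro Y m i y u
    rcases Fin.eq_zero_or_eq_succ i with rfl | ⟨i, rfl⟩
    · exact aw_σ_zero k y u
    · refine aw_lift k _ _ (CubeMap.σ i) _ (CubeMap.σ_succ_apply_zero i)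
        (CubeMap.tail_σ_succ i) (fun ε' m u => ?_) (fun m u => ?_) u
      · have := Y.d_s_of_lt ε' 0 i y (Fin.zero_le _)
        rw [Fin.castSucc_zero] at this
        rw [← ih, this]
      · exact ih (Y := Y.pathObj) i y u

theorem ofPath_aw_conn {n : ℕ} {Y : CubicalSet.{u}} {m : ℕ} (y : Y.cube (n + 1))
    (u : Fin (m + 1) →o (Fin n → Fin 2)) :
    ofPath k Y (m + 1) (ofPath k Y.pathObj m
      (aw k n Y.pathObj.pathObj (m := m) (Y.conn 0 y) u)) = 0 := by
  have := aw_nat k Y.connPath y u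
  rw [← ofPath_connPath k Y m (aw k n Y.pathObj (m := m) y u), ← this]
  rfl

/-- Folding the first coordinate with the one that is put aside: the contribution in which both jump
vanishes because it consists of connections, and if the first coordinate of the vertex `0` is `0`,
then the face of the connection is degenerate. -/
theorem ofPath_aw_succ_conn {n : ℕ} {Y : CubicalSet.{u}} {m : ℕ} (y : Y.cube (n + 1))
    (u : Fin (m + 1) →o (Fin (n + 1) → Fin 2)) :
    ofPath k Y m (aw k (n + 1) Y.pathObj (m := m) (Y.conn 0 y) u) =
      if u 0 0 = 1 then ofPath k Y m (aw k n Y.pathObj (m := m) y (tailSimplex u)) else 0 := by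
  have h : ofPath k Y m (aw k (n + 1) Y.pathObj (m := m) (Y.conn 0 y) u) =
      ofPath k Y m (aw k n Y.pathObj (m := m) (Y.d (u 0 0) 1 (Y.conn 0 y)) (tailSimplex u)) := by
    cases m with
    | zero => rw [aw_succ_zero]; rfl
    | succ m =>
      rw [aw_succ_succ, map_add]
      rw [apply_ite (ofPath k Y (m + 1)), LinearMap.map_zero, ofPath_aw_conn k y, ite_self,
        add_zero]
      rfl
  rw [h]
  -- the face of the connection is degenerate for `u 0 0 = 0`, and equal to `y` for `u 0 0 = 1`
  have h01 : u 0 0 = 0 ∨ u 0 0 = 1 := by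
    generalize u 0 0 = a
    revert a
    decide
  rcases h01 with h' | h'
  · rw [h', if_neg (by decide)]
    have := Y.d_zero_succ_conn 0 y
    rw [Fin.succ_zero_eq_one] at this
    rw [this, ofPath_aw_s]
  · rw [h', if_pos rfl]
    have := Y.d_one_succ_conn 0 y
    rw [Fin.succ_zero_eq_one] at this
    rw [this]

theorem aw_γ_zero {n : ℕ} {Y : CubicalSet.{u}} {m : ℕ} (y : Y.cube (n + 1))
    (u : Fin (m + 1) →o (Fin (n + 2) → Fin 2)) :
    aw k (n + 2) Y (Y.conn 0 y) u = aw k (n + 1) Y y ((CubeMap.γ 0).comp u) := by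
  have ht : ∀ {m : ℕ} (u : Fin (m + 1) →o (Fin (n + 2) → Fin 2)),
      tailSimplex ((CubeMap.γ 0).comp u) = tailSimplex (tailSimplex u) := fun u =>
    OrderHom.ext _ _ (funext fun i => CubeMap.tail_γ_zero (u i))
  have h01 : u 0 0 = 0 ∨ u 0 0 = 1 := by
    generalize u 0 0 = a
    revert a
    decide
  have hmin : ∀ i, (CubeMap.γ 0).comp u i 0 = min (u i 0) (u i 1) := fun i => rfl
  have e0 := Y.d_zero_castSucc_conn 0 y
  have e1 := Y.d_one_castSucc_conn 0 y
  rw [Fin.castSucc_zero] at e0 e1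
  have m0 : ∀ a : Fin 2, min 0 a = 0 := by decide
  have m1 : ∀ a : Fin 2, min 1 a = a := by decide
  cases m with
  | zero =>
    rw [aw_succ_zero]
    rcases h01 with h | h
    · rw [h, e0, aw_σ_zero, aw_succ_zero, hmin, h, m0, ht]
      rfl
    · rw [h, e1, aw_succ_zero, aw_succ_zero, hmin, h, m1, ht]
      rfl
  | succ m =>
    have hd : dropSimplex ((CubeMap.γ 0).comp u) = (CubeMap.γ 0).comp (dropSimplex u) := rfl
    rw [aw_succ_succ, ofPath_aw_succ_conn, ← ite_and]
    rcases h01 with h | h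
    · rw [h, e0, aw_σ_zero, aw_succ_succ, hmin, hmin, h, m0, hd, ht, ht]
      have : ∀ a b : Fin 2, min a b = 1 ↔ a = 1 ∧ b = 1 := by decide
      simp only [this, and_assoc]
      rfl
    · rw [h, e1, if_neg (fun h' => absurd h'.1.1 (by decide)), add_zero, aw_succ_succ,
        aw_succ_succ, hmin, hmin, h, m1, hd, ht, ht]
      have h' : u 1 0 = 1 := le_antisymm (Fin.le_last _) (by
        rw [← h]
        exact u.monotone (Fin.zero_le _) 0)
      rw [h', m1]
      rfl

theorem aw_γ {n : ℕ} : ∀ {Y : CubicalSet.{u}} {m : ℕ} (i : Fin (n + 1))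
    (y : Y.cube (n + 1)) (u : Fin (m + 1) →o (Fin (n + 2) → Fin 2)),
    aw k (n + 2) Y (Y.conn i y) u = aw k (n + 1) Y y ((CubeMap.γ i).comp u) := by
  induction n with
  | zero =>
    intro Y m i y u
    obtain rfl : i = 0 := Subsingleton.elim (α := Fin 1) _ _
    exact aw_γ_zero k y u
  | succ n ih =>
    intro Y m i y u
    rcases Fin.eq_zero_or_eq_succ i with rfl | ⟨i, rfl⟩
    · exact aw_γ_zero k y u
    · refine aw_lift k _ _ (CubeMap.γ i) _ (CubeMap.γ_succ_apply_zero i)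
        (CubeMap.tail_γ_succ i) (fun ε' m u => ?_) (fun m u => ?_) u
      · have := Y.d_conn_of_lt ε' 0 i y (Fin.zero_le _)
        rw [Fin.castSucc_zero, Fin.castSucc_zero] at this
        rw [← ih, this]
      · exact ih (Y := Y.pathObj) i y u

/-- The Alexander–Whitney map is compatible with the relation that defines the triangulation. -/
theorem aw_pullback {Y : CubicalSet.{u}} {l n : ℕ} {f : (Fin l → Fin 2) →o (Fin n → Fin 2)}
    {y : Y.cube n} {y' : Y.cube l} (h : Y.Pullback f y y') {m : ℕ}
    (u : Fin (m + 1) →o (Fin l → Fin 2)) : aw k l Y y' u = aw k n Y y (f.comp u) := by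
  induction h with
  | id y => rfl
  | δ ε i y => exact aw_δ k ε i y u
  | σ i y => exact aw_σ k i y u
  | γ i y => exact aw_γ k i y u
  | comp _ _ ih ih' => rw [ih', ih]; rfl

end CubicalChains

namespace CubicalChains

open CubicalSet Simplicial

variable (k : Type v) [CommRing k]

/-- The value of the Alexander–Whitney map on a simplex of the triangulation; it is well-defined by
`aw_pullback`. -/
noncomputable def awSimplex (Y : CubicalSet.{u}) (m : ℕ) :
    Y.triangulation _⦋m⦌ → NormChains k (Y.thin m) :=
  Quot.lift (fun x => aw k x.1 Y x.2.1 x.2.2) (by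
    rintro _ _ ⟨h, u⟩
    exact aw_pullback k h u)

/-- The map from the simplicial chains of the triangulation to the cubical chains. -/
noncomputable def awMap (Y : CubicalSet.{u}) (m : ℕ) :
    NormChains k (Y.triangulation.degenerate m) →ₗ[k] NormChains k (Y.thin m) :=
  NormChains.desc (awSimplex k Y m) (by
    intro x hx
    cases m with
    | zero => simp at hx
    | succ m =>
      obtain ⟨i, z, rfl⟩ := SimplicialChains.exists_eq_σ hx
      obtain ⟨⟨n, y, u⟩, rfl⟩ := Quot.exists_rep z
      change aw k n Y y (u.comp (SimplexCategory.σ i).toOrderHom) = 0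
      refine aw_eq_zero_of_degenerate k _ _ i ?_
      change u (Fin.predAbove i i.castSucc) = u (Fin.predAbove i i.succ)
      simp)

theorem awMap_mk {Y : CubicalSet.{u}} {m n : ℕ} (y : Y.cube n)
    (u : Fin (m + 1) →o (Fin n → Fin 2)) :
    awMap k Y m (NormChains.mk k _ (Y.triangulationMk y u)) = aw k n Y y u :=
  NormChains.desc_mk _ _ _

theorem triangulation_δ {Y : CubicalSet.{u}} {m n : ℕ} (y : Y.cube n)
    (u : Fin (m + 2) →o (Fin n → Fin 2)) (j : Fin (m + 2)) :
    Y.triangulation.δ j (Y.triangulationMk y u) = Y.triangulationMk y (faceSimplex j u) := rfl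

theorem simplicial_d_mk (X : SSet.{u}) (n : ℕ) (x : X _⦋n + 1⦌) :
    SimplicialChains.d k X n (NormChains.mk k _ x) =
      ∑ i : Fin (n + 2), (-1 : ℤ) ^ (i : ℕ) • NormChains.mk k _ (X.δ i x) :=
  NormChains.desc_mk _ _ _

theorem exists_triangulationMk (Y : CubicalSet.{u}) {m : ℕ} (x : Y.triangulation _⦋m⦌) :
    ∃ (n : ℕ) (y : Y.cube n) (u : Fin (m + 1) →o (Fin n → Fin 2)), x = Y.triangulationMk y u := by
  obtain ⟨⟨n, y, u⟩, rfl⟩ := Quot.exists_rep x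
  exact ⟨n, y, u, rfl⟩

theorem awMap_d (Y : CubicalSet.{u}) (m : ℕ) :
    awMap k Y m ∘ₗ SimplicialChains.d k Y.triangulation m = d k Y m ∘ₗ awMap k Y (m + 1) := by
  refine NormChains.hom_ext fun x => ?_
  obtain ⟨n, y, u, rfl⟩ := exists_triangulationMk Y x
  rw [LinearMap.comp_apply, LinearMap.comp_apply, simplicial_d_mk, map_sum, awMap_mk, d_aw]
  refine Finset.sum_congr rfl fun j _ => ?_
  rw [map_zsmul, triangulation_δ, awMap_mk]

/-! ### The shuffle map -/

/-- The value of the shuffle map on a cube `y`: the signed sum of the top-dimensional simplices of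
the triangulated cube. -/
noncomputable def shSum (Y : CubicalSet.{u}) {n : ℕ} (y : Y.cube n) :
    NormChains k (Y.triangulation.degenerate n) :=
  ∑ π : Equiv.Perm (Fin n), (Equiv.Perm.sign π : ℤ) •
    NormChains.mk k (Y.triangulation.degenerate n) (Y.triangulationMk y (permSimplex π))

theorem triangulationMk_pullback {Y : CubicalSet.{u}} {l n : ℕ}
    {f : (Fin l → Fin 2) →o (Fin n → Fin 2)} {y : Y.cube n} {y' : Y.cube l} (h : Y.Pullback f y y')
    {m : ℕ} (u : Fin (m + 1) →o (Fin l → Fin 2)) :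
    Y.triangulationMk y' u = Y.triangulationMk y (f.comp u) :=
  Quot.sound (.pullback h u)

theorem eq_faceSimplex_comp_σ {m : ℕ} {P : Type*} [Preorder P] (u : Fin (m + 2) →o P)
    (i : Fin (m + 1)) (h : u i.castSucc = u i.succ) :
    u = (faceSimplex i.castSucc u).comp (SimplexCategory.σ i).toOrderHom := by
  ext j : 2
  change u j = u (i.castSucc.succAbove (i.predAbove j))
  by_cases hj : j = i.castSucc
  · subst hj
    simp [h]
  · rw [Fin.succAbove_predAbove hj]

theorem mem_degenerate_of_eq {Y : CubicalSet.{u}} {m n : ℕ} (y : Y.cube n)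
    (u : Fin (m + 2) →o (Fin n → Fin 2)) (i : Fin (m + 1)) (h : u i.castSucc = u i.succ) :
    Y.triangulationMk y u ∈ Y.triangulation.degenerate (m + 1) := by
  have e : Y.triangulationMk y u =
      Y.triangulation.σ i (Y.triangulationMk y (faceSimplex i.castSucc u)) :=
    congrArg (Y.triangulationMk y) (eq_faceSimplex_comp_σ u i h)
  rw [e]
  exact Y.triangulation.σ_mem_degenerate i _

theorem permSimplex_apply {n : ℕ} (π : Equiv.Perm (Fin n)) (j : Fin (n + 1)) (i : Fin n) :
    permSimplex π j i = if (π.symm i : ℕ) < j then 1 else 0 := rfl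

/-- On a degenerate cube, every summand of the shuffle map is degenerate. On a folded cube, the
summands cancel in pairs: exchanging the two coordinates that are folded changes the sign, but not
the simplex. -/
theorem shSum_thin {Y : CubicalSet.{u}} {n : ℕ} {y : Y.cube n} (h : Y.Thin y) :
    shSum k Y y = 0 := by
  rcases h with ⟨i, y⟩ | ⟨i, y⟩
  · refine Finset.sum_eq_zero fun π _ => ?_
    rw [triangulationMk_pullback (.σ i y), NormChains.mk_eq_zero, smul_zero]
    refine mem_degenerate_of_eq _ _ (π.symm i) ?_
    funext j
    change permSimplex π _ (i.succAbove j) = permSimplex π _ (i.succAbove j)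
    rw [permSimplex_apply, permSimplex_apply]
    have : (π.symm (i.succAbove j) : ℕ) ≠ π.symm i := fun e =>
      Fin.succAbove_ne i j (π.symm.injective (Fin.ext e))
    simp only [Fin.val_castSucc, Fin.val_succ]
    refine if_congr ?_ rfl rfl
    omega
  · refine Finset.sum_involution (fun π _ => Equiv.swap i.castSucc i.succ * π) ?_ ?_ ?_ ?_
    · intro π _
      have e : Y.triangulationMk (Y.conn i y) (permSimplex (Equiv.swap i.castSucc i.succ * π)) =
          Y.triangulationMk (Y.conn i y) (permSimplex π) := by
        rw [triangulationMk_pullback (.γ i y), triangulationMk_pullback (.γ i y)]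
        congr 1
        ext a : 2
        funext j
        have hs : ∀ x, permSimplex (Equiv.swap i.castSucc i.succ * π) a x =
          permSimplex π a (Equiv.swap i.castSucc i.succ x) := fun x => rfl
        change (if j < i then _ else if j = i then _ else _) =
          (if j < i then _ else if j = i then _ else _)
        simp only [hs, Equiv.swap_apply_left, Equiv.swap_apply_right]
        split_ifs with h1 h2
        · rw [Equiv.swap_apply_of_ne_of_ne] <;> simp [Fin.ext_iff] <;> omega
        · exact min_comm _ _
        · rw [Equiv.swap_apply_of_ne_of_ne] <;> simp [Fin.ext_iff] <;> omega
      rw [e, ← add_smul, Equiv.Perm.sign_mul, Equiv.Perm.sign_swap (by simp [Fin.ext_iff])]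
      simp
    · intro π _ _ h
      have := congrArg (fun σ => σ * π⁻¹) h
      simp [Fin.ext_iff] at this
    · simp
    · intro π _
      simp [← mul_assoc]

/-- The shuffle map, from the cubical chains to the simplicial chains of the triangulation. -/
noncomputable def sh (Y : CubicalSet.{u}) (n : ℕ) :
    NormChains k (Y.thin n) →ₗ[k] NormChains k (Y.triangulation.degenerate n) :=
  NormChains.desc (shSum k Y) fun _ h => shSum_thin k h

theorem sh_mk {Y : CubicalSet.{u}} {n : ℕ} (y : Y.cube n) :
    sh k Y n (NormChains.mk k _ y) = ∑ π : Equiv.Perm (Fin n), (Equiv.Perm.sign π : ℤ) •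
      NormChains.mk k (Y.triangulation.degenerate n) (Y.triangulationMk y (permSimplex π)) :=
  NormChains.desc_mk _ _ _

/-- The Alexander–Whitney map is a left inverse of the shuffle map: only the identity permutation
contributes. -/
theorem awMap_sh (Y : CubicalSet.{u}) (n : ℕ) : awMap k Y n ∘ₗ sh k Y n = LinearMap.id := by
  refine NormChains.hom_ext fun y => ?_
  rw [LinearMap.comp_apply, sh_mk, map_sum, Finset.sum_eq_single 1]
  · rw [map_zsmul, awMap_mk, aw_eq_mk]
    · simp
    · intro i
      have e : ((1 : Equiv.Perm (Fin n)).symm i) = i := rfl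
      simp [permSimplex_apply, e]
  · intro π _ hπ
    rw [map_zsmul, awMap_mk]
    obtain ⟨i, hi⟩ : ∃ i, π.symm i ≠ i := by
      by_contra! h
      exact hπ (Equiv.ext fun i => by rw [← h (π i)]; simp)
    rw [aw_eq_zero_of_exists k y _ i, smul_zero]
    rintro ⟨h1, h2⟩
    rw [permSimplex_apply] at h1 h2
    have h1' : ¬ (π.symm i : ℕ) < i := fun h => by simp [h] at h1
    have h2' : (π.symm i : ℕ) < i + 1 := by
      by_contra h
      simp at h h2
      omega
    exact hi (Fin.ext (by omega))
  · simp

end CubicalChains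

/-! ### Permutations and shuffles -/

namespace Shuffle

variable {p q n : ℕ}

/-- The two parts of a shuffle, as a bijection. -/
noncomputable def equiv (S : Shuffle p q n) : Fin p ⊕ Fin q ≃ Fin n :=
  Equiv.ofBijective (Sum.elim S.α S.β)
    ⟨Function.Injective.sumElim S.α.injective S.β.injective S.disjoint, fun x => by
      rcases S.cover x with ⟨i, rfl⟩ | ⟨i, rfl⟩
      · exact ⟨Sum.inl i, rfl⟩
      · exact ⟨Sum.inr i, rfl⟩⟩

/-- The first `p` and the last `q` elements of `{0, …, n - 1}`. -/
def blocks (h : p + q = n) : Fin p ⊕ Fin q ≃ Fin n :=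
  finSumFinEquiv.trans (finCongr h)

theorem blocks_inl (h : p + q = n) (i : Fin p) : (blocks h (Sum.inl i) : ℕ) = i := rfl

theorem blocks_inr (h : p + q = n) (i : Fin q) : (blocks h (Sum.inr i) : ℕ) = p + i := rfl

/-- The permutation whose first `p` values are those of `S.α`, permuted by `σ`, and whose last `q`
values are those of `S.β`, permuted by `τ`. -/
noncomputable def perm (h : p + q = n) (S : Shuffle p q n) (σ : Equiv.Perm (Fin p))
    (τ : Equiv.Perm (Fin q)) : Equiv.Perm (Fin n) :=
  (blocks h).symm.trans ((Equiv.sumCongr σ τ).trans S.equiv)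

theorem perm_inl (h : p + q = n) (S : Shuffle p q n) (σ : Equiv.Perm (Fin p))
    (τ : Equiv.Perm (Fin q)) (i : Fin p) : S.perm h σ τ (blocks h (Sum.inl i)) = S.α (σ i) := by
  simp only [perm, Equiv.trans_apply, Equiv.symm_apply_apply]
  rfl

theorem perm_inr (h : p + q = n) (S : Shuffle p q n) (σ : Equiv.Perm (Fin p))
    (τ : Equiv.Perm (Fin q)) (i : Fin q) : S.perm h σ τ (blocks h (Sum.inr i)) = S.β (τ i) := by
  simp only [perm, Equiv.trans_apply, Equiv.symm_apply_apply]
  rfl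

theorem perm_symm_α (h : p + q = n) (S : Shuffle p q n) (σ : Equiv.Perm (Fin p))
    (τ : Equiv.Perm (Fin q)) (i : Fin p) : ((S.perm h σ τ).symm (S.α i) : ℕ) = σ.symm i := by
  rw [← blocks_inl h, Fin.val_inj, Equiv.symm_apply_eq, perm_inl, Equiv.apply_symm_apply]

theorem perm_symm_β (h : p + q = n) (S : Shuffle p q n) (σ : Equiv.Perm (Fin p))
    (τ : Equiv.Perm (Fin q)) (i : Fin q) :
    ((S.perm h σ τ).symm (S.β i) : ℕ) = p + τ.symm i := by
  rw [← blocks_inr h, Fin.val_inj, Equiv.symm_apply_eq, perm_inr, Equiv.apply_symm_apply]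

theorem sign_perm_one (h : p + q = n) (S : Shuffle p q n) :
    (Equiv.Perm.sign (S.perm h 1 1) : ℤ) = S.sign := by
  have e : (Equiv.Perm.sign (S.perm h 1 1) : ℤ) = ∏ i, ∏ j, if i < j then
      (if S.perm h 1 1 i < S.perm h 1 1 j then 1 else -1) else 1 := by
    rw [Equiv.Perm.sign_eq_prod_prod_Ioi, Units.coe_prod]
    refine Finset.prod_congr rfl fun i _ => ?_
    rw [Units.coe_prod, ← Finset.prod_filter]
    refine Finset.prod_congr (by ext; simp) fun j _ => ?_
    split_ifs <;> simp
  rw [e, ← (blocks h).prod_comp, Fintype.prod_sum_type]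
  have l : ∀ i j, blocks h (Sum.inl i) < blocks h (Sum.inr j) := fun i j => by
    rw [Fin.lt_def, blocks_inl, blocks_inr]
    omega
  have h1 : ∀ i, (∏ j, if blocks h (Sum.inl i) < j then
      (if S.perm h 1 1 (blocks h (Sum.inl i)) < S.perm h 1 1 j then 1 else -1) else 1) =
      ∏ j, if S.β j < S.α i then (-1 : ℤ) else 1 := by
    intro i
    rw [← (blocks h).prod_comp, Fintype.prod_sum_type, Finset.prod_eq_one, one_mul]
    · refine Finset.prod_congr rfl fun j _ => ?_
      rw [if_pos (l i j), perm_inl, perm_inr]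
      have := S.disjoint i j
      rcases lt_or_gt_of_ne this with h' | h'
      · simp [h', h'.le.not_gt]
      · simp [h', h'.le.not_gt]
    · intro j _
      refine ite_eq_right_iff.2 fun h' => if_pos ?_
      rw [perm_inl, perm_inl]
      exact S.α.strictMono h'
  have h2 : ∀ i, (∏ j, if blocks h (Sum.inr i) < j then
      (if S.perm h 1 1 (blocks h (Sum.inr i)) < S.perm h 1 1 j then 1 else -1) else 1) =
      (1 : ℤ) := by
    intro i
    rw [← (blocks h).prod_comp, Fintype.prod_sum_type, Finset.prod_eq_one, one_mul,
      Finset.prod_eq_one]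
    · intro j _
      refine ite_eq_right_iff.2 fun h' => if_pos ?_
      rw [perm_inr, perm_inr]
      refine S.β.strictMono ?_
      rw [Fin.lt_def, blocks_inr, blocks_inr] at h'
      exact Fin.lt_def.2 (by simpa using h')
    · intro j _
      exact if_neg (l j i).le.not_gt
  simp only [h1, h2, Finset.prod_const_one, mul_one]
  rfl

theorem sign_perm (h : p + q = n) (S : Shuffle p q n) (σ : Equiv.Perm (Fin p))
    (τ : Equiv.Perm (Fin q)) :
    (Equiv.Perm.sign (S.perm h σ τ) : ℤ) =
      S.sign * Equiv.Perm.sign σ * Equiv.Perm.sign τ := by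
  have e : S.perm h σ τ = S.perm h 1 1 * (blocks h).permCongr (Equiv.Perm.sumCongr σ τ) := by
    ext i
    simp [perm, Equiv.permCongr_apply]
  rw [e, Equiv.Perm.sign_mul, Equiv.Perm.sign_permCongr, Equiv.Perm.sign_sumCongr, Units.val_mul,
    Units.val_mul, sign_perm_one, mul_assoc]

theorem perm_bijective (h : p + q = n) : Function.Bijective
    (fun x : Shuffle p q n × Equiv.Perm (Fin p) × Equiv.Perm (Fin q) =>
      x.1.perm h x.2.1 x.2.2) := by
  constructor
  · rintro ⟨S, σ, τ⟩ ⟨S', σ', τ'⟩ e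
    have e' : ∀ i, S.perm h σ τ i = S'.perm h σ' τ' i := fun i => DFunLike.congr_fun e i
    have hα : ∀ i, S.α (σ i) = S'.α (σ' i) := fun i => by rw [← perm_inl h S σ τ, e', perm_inl]
    have hβ : ∀ i, S.β (τ i) = S'.β (τ' i) := fun i => by rw [← perm_inr h S σ τ, e', perm_inr]
    obtain rfl : S = S' := by
      refine Shuffle.ext (orderEmb_ext_range ?_) (orderEmb_ext_range ?_)
      · rw [← σ.surjective.range_comp S.α, ← σ'.surjective.range_comp S'.α]
        exact congrArg Set.range (funext hα)
      · rw [← τ.surjective.range_comp S.β, ← τ'.surjective.range_comp S'.β]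
        exact congrArg Set.range (funext hβ)
    obtain rfl : σ = σ' := Equiv.ext fun i => S.α.injective (hα i)
    obtain rfl : τ = τ' := Equiv.ext fun i => S.β.injective (hβ i)
    rfl
  · intro π
    have key : ∀ (r : ℕ) (f : Fin r → Fin n), Function.Injective f →
        ∃ (α : Fin r ↪o Fin n) (σ : Equiv.Perm (Fin r)), ∀ i, α (σ i) = f i := by
      intro r f hf
      have hc : (Finset.univ.image f).card = r := by
        rw [Finset.card_image_of_injective _ hf, Finset.card_univ, Fintype.card_fin]
      have hr := Finset.range_orderEmbOfFin _ hc
      have hm : ∀ i, ∃ j, (Finset.univ.image f).orderEmbOfFin hc j = f i := fun i => by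
        change f i ∈ Set.range _
        rw [hr]
        simp
      choose σ hσ using hm
      have hσ' : Function.Injective σ := fun i j hij => hf (by rw [← hσ, ← hσ, hij])
      exact ⟨_, Equiv.ofBijective σ (Finite.injective_iff_bijective.1 hσ'), hσ⟩
    obtain ⟨α, σ, hα⟩ := key p (fun i => π (blocks h (Sum.inl i)))
      (fun i j hij => Sum.inl_injective ((blocks h).injective (π.injective hij)))
    obtain ⟨β, τ, hβ⟩ := key q (fun i => π (blocks h (Sum.inr i)))
      (fun i j hij => Sum.inr_injective ((blocks h).injective (π.injective hij)))
    have hα' : ∀ i, α i = π (blocks h (Sum.inl (σ.symm i))) := fun i => by rw [← hα]; simp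
    have hβ' : ∀ i, β i = π (blocks h (Sum.inr (τ.symm i))) := fun i => by rw [← hβ]; simp
    refine ⟨⟨⟨α, β, ?_, ?_⟩, σ, τ⟩, ?_⟩
    · intro i j hij
      rw [hα', hβ'] at hij
      simpa using (blocks h).injective (π.injective hij)
    · intro x
      obtain ⟨y, rfl⟩ := π.surjective x
      obtain ⟨z | z, rfl⟩ := (blocks h).surjective y
      · exact Or.inl ⟨_, hα z⟩
      · exact Or.inr ⟨_, hβ z⟩
    · refine Equiv.ext fun y => ?_
      obtain ⟨z | z, rfl⟩ := (blocks h).surjective y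
      · exact (perm_inl h _ σ τ z).trans (hα z)
      · exact (perm_inr h _ σ τ z).trans (hβ z)

/-- A sum over permutations is a sum over shuffles and permutations of their two parts. -/
theorem sum_perm {M : Type*} [AddCommMonoid M] (h : p + q = n) (F : Equiv.Perm (Fin n) → M) :
    ∑ π, F π = ∑ S : Shuffle p q n, ∑ σ : Equiv.Perm (Fin p), ∑ τ : Equiv.Perm (Fin q),
      F (S.perm h σ τ) := by
  rw [← Fintype.sum_bijective _ (perm_bijective h) (fun x => F (x.1.perm h x.2.1 x.2.2)) F
    fun _ => rfl, Fintype.sum_prod_type]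
  exact Finset.sum_congr rfl fun S _ => Fintype.sum_prod_type _

end Shuffle

/-! ### The shuffle map is a morphism of coalgebras -/

namespace CubicalChains

open CubicalSet Simplicial

variable (k : Type v) [CommRing k]

/-- If the coordinates of a simplex `u` outside the image of `α` are constant, then `[y, u]` is a
simplex of a face of `y`. -/
theorem triangulationMk_iterFace {Y : CubicalSet.{u}} {m p n : ℕ} (α : Fin p ↪o Fin n)
    (c : Fin n → Fin 2) (y : Y.cube n) (u : Fin (m + 1) →o (Fin n → Fin 2))
    (u' : Fin (m + 1) →o (Fin p → Fin 2)) (h : ∀ b j, u b (α j) = u' b j)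
    (hc : ∀ b i, i ∉ Set.range α → u b i = c i) :
    Y.triangulationMk y u = Y.triangulationMk (Y.iterFace α c y) u' := by
  have key : ∀ (n : ℕ) (α : Fin p ↪o Fin n) (c : Fin n → Fin 2) (y : Y.cube n)
      (u : Fin (m + 1) →o (Fin n → Fin 2)) (_ : ∀ b j, u b (α j) = u' b j)
      (_ : ∀ i, i ∈ Set.range α),
      Y.triangulationMk y u = Y.triangulationMk (Y.iterFace α c y) u' := by
    intro n α c y u h hs
    obtain rfl := eq_of_range_eq_univ α hs
    rw [iterFace_id]
    obtain rfl := orderEmb_eq_refl α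
    congr 1
    ext b : 2
    exact funext (h b)
  induction n with
  | zero => exact key 0 α c y u h fun i => i.elim0
  | succ n ih =>
    by_cases hs : ∀ i, i ∈ Set.range α
    · exact key _ α c y u h hs
    · push Not at hs
      obtain ⟨i, hi⟩ := hs
      rw [Y.iterFace_of_notMem α _ _ i hi, ← ih (eraseEmb α i hi) _ _ ((CubeMap.σ i).comp u),
        triangulationMk_pullback (.δ (c i) i y)]
      · congr 1
        ext b : 2
        funext j
        change u b j = Fin.insertNth (α := fun _ => Fin 2) i (c i) (fun j => u b (i.succAbove j)) j
        rcases Fin.eq_self_or_eq_succAbove i j with rfl | ⟨j, rfl⟩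
        · rw [Fin.insertNth_apply_same, hc b _ hi]
        · rw [Fin.insertNth_apply_succAbove]
      · intro b j
        change u b (i.succAbove _) = _
        rw [succAbove_eraseEmb, h]
      · intro b j hj
        refine hc b _ ?_
        rintro ⟨x, hx⟩
        exact hj ⟨x, Fin.succAbove_right_injective ((succAbove_eraseEmb α i hi x).trans hx)⟩

/-- The front face of `u_π` lies in the face of the cube spanned by the directions `π 1, …, π p`,
where the other coordinates are `0`. -/
theorem front_permSimplex {Y : CubicalSet.{u}} {p q n : ℕ} (h : p + q = n) (S : Shuffle p q n)
    (σ : Equiv.Perm (Fin p)) (τ : Equiv.Perm (Fin q)) (y : Y.cube n) (hp : 0 + p ≤ n) :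
    Y.triangulation.map (SimplexCategory.subinterval 0 p hp).op
      (Y.triangulationMk y (permSimplex (S.perm h σ τ))) =
      Y.triangulationMk (Y.iterFace S.α (fun _ => 0) y) (permSimplex σ) := by
  change Y.triangulationMk y ((permSimplex (S.perm h σ τ)).comp
    (SimplexCategory.subinterval 0 p hp).toOrderHom) = _
  refine triangulationMk_iterFace _ _ _ _ _ (fun b j => ?_) (fun b i hi => ?_)
  · change (if ((S.perm h σ τ).symm (S.α j) : ℕ) < (b : ℕ) + 0 then _ else _) = _
    rw [S.perm_symm_α]
    rfl
  · obtain ⟨j, rfl⟩ := S.mem_range_β.2 hi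
    change (if ((S.perm h σ τ).symm (S.β j) : ℕ) < (b : ℕ) + 0 then _ else _) = _
    have hb : (b : ℕ) < p + 1 := b.2
    rw [S.perm_symm_β, if_neg (by omega)]

/-- The back face of `u_π` lies in the face of the cube spanned by the last `q` values of `π`, where
the other coordinates are `1`. -/
theorem back_permSimplex {Y : CubicalSet.{u}} {p q n : ℕ} (h : p + q = n) (S : Shuffle p q n)
    (σ : Equiv.Perm (Fin p)) (τ : Equiv.Perm (Fin q)) (y : Y.cube n) (hp : p + q ≤ n) :
    Y.triangulation.map (SimplexCategory.subinterval p q hp).op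
      (Y.triangulationMk y (permSimplex (S.perm h σ τ))) =
      Y.triangulationMk (Y.iterFace S.β (fun _ => 1) y) (permSimplex τ) := by
  change Y.triangulationMk y ((permSimplex (S.perm h σ τ)).comp
    (SimplexCategory.subinterval p q hp).toOrderHom) = _
  refine triangulationMk_iterFace _ _ _ _ _ (fun b j => ?_) (fun b i hi => ?_)
  · change (if ((S.perm h σ τ).symm (S.β j) : ℕ) < (b : ℕ) + p then _ else _) = _
    rw [S.perm_symm_β, add_comm (b : ℕ)]
    simp only [Nat.add_lt_add_iff_left]
    rfl
  · obtain ⟨j, rfl⟩ := S.mem_range_α.2 hi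
    change (if ((S.perm h σ τ).symm (S.α j) : ℕ) < (b : ℕ) + p then _ else _) = _
    rw [S.perm_symm_α, if_pos (by omega)]

/-- The shuffle map is compatible with the diagonals: a permutation of `{1, …, n}` is the same as a
`(p, q)`-shuffle together with permutations of its two parts. -/
theorem comul_sh (Y : CubicalSet.{u}) (p q n : ℕ) (h : p + q = n) :
    SimplicialChains.comul k Y.triangulation p q n h ∘ₗ sh k Y n =
      TensorProduct.map (sh k Y p) (sh k Y q) ∘ₗ comul k Y p q n := by
  refine NormChains.hom_ext fun y => ?_
  rw [LinearMap.comp_apply, LinearMap.comp_apply, sh_mk, map_sum, Shuffle.sum_perm h]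
  simp only [comul, SimplicialChains.comul, NormChains.desc_mk, map_zsmul, map_sum,
    TensorProduct.map_tmul, sh_mk, front_permSimplex, back_permSimplex]
  refine Finset.sum_congr rfl fun S _ => ?_
  rw [TensorProduct.sum_tmul, Finset.smul_sum]
  refine Finset.sum_congr rfl fun σ _ => ?_
  rw [TensorProduct.tmul_sum, Finset.smul_sum]
  refine Finset.sum_congr rfl fun τ _ => ?_
  rw [Shuffle.sign_perm, TensorProduct.tmul_smul, ← TensorProduct.smul_tmul', smul_smul, smul_smul]
  congr 1
  ring

theorem counit_sh (Y : CubicalSet.{u}) :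
    SimplicialChains.counit k Y.triangulation ∘ₗ sh k Y 0 = counit k Y := by
  refine NormChains.hom_ext fun y => ?_
  rw [LinearMap.comp_apply, sh_mk]
  simp [counit, SimplicialChains.counit]

/-- The inner faces of the simplices `u_π` cancel in pairs, since omitting a vertex between two
consecutive jumps forgets their order. -/
theorem d_sh_middle {Y : CubicalSet.{u}} {n : ℕ} (y : Y.cube (n + 1)) (a : Fin n) :
    ∑ π : Equiv.Perm (Fin (n + 1)), (Equiv.Perm.sign π : ℤ) •
      NormChains.mk k (Y.triangulation.degenerate n)
        (Y.triangulation.δ a.castSucc.succ (Y.triangulationMk y (permSimplex π))) = 0 := by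
  have hne : a.castSucc ≠ a.succ := by simp [Fin.ext_iff]
  refine Finset.sum_involution (fun π _ => π * Equiv.swap a.castSucc a.succ) ?_ ?_ ?_ ?_
  · intro π _
    have e : faceSimplex a.castSucc.succ (permSimplex (π * Equiv.swap a.castSucc a.succ)) =
        faceSimplex a.castSucc.succ (permSimplex π) := by
      ext b : 2
      funext i
      have hs : (π * Equiv.swap a.castSucc a.succ).symm i =
        Equiv.swap a.castSucc a.succ (π.symm i) := rfl
      change (if ((π * Equiv.swap a.castSucc a.succ).symm i : ℕ) <
        (a.castSucc.succ.succAbove b : ℕ) then _ else _) =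
        (if (π.symm i : ℕ) < (a.castSucc.succ.succAbove b : ℕ) then _ else _)
      have hb : (a.castSucc.succ.succAbove b : ℕ) ≠ a + 1 := fun h =>
        Fin.succAbove_ne a.castSucc.succ b (Fin.ext (by simpa using h))
      rw [hs]
      refine if_congr ?_ rfl rfl
      by_cases h1 : π.symm i = a.castSucc
      · rw [h1, Equiv.swap_apply_left, Fin.val_succ, Fin.val_castSucc]
        omega
      by_cases h2 : π.symm i = a.succ
      · rw [h2, Equiv.swap_apply_right, Fin.val_succ, Fin.val_castSucc]
        omega
      rw [Equiv.swap_apply_of_ne_of_ne h1 h2]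
    rw [triangulation_δ, triangulation_δ, e, ← add_smul, Equiv.Perm.sign_mul,
      Equiv.Perm.sign_swap hne]
    simp
  · intro π _ _ h
    have := congrArg (fun σ => π⁻¹ * σ) h
    simp [hne] at this
  · simp
  · intro π _
    simp [mul_assoc]

/-- The shuffle map is a chain map. The inner faces cancel, while the first and the last vertices of
the simplices `u_π` lead to the faces of the cube with a coordinate equal to `1` and `0`,
respectively. -/
theorem d_sh (Y : CubicalSet.{u}) (n : ℕ) :
    SimplicialChains.d k Y.triangulation n ∘ₗ sh k Y (n + 1) = sh k Y n ∘ₗ d k Y n := by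
  refine NormChains.hom_ext fun y => ?_
  rw [LinearMap.comp_apply, LinearMap.comp_apply, sh_mk, map_sum, d_mk]
  simp only [map_zsmul, simplicial_d_mk, Finset.smul_sum]
  rw [Finset.sum_comm, Fin.sum_univ_succ, Fin.sum_univ_castSucc]
  have hz : ∀ (z : ℤ) (f : Equiv.Perm (Fin (n + 1)) → NormChains k (Y.triangulation.degenerate n)),
      ∑ π : Equiv.Perm (Fin (n + 1)), (Equiv.Perm.sign π : ℤ) • z • f π =
        z • ∑ π : Equiv.Perm (Fin (n + 1)), (Equiv.Perm.sign π : ℤ) • f π := by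
    intro z f
    rw [Finset.smul_sum]
    exact Finset.sum_congr rfl fun π _ => smul_comm _ _ _
  simp only [hz, Fin.succ_castSucc]
  have hm : ∀ a : Fin n, _ := fun a => d_sh_middle k y a
  simp only [Fin.succ_castSucc] at hm
  rw [Finset.sum_eq_zero (s := (Finset.univ : Finset (Fin n))) (fun a _ => by rw [hm, smul_zero]),
    zero_add]
  -- omitting the first vertex gives the back faces, which are indexed by `(1, n)`-shuffles
  have h0 : ∑ π : Equiv.Perm (Fin (n + 1)), (Equiv.Perm.sign π : ℤ) •
      NormChains.mk k (Y.triangulation.degenerate n)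
        (Y.triangulation.δ 0 (Y.triangulationMk y (permSimplex π))) =
      ∑ i : Fin (n + 1), (-1 : ℤ) ^ (i : ℕ) • sh k Y n (NormChains.mk k _ (Y.d 1 i y)) := by
    have e : ∀ u : Fin (n + 2) →o (Fin (n + 1) → Fin 2),
        Y.triangulation.δ 0 (Y.triangulationMk y u) =
        Y.triangulation.map (SimplexCategory.subinterval 1 n (by omega)).op
          (Y.triangulationMk y u) := by
      intro u
      rw [triangulation_δ, faceSimplex_zero]
      rfl
    have e1 : ∀ i : Fin (n + 1), inversionSign (constEmb i) i.succAboveOrderEmb • sh k Y n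
        (NormChains.mk k _ (Y.iterFace i.succAboveOrderEmb (fun _ => 1) y)) =
          (-1 : ℤ) ^ (i : ℕ) • sh k Y n (NormChains.mk k _ (Y.d 1 i y)) := fun i => by
      rw [iterFace_succAbove, neg_one_pow_eq_inversionSign]
    rw [Shuffle.sum_perm (p := 1) (q := n) (by omega)]
    simp only [e, back_permSimplex, Shuffle.sign_perm]
    rw [← Finset.sum_congr rfl (fun i _ => e1 i), ← Shuffle.sum_single' (fun α β =>
      inversionSign α β • sh k Y n (NormChains.mk k _ (Y.iterFace β (fun _ => 1) y)))]
    refine Finset.sum_congr rfl fun S _ => ?_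
    rw [Fintype.sum_unique, sh_mk, Finset.smul_sum]
    refine Finset.sum_congr rfl fun τ _ => ?_
    rw [smul_smul, Subsingleton.elim (default : Equiv.Perm (Fin 1)) 1, Equiv.Perm.sign_one,
      Units.val_one, mul_one]
    rfl
  -- omitting the last vertex gives the front faces, which are indexed by `(n, 1)`-shuffles
  have hl : (-1 : ℤ) ^ (n + 1) • ∑ π : Equiv.Perm (Fin (n + 1)), (Equiv.Perm.sign π : ℤ) •
      NormChains.mk k (Y.triangulation.degenerate n)
        (Y.triangulation.δ (Fin.last (n + 1)) (Y.triangulationMk y (permSimplex π))) =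
      ∑ i : Fin (n + 1), (-1 : ℤ) ^ ((i : ℕ) + 1) • sh k Y n (NormChains.mk k _ (Y.d 0 i y)) := by
    have e : ∀ u : Fin (n + 2) →o (Fin (n + 1) → Fin 2),
        Y.triangulation.δ (Fin.last (n + 1)) (Y.triangulationMk y u) =
        Y.triangulation.map (SimplexCategory.subinterval 0 n (by omega)).op
          (Y.triangulationMk y u) := by
      intro u
      refine congrArg (Y.triangulationMk y) ?_
      ext b : 2
      change u ((Fin.last (n + 1)).succAbove b) = u _
      rw [Fin.succAbove_last]
      rfl
    have e1 : ∀ i : Fin (n + 1), (-1 : ℤ) ^ (n + 1) •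
        inversionSign i.succAboveOrderEmb (constEmb i) • sh k Y n
        (NormChains.mk k _ (Y.iterFace i.succAboveOrderEmb (fun _ => 0) y)) =
          (-1 : ℤ) ^ ((i : ℕ) + 1) • sh k Y n (NormChains.mk k _ (Y.d 0 i y)) := fun i => by
      rw [iterFace_succAbove, smul_smul, pow_succ, pow_succ, neg_one_pow_eq_inversionSign,
        ← inversionSign_comm i.succAboveOrderEmb (constEmb i) (fun _ _ => Fin.succAbove_ne _ _)]
      congr 1
      ring
    rw [Shuffle.sum_perm (p := n) (q := 1) rfl]
    simp only [e, front_permSimplex, Shuffle.sign_perm]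
    rw [← Finset.sum_congr rfl (fun i _ => e1 i), ← Finset.smul_sum,
      ← Shuffle.sum_single (fun α β =>
      inversionSign α β • sh k Y n (NormChains.mk k _ (Y.iterFace α (fun _ => 0) y)))]
    congr 1
    refine Finset.sum_congr rfl fun S _ => ?_
    rw [sh_mk, Finset.smul_sum]
    refine Finset.sum_congr rfl fun τ _ => ?_
    rw [Fintype.sum_unique, smul_smul, Subsingleton.elim (default : Equiv.Perm (Fin 1)) 1,
      Equiv.Perm.sign_one, Units.val_one, mul_one]
    rfl
  have hl' : ((Fin.last n).succ : Fin (n + 2)) = Fin.last (n + 1) := rfl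
  rw [h0, hl', Fin.val_last, hl, Fin.val_zero, pow_zero, one_smul, map_sum,
    ← Finset.sum_add_distrib]
  refine Finset.sum_congr rfl fun i _ => ?_
  rw [map_zsmul, map_sub, smul_sub, pow_succ]
  simp
  abel

end CubicalChains

/-! ### The cube category acting on maps into a cube -/

namespace CubeMap

/-- The coordinates of a point of `2^n`, as a sequence indexed by the natural numbers and extended
by `0`. -/
def coord {n : ℕ} (t : Fin n → Fin 2) (a : ℕ) : Fin 2 :=
  if h : a < n then t ⟨a, h⟩ else 0

theorem coord_injective {n : ℕ} : Function.Injective (coord (n := n)) := by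
  intro t t' h
  funext i
  simpa [coord] using congrFun h i

theorem coord_δ {n : ℕ} (ε : Fin 2) (i : Fin (n + 1)) (t : Fin n → Fin 2) (a : ℕ) :
    coord (δ ε i t) a = if a < i then coord t a else if a = i then ε else coord t (a - 1) := by
  by_cases ha : a < n + 1
  · rw [coord, dif_pos ha]
    change Fin.insertNth (α := fun _ => Fin 2) i ε t ⟨a, ha⟩ = _
    rcases Fin.eq_self_or_eq_succAbove i ⟨a, ha⟩ with h | ⟨j, h⟩
    · have h' : a = i := congrArg Fin.val h
      rw [h, Fin.insertNth_apply_same, if_neg (by omega), if_pos h']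
    · rw [h, Fin.insertNth_apply_succAbove]
      have h' : a = (i.succAbove j : ℕ) := congrArg Fin.val h
      simp only [Fin.succAbove, Fin.lt_def, Fin.val_castSucc] at h'
      split_ifs at h' with h1
      · simp only [Fin.val_castSucc] at h'
        subst h'
        rw [if_pos h1, coord, dif_pos j.2]
      · simp only [Fin.val_succ] at h'
        subst h'
        rw [if_neg (by omega), if_neg (by omega), Nat.add_sub_cancel, coord, dif_pos j.2]
  · have := i.2
    rw [coord, dif_neg ha, if_neg (by omega), if_neg (by omega), coord, dif_neg (by omega)]

theorem coord_σ {n : ℕ} (i : Fin (n + 1)) (t : Fin (n + 1) → Fin 2) (a : ℕ) :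
    coord (σ i t) a = if a < i then coord t a else coord t (a + 1) := by
  have hi := i.2
  by_cases ha : a < n
  · rw [coord, dif_pos ha]
    change t (i.succAbove ⟨a, ha⟩) = _
    simp only [Fin.succAbove, Fin.lt_def, Fin.val_castSucc]
    split_ifs with h
    · rw [coord, dif_pos (by omega)]; rfl
    · rw [coord, dif_pos (by omega)]; rfl
  · rw [coord, dif_neg ha, if_neg (by omega), coord, dif_neg (by omega)]

theorem coord_γ {n : ℕ} (i : Fin (n + 1)) (t : Fin (n + 2) → Fin 2) (a : ℕ) :
    coord (γ i t) a = if a < i then coord t a else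
      if a = i then min (coord t a) (coord t (a + 1)) else coord t (a + 1) := by
  have hi := i.2
  by_cases ha : a < n + 1
  · rw [coord, dif_pos ha]
    change (if (⟨a, ha⟩ : Fin (n + 1)) < i then t _ else if ⟨a, ha⟩ = i then min (t _) (t _) else
      t _) = _
    simp only [Fin.lt_def, Fin.ext_iff]
    split_ifs with h h'
    · rw [coord, dif_pos (by omega)]; rfl
    · subst h'
      rw [coord, dif_pos (by omega), coord, dif_pos (by omega)]; rfl
    · rw [coord, dif_pos (by omega)]; rfl
  · rw [coord, dif_neg ha, if_neg (by omega), if_neg (by omega), coord, dif_neg (by omega)]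

theorem hom_ext {m n : ℕ} {f g : (Fin m → Fin 2) →o (Fin n → Fin 2)}
    (h : ∀ t a, coord (f t) a = coord (g t) a) : f = g :=
  OrderHom.ext _ _ (funext fun t => coord_injective (funext (h t)))

section identities

variable {n : ℕ}

theorem δ_δ (ε ε' : Fin 2) (i j : Fin (n + 1)) (h : i ≤ j) :
    (δ ε' j.succ).comp (δ ε i) = (δ ε i.castSucc).comp (δ ε' j) := by
  refine hom_ext fun t a => ?_
  rw [Fin.le_def] at h
  simp only [OrderHom.comp_coe, Function.comp_apply, coord_δ, Fin.val_succ, Fin.val_castSucc]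
  grind

theorem σ_σ (i j : Fin (n + 1)) (h : i ≤ j) :
    (σ j).comp (σ i.castSucc) = (σ i).comp (σ j.succ) := by
  refine hom_ext fun t a => ?_
  rw [Fin.le_def] at h
  simp only [OrderHom.comp_coe, Function.comp_apply, coord_σ, Fin.val_succ, Fin.val_castSucc]
  grind

theorem σ_δ_of_lt (ε : Fin 2) (i j : Fin (n + 1)) (h : i ≤ j) :
    (σ j.succ).comp (δ ε i.castSucc) = (δ ε i).comp (σ j) := by
  refine hom_ext fun t a => ?_
  rw [Fin.le_def] at h
  simp only [OrderHom.comp_coe, Function.comp_apply, coord_σ, coord_δ, Fin.val_succ,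
    Fin.val_castSucc]
  grind

theorem σ_δ_self (ε : Fin 2) (i : Fin (n + 1)) :
    (σ i).comp (δ ε i) = OrderHom.id := by
  refine hom_ext fun t a => ?_
  simp only [OrderHom.comp_coe, Function.comp_apply, coord_σ, coord_δ, OrderHom.id_coe, id]
  grind

theorem σ_δ_of_gt (ε : Fin 2) (i j : Fin (n + 1)) (h : j ≤ i) :
    (σ j.castSucc).comp (δ ε i.succ) = (δ ε i).comp (σ j) := by
  refine hom_ext fun t a => ?_
  rw [Fin.le_def] at h
  simp only [OrderHom.comp_coe, Function.comp_apply, coord_σ, coord_δ, Fin.val_succ,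
    Fin.val_castSucc]
  grind

theorem γ_γ (i j : Fin (n + 1)) (h : i ≤ j) :
    (γ j).comp (γ i.castSucc) = (γ i).comp (γ j.succ) := by
  refine hom_ext fun t a => ?_
  rw [Fin.le_def] at h
  simp only [OrderHom.comp_coe, Function.comp_apply, coord_γ, Fin.val_succ, Fin.val_castSucc]
  grind

theorem γ_δ_of_lt (ε : Fin 2) (i j : Fin (n + 1)) (h : i ≤ j) :
    (γ j.succ).comp (δ ε i.castSucc.castSucc) = (δ ε i.castSucc).comp (γ j) := by
  refine hom_ext fun t a => ?_
  rw [Fin.le_def] at h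
  simp only [OrderHom.comp_coe, Function.comp_apply, coord_γ, coord_δ, Fin.val_succ,
    Fin.val_castSucc]
  grind

theorem γ_δ_zero_castSucc (j : Fin (n + 1)) :
    (γ j).comp (δ 0 j.castSucc) = (δ 0 j).comp (σ j) := by
  have : ∀ x : Fin 2, min 0 x = 0 := by decide
  refine hom_ext fun t a => ?_
  simp only [OrderHom.comp_coe, Function.comp_apply, coord_γ, coord_δ, coord_σ,
    Fin.val_castSucc]
  grind

theorem γ_δ_zero_succ (j : Fin (n + 1)) :
    (γ j).comp (δ 0 j.succ) = (δ 0 j).comp (σ j) := by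
  have : ∀ x : Fin 2, min x 0 = 0 := by decide
  refine hom_ext fun t a => ?_
  simp only [OrderHom.comp_coe, Function.comp_apply, coord_γ, coord_δ, coord_σ,
    Fin.val_succ]
  grind

theorem γ_δ_one_castSucc (j : Fin (n + 1)) : (γ j).comp (δ 1 j.castSucc) = OrderHom.id := by
  have : ∀ x : Fin 2, min 1 x = x := by decide
  refine hom_ext fun t a => ?_
  simp only [OrderHom.comp_coe, Function.comp_apply, coord_γ, coord_δ, OrderHom.id_coe, id,
    Fin.val_castSucc]
  grind

theorem γ_δ_one_succ (j : Fin (n + 1)) : (γ j).comp (δ 1 j.succ) = OrderHom.id := by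
  have : ∀ x : Fin 2, min x 1 = x := by decide
  refine hom_ext fun t a => ?_
  simp only [OrderHom.comp_coe, Function.comp_apply, coord_γ, coord_δ, OrderHom.id_coe, id,
    Fin.val_succ]
  grind

theorem γ_δ_of_gt (ε : Fin 2) (i j : Fin (n + 1)) (h : j ≤ i) :
    (γ j.castSucc).comp (δ ε i.succ.succ) = (δ ε i.succ).comp (γ j) := by
  refine hom_ext fun t a => ?_
  rw [Fin.le_def] at h
  simp only [OrderHom.comp_coe, Function.comp_apply, coord_γ, coord_δ, Fin.val_succ,
    Fin.val_castSucc]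
  grind

theorem σ_γ_of_lt (i j : Fin (n + 1)) (h : i ≤ j) :
    (σ j.succ).comp (γ i.castSucc) = (γ i).comp (σ j.succ.succ) := by
  refine hom_ext fun t a => ?_
  rw [Fin.le_def] at h
  simp only [OrderHom.comp_coe, Function.comp_apply, coord_γ, coord_σ, Fin.val_succ,
    Fin.val_castSucc]
  grind

theorem σ_γ_self (i : Fin (n + 1)) : (σ i).comp (γ i) = (σ i).comp (σ i.succ) := by
  refine hom_ext fun t a => ?_
  simp only [OrderHom.comp_coe, Function.comp_apply, coord_γ, coord_σ, Fin.val_succ]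
  grind

theorem σ_γ_of_gt (i j : Fin (n + 1)) (h : j ≤ i) :
    (σ j.castSucc).comp (γ i.succ) = (γ i).comp (σ j.castSucc.castSucc) := by
  refine hom_ext fun t a => ?_
  rw [Fin.le_def] at h
  simp only [OrderHom.comp_coe, Function.comp_apply, coord_γ, coord_σ, Fin.val_succ,
    Fin.val_castSucc]
  grind

end identities

end CubeMap

namespace CubicalSet

/-- The cubical set whose `m`-cubes are all weakly increasing maps `2^m → 2^n`. It contains the
standard `n`-cube, whose cubes are the morphisms of the cube category; admitting all weakly
increasing maps does no harm, as they can still be applied to the simplices of `2^m`. -/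
abbrev mapsToCube (n : ℕ) : CubicalSet.{u} where
  cube m := ULift.{u} ((Fin m → Fin 2) →o (Fin n → Fin 2))
  d ε i f := ⟨f.down.comp (CubeMap.δ ε i)⟩
  s i f := ⟨f.down.comp (CubeMap.σ i)⟩
  conn i f := ⟨f.down.comp (CubeMap.γ i)⟩
  d_d ε ε' i j f h := congrArg (fun g => ULift.up (f.down.comp g)) (CubeMap.δ_δ ε ε' i j h)
  s_s i j f h := congrArg (fun g => ULift.up (f.down.comp g)) (CubeMap.σ_σ i j h)
  d_s_of_lt ε i j f h := congrArg (fun g => ULift.up (f.down.comp g)) (CubeMap.σ_δ_of_lt ε i j h)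
  d_s_self ε i f := congrArg (fun g => ULift.up (f.down.comp g)) (CubeMap.σ_δ_self ε i)
  d_s_of_gt ε i j f h := congrArg (fun g => ULift.up (f.down.comp g)) (CubeMap.σ_δ_of_gt ε i j h)
  conn_conn i j f h := congrArg (fun g => ULift.up (f.down.comp g)) (CubeMap.γ_γ i j h)
  d_conn_of_lt ε i j f h := congrArg (fun g => ULift.up (f.down.comp g)) (CubeMap.γ_δ_of_lt ε i j h)
  d_zero_castSucc_conn j f := congrArg (fun g => ULift.up (f.down.comp g))
    (CubeMap.γ_δ_zero_castSucc j)
  d_zero_succ_conn j f := congrArg (fun g => ULift.up (f.down.comp g)) (CubeMap.γ_δ_zero_succ j)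
  d_one_castSucc_conn j f := congrArg (fun g => ULift.up (f.down.comp g))
    (CubeMap.γ_δ_one_castSucc j)
  d_one_succ_conn j f := congrArg (fun g => ULift.up (f.down.comp g)) (CubeMap.γ_δ_one_succ j)
  d_conn_of_gt ε i j f h := congrArg (fun g => ULift.up (f.down.comp g)) (CubeMap.γ_δ_of_gt ε i j h)
  conn_s_of_lt i j f h := congrArg (fun g => ULift.up (f.down.comp g)) (CubeMap.σ_γ_of_lt i j h)
  conn_s_self i f := congrArg (fun g => ULift.up (f.down.comp g)) (CubeMap.σ_γ_self i)
  conn_s_of_gt i j f h := congrArg (fun g => ULift.up (f.down.comp g)) (CubeMap.σ_γ_of_gt i j h)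

/-- Composition with a weakly increasing map `2^l → 2^n`. -/
def postcomp {l n : ℕ} (f : (Fin l → Fin 2) →o (Fin n → Fin 2)) :
    Hom (mapsToCube.{u} l) (mapsToCube.{u} n) where
  app _ g := ⟨f.comp g.down⟩
  app_d _ _ _ := rfl
  app_s _ _ := rfl
  app_conn _ _ := rfl

/-- The cubical set of all pairs `(f^* y, f)`, where `f` is a morphism of the cube category. It
takes the place of the standard cube, but maps to `Y` by construction. -/
abbrev pullbacks (Y : CubicalSet.{u}) {n : ℕ} (y : Y.cube n) : CubicalSet.{u} where
  cube m := {x : Y.cube m × (mapsToCube.{u} n).cube m // Y.Pullback x.2.down y x.1}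
  d ε i x := ⟨(Y.d ε i x.1.1, (mapsToCube n).d ε i x.1.2), x.2.comp (.δ ε i _)⟩
  s i x := ⟨(Y.s i x.1.1, (mapsToCube n).s i x.1.2), x.2.comp (.σ i _)⟩
  conn i x := ⟨(Y.conn i x.1.1, (mapsToCube n).conn i x.1.2), x.2.comp (.γ i _)⟩
  d_d ε ε' i j _ h := Subtype.ext (Prod.ext (Y.d_d ε ε' i j _ h)
    ((mapsToCube n).d_d ε ε' i j _ h))
  s_s i j _ h := Subtype.ext (Prod.ext (Y.s_s i j _ h)
    ((mapsToCube n).s_s i j _ h))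
  d_s_of_lt ε i j _ h := Subtype.ext (Prod.ext (Y.d_s_of_lt ε i j _ h)
    ((mapsToCube n).d_s_of_lt ε i j _ h))
  d_s_self ε i _ := Subtype.ext (Prod.ext (Y.d_s_self ε i _)
    ((mapsToCube n).d_s_self ε i _))
  d_s_of_gt ε i j _ h := Subtype.ext (Prod.ext (Y.d_s_of_gt ε i j _ h)
    ((mapsToCube n).d_s_of_gt ε i j _ h))
  conn_conn i j _ h := Subtype.ext (Prod.ext (Y.conn_conn i j _ h)
    ((mapsToCube n).conn_conn i j _ h))
  d_conn_of_lt ε i j _ h := Subtype.ext (Prod.ext (Y.d_conn_of_lt ε i j _ h)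
    ((mapsToCube n).d_conn_of_lt ε i j _ h))
  d_zero_castSucc_conn j _ := Subtype.ext (Prod.ext (Y.d_zero_castSucc_conn j _)
    ((mapsToCube n).d_zero_castSucc_conn j _))
  d_zero_succ_conn j _ := Subtype.ext (Prod.ext (Y.d_zero_succ_conn j _)
    ((mapsToCube n).d_zero_succ_conn j _))
  d_one_castSucc_conn j _ := Subtype.ext (Prod.ext (Y.d_one_castSucc_conn j _)
    ((mapsToCube n).d_one_castSucc_conn j _))
  d_one_succ_conn j _ := Subtype.ext (Prod.ext (Y.d_one_succ_conn j _)
    ((mapsToCube n).d_one_succ_conn j _))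
  d_conn_of_gt ε i j _ h := Subtype.ext (Prod.ext (Y.d_conn_of_gt ε i j _ h)
    ((mapsToCube n).d_conn_of_gt ε i j _ h))
  conn_s_of_lt i j _ h := Subtype.ext (Prod.ext (Y.conn_s_of_lt i j _ h)
    ((mapsToCube n).conn_s_of_lt i j _ h))
  conn_s_self i _ := Subtype.ext (Prod.ext (Y.conn_s_self i _)
    ((mapsToCube n).conn_s_self i _))
  conn_s_of_gt i j _ h := Subtype.ext (Prod.ext (Y.conn_s_of_gt i j _ h)
    ((mapsToCube n).conn_s_of_gt i j _ h))

/-- The projection `(f^* y, f) ↦ f^* y`. -/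
def pullbacksFst (Y : CubicalSet.{u}) {n : ℕ} (y : Y.cube n) : Hom (Y.pullbacks y) Y where
  app _ x := x.1.1
  app_d _ _ _ := rfl
  app_s _ _ := rfl
  app_conn _ _ := rfl

/-- The projection `(f^* y, f) ↦ f`. -/
def pullbacksSnd (Y : CubicalSet.{u}) {n : ℕ} (y : Y.cube n) :
    Hom (Y.pullbacks y) (mapsToCube.{u} n) where
  app _ x := x.1.2
  app_d _ _ _ := rfl
  app_s _ _ := rfl
  app_conn _ _ := rfl

end CubicalSet

/-! ### Simplicial cubes, and the idempotent given by the shuffle map and its left inverse -/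

/-- The morphisms of the cube category. -/
inductive IsCubeMap : ∀ {m n : ℕ}, ((Fin m → Fin 2) →o (Fin n → Fin 2)) → Prop
  | id {n : ℕ} : IsCubeMap (OrderHom.id : (Fin n → Fin 2) →o (Fin n → Fin 2))
  | δ {n : ℕ} (ε : Fin 2) (i : Fin (n + 1)) : IsCubeMap (CubeMap.δ ε i)
  | σ {n : ℕ} (i : Fin (n + 1)) : IsCubeMap (CubeMap.σ i)
  | γ {n : ℕ} (i : Fin (n + 1)) : IsCubeMap (CubeMap.γ i)
  | comp {l m n : ℕ} {f : (Fin m → Fin 2) →o (Fin n → Fin 2)}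
      {g : (Fin l → Fin 2) →o (Fin m → Fin 2)} : IsCubeMap f → IsCubeMap g → IsCubeMap (f.comp g)

namespace IsCubeMap

open CubicalSet

variable {m n : ℕ} {f : (Fin m → Fin 2) →o (Fin n → Fin 2)}

theorem pullback (h : IsCubeMap f) : ∀ {p : ℕ} (g : (mapsToCube.{u} p).cube n),
    (mapsToCube.{u} p).Pullback f g ⟨g.down.comp f⟩ := by
  induction h with
  | id => intro p g; exact .id _
  | δ ε i => intro p g; exact .δ ε i g
  | σ i => intro p g; exact .σ i g
  | γ i => intro p g; exact .γ i g
  | comp _ _ ih ih' => intro p g; exact (ih g).comp (ih' _)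

/-- The morphisms of the cube category preserve minima. This singles out the top vertex of a simplex
as the apex of the contraction below. -/
theorem map_inf (h : IsCubeMap f) : ∀ x y : Fin m → Fin 2, f (x ⊓ y) = f x ⊓ f y := by
  induction h with
  | id => intro x y; rfl
  | δ ε i =>
    intro x y
    funext j
    change Fin.insertNth (α := fun _ => Fin 2) i ε _ j =
      Fin.insertNth (α := fun _ => Fin 2) i ε _ j ⊓ Fin.insertNth (α := fun _ => Fin 2) i ε _ j
    rcases Fin.eq_self_or_eq_succAbove i j with rfl | ⟨j, rfl⟩
    · simp
    · simp
  | σ i => intro x y; rfl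
  | γ i =>
    intro x y
    funext j
    change (if _ then _ else if _ then _ else _) = (if _ then _ else if _ then _ else _) ⊓
      (if _ then _ else if _ then _ else _)
    split_ifs
    · rfl
    · exact inf_inf_inf_comm _ _ _ _
    · rfl
  | comp _ _ ih ih' => intro x y; simp only [OrderHom.comp_coe, Function.comp_apply, ih, ih']

end IsCubeMap

theorem CubicalSet.Pullback.isCubeMap {Y : CubicalSet.{u}} {m n : ℕ}
    {f : (Fin m → Fin 2) →o (Fin n → Fin 2)} {y : Y.cube n} {y' : Y.cube m}
    (h : Y.Pullback f y y') : IsCubeMap f := by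
  induction h with
  | id => exact .id
  | δ ε i => exact .δ ε i
  | σ i => exact .σ i
  | γ i => exact .γ i
  | comp _ _ ih ih' => exact ih.comp ih'

/-- The map `x ↦ min x v` from a cube to the face below the vertex `v`. -/
def meetMap {n : ℕ} (v : Fin n → Fin 2) : (Fin n → Fin 2) →o (Fin n → Fin 2) where
  toFun x := x ⊓ v
  monotone' _ _ h := inf_le_inf_right v h

/-- The map `x ↦ min x v` replaces some coordinates by `0`, and it is therefore a composite of
codegeneracies and cofaces. -/
theorem isCubeMap_meetMap {n : ℕ} (v : Fin n → Fin 2) : IsCubeMap (meetMap v) := by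
  have key : ∀ s : Finset (Fin n), IsCubeMap (meetMap fun i => if i ∈ s then 0 else 1) := by
    have h1 : ∀ x : Fin 2, min x 1 = x := by decide
    intro s
    induction s using Finset.induction_on with
    | empty =>
      convert IsCubeMap.id
      ext x : 2
      funext j
      exact h1 _
    | insert i s _ ih =>
      cases n with
      | zero => exact i.elim0
      | succ n =>
        convert (IsCubeMap.comp (.δ 0 i) (.σ i)).comp ih
        ext x : 2
        funext j
        change min (x j) (if j ∈ insert i s then 0 else 1) = Fin.insertNth (α := fun _ => Fin 2) i 0
          (fun j => min (x (i.succAbove j)) (if i.succAbove j ∈ s then 0 else 1)) j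
        rcases Fin.eq_self_or_eq_succAbove i j with rfl | ⟨j, rfl⟩
        · simp
        · simp [Fin.succAbove_ne]
  convert key (Finset.univ.filter fun i => v i = 0)
  rename_i i
  simp only [Finset.mem_filter, Finset.mem_univ, true_and]
  generalize v i = a
  revert a
  decide

open Simplicial in
/-- The nerve of the poset `2^n`, that is, the simplicial cube. -/
def cubeNerve (n : ℕ) : SSet.{u} where
  obj Δ := ULift.{u} (Fin (Δ.unop.len + 1) →o (Fin n → Fin 2))
  map θ := TypeCat.ofHom fun x => ⟨x.down.comp θ.unop.toOrderHom⟩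
  map_id _ := rfl
  map_comp _ _ := rfl

/-- The map of simplicial cubes induced by a weakly increasing map. -/
def cubeNerveMap {l n : ℕ} (f : (Fin l → Fin 2) →o (Fin n → Fin 2)) :
    cubeNerve.{u} l ⟶ cubeNerve.{u} n where
  app _ := TypeCat.ofHom fun x => ⟨f.comp x.down⟩
  naturality _ _ _ := rfl

open Simplicial in
/-- A simplex of the simplicial cube. -/
def cubeNerveMk {m n : ℕ} (u : Fin (m + 1) →o (Fin n → Fin 2)) : cubeNerve.{u} n _⦋m⦌ := ⟨u⟩

/-- The map `u ↦ [y, u]` from a simplicial cube to a triangulation. -/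
def charMap {Y : CubicalSet.{u}} {n : ℕ} (y : Y.cube n) : cubeNerve.{u} n ⟶ Y.triangulation where
  app _ := TypeCat.ofHom fun x => Y.triangulationMk y x.down
  naturality _ _ _ := rfl

theorem eq_comp_of_pullback_mapsToCube {p m n : ℕ} {f : (Fin m → Fin 2) →o (Fin n → Fin 2)}
    {g : (CubicalSet.mapsToCube.{u} p).cube n} {g' : (CubicalSet.mapsToCube.{u} p).cube m}
    (h : (CubicalSet.mapsToCube.{u} p).Pullback f g g') : g'.down = g.down.comp f := by
  induction h with
  | comp _ _ ih ih' => rw [ih', ih]; rfl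
  | _ => rfl

/-- The evaluation `[f, u] ↦ f ∘ u`. -/
def evalMap (n : ℕ) : (CubicalSet.mapsToCube.{u} n).triangulation ⟶ cubeNerve.{u} n where
  app _ := TypeCat.ofHom (Quot.lift (fun x => ⟨x.2.1.down.comp x.2.2⟩) (by
    rintro _ _ ⟨h, u⟩
    rw [eq_comp_of_pullback_mapsToCube h]
    rfl))
  naturality _ _ _ := by
    ext x
    obtain ⟨x, rfl⟩ := Quot.exists_rep x
    rfl

theorem charMap_pullback {Y : CubicalSet.{u}} {l n : ℕ} {f : (Fin l → Fin 2) →o (Fin n → Fin 2)}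
    {y : Y.cube n} {y' : Y.cube l} (h : Y.Pullback f y y') :
    charMap y' = cubeNerveMap f ≫ charMap y := by
  ext Δ x
  exact CubicalChains.triangulationMk_pullback h x.down

namespace SimplicialChains

open Simplicial

variable (k : Type v) [CommRing k]

theorem map_mk {X Z : SSet.{u}} (f : X ⟶ Z) (n : ℕ) (x : X _⦋n⦌) :
    map k f n (NormChains.mk k _ x) = NormChains.mk k _ (f.app _ x) :=
  NormChains.desc_mk _ _ _

theorem map_comp_apply {X Z W : SSet.{u}} (f : X ⟶ Z) (g : Z ⟶ W) (n : ℕ)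
    (c : NormChains k (X.degenerate n)) : map k (f ≫ g) n c = map k g n (map k f n c) := by
  suffices h : map k (f ≫ g) n = map k g n ∘ₗ map k f n from LinearMap.congr_fun h c
  refine NormChains.hom_ext fun x => ?_
  rw [LinearMap.comp_apply, map_mk, map_mk, map_mk]
  rfl

theorem map_d {X Z : SSet.{u}} (f : X ⟶ Z) (n : ℕ) (c : NormChains k (X.degenerate (n + 1))) :
    map k f n (d k X n c) = d k Z n (map k f (n + 1) c) :=
  LinearMap.congr_fun ((coalgebraMap k f).f_d n) c

end SimplicialChains

namespace CubicalChains

open CubicalSet Simplicial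

variable (k : Type v) [CommRing k]

/-- The map of triangulations induced by a morphism of cubical sets. -/
def triangulationMap {Y Z : CubicalSet.{u}} (f : Hom Y Z) : Y.triangulation ⟶ Z.triangulation :=
  triangulationFunctor.map (X := Y) (Y := Z) f

theorem sh_map {Y Z : CubicalSet.{u}} (f : Hom Y Z) (n : ℕ) (c : NormChains k (Y.thin n)) :
    sh k Z n (map k (Y := Y) (Z := Z) f n c) =
      SimplicialChains.map k (triangulationMap f) n (sh k Y n c) := by
  suffices h : sh k Z n ∘ₗ map k (Y := Y) (Z := Z) f n =
      SimplicialChains.map k (triangulationMap f) n ∘ₗ sh k Y n from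
    LinearMap.congr_fun h c
  refine NormChains.hom_ext fun y => ?_
  rw [LinearMap.comp_apply, LinearMap.comp_apply, map_mk, sh_mk, sh_mk]
  rw [map_sum]
  refine Finset.sum_congr rfl fun π _ => ?_
  rw [map_zsmul, SimplicialChains.map_mk]
  rfl

/-- The endomorphism of the chains on a simplicial cube that corresponds to the composition of the
Alexander–Whitney map and the shuffle map, obtained by evaluating this composition for `mapsToCube`
at the identity of `2^n`. -/
noncomputable def cubeProj (n m : ℕ) :
    NormChains k ((cubeNerve.{u} n).degenerate m) →ₗ[k]
      NormChains k ((cubeNerve.{u} n).degenerate m) :=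
  SimplicialChains.map k (evalMap n) m ∘ₗ sh k (mapsToCube.{u} n) m ∘ₗ
    awMap k (mapsToCube.{u} n) m ∘ₗ
      SimplicialChains.map k (charMap (Y := mapsToCube.{u} n) ⟨OrderHom.id⟩) m

theorem cubeProj_mk {n m : ℕ} (u : Fin (m + 1) →o (Fin n → Fin 2)) :
    cubeProj k n m (NormChains.mk k _ (cubeNerveMk.{u} u)) =
      SimplicialChains.map k (evalMap.{u} n) m (sh k (mapsToCube.{u} n) m
        (aw k n (mapsToCube.{u} n) (m := m) ⟨OrderHom.id⟩ u)) := by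
  rw [cubeProj, LinearMap.comp_apply, LinearMap.comp_apply, LinearMap.comp_apply,
    SimplicialChains.map_mk]
  exact congrArg (fun c => SimplicialChains.map k (evalMap n) m (sh k (mapsToCube n) m c))
    (awMap_mk k (Y := mapsToCube n) ⟨OrderHom.id⟩ u)

theorem cubeProj_d (n m : ℕ) (c : NormChains k ((cubeNerve.{u} n).degenerate (m + 1))) :
    SimplicialChains.d k _ m (cubeProj k n (m + 1) c) =
      cubeProj k n m (SimplicialChains.d k _ m c) := by
  have h1 := fun c => LinearMap.congr_fun (awMap_d k (mapsToCube.{u} n) m) c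
  have h2 := fun c => LinearMap.congr_fun (d_sh k (mapsToCube.{u} n) m) c
  simp only [LinearMap.comp_apply] at h1 h2
  simp only [cubeProj, LinearMap.comp_apply]
  rw [← SimplicialChains.map_d, h2, ← h1, ← SimplicialChains.map_d]

/-- The endomorphism `cubeProj` is natural with respect to the morphisms of the cube category. -/
theorem cubeProj_map {l n : ℕ} {f : (Fin l → Fin 2) →o (Fin n → Fin 2)} (hf : IsCubeMap f) (m : ℕ)
    (c : NormChains k ((cubeNerve.{u} l).degenerate m)) :
    cubeProj k n m (SimplicialChains.map k (cubeNerveMap f) m c) =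
      SimplicialChains.map k (cubeNerveMap f) m (cubeProj k l m c) := by
  suffices h : cubeProj k n m ∘ₗ SimplicialChains.map k (cubeNerveMap f) m =
      SimplicialChains.map k (cubeNerveMap f) m ∘ₗ cubeProj k l m from LinearMap.congr_fun h c
  refine NormChains.hom_ext fun x => ?_
  obtain ⟨u⟩ := x
  have e1 : SimplicialChains.map k (cubeNerveMap.{u} f) m (NormChains.mk k _ (cubeNerveMk u)) =
      NormChains.mk k _ (cubeNerveMk (f.comp u)) := SimplicialChains.map_mk _ _ _ _
  have e2 := aw_pullback k (hf.pullback (p := n) ⟨OrderHom.id⟩) u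
  have e3 := aw_nat k (postcomp.{u} f) (n := l) ⟨OrderHom.id⟩ u
  change cubeProj k n m (SimplicialChains.map k (cubeNerveMap.{u} f) m
    (NormChains.mk k _ (cubeNerveMk u))) = SimplicialChains.map k (cubeNerveMap.{u} f) m
      (cubeProj k l m (NormChains.mk k _ (cubeNerveMk u)))
  rw [e1, cubeProj_mk, cubeProj_mk, ← e2]
  change SimplicialChains.map k (evalMap n) m (sh k (mapsToCube n) m
    (aw k l (mapsToCube n) ((postcomp f).app l ⟨OrderHom.id⟩) u)) = _
  rw [e3, sh_map, ← SimplicialChains.map_comp_apply]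
  rw [← SimplicialChains.map_comp_apply]
  congr 2
  ext Δ x
  obtain ⟨x, rfl⟩ := Quot.exists_rep x
  rfl

/-- The composition of the Alexander–Whitney map and the shuffle map is given by `cubeProj` on every
simplicial cube of a triangulation. Both sides are compared with the composition for `pullbacks`,
which maps to both cubical sets involved. -/
theorem charMap_cubeProj {Y : CubicalSet.{u}} {n : ℕ} (y : Y.cube n) (m : ℕ)
    (u : Fin (m + 1) →o (Fin n → Fin 2)) :
    SimplicialChains.map k (charMap y) m (cubeProj k n m (NormChains.mk k _ (cubeNerveMk u))) =
      sh k Y m (aw k n Y y u) := by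
  have h : SimplicialChains.map k (charMap y) m ∘ₗ SimplicialChains.map k (evalMap n) m ∘ₗ
      sh k (mapsToCube.{u} n) m ∘ₗ
        map k (Y := Y.pullbacks y) (Z := mapsToCube.{u} n) (Y.pullbacksSnd y) m =
      sh k Y m ∘ₗ map k (Y := Y.pullbacks y) (Z := Y) (Y.pullbacksFst y) m := by
    refine NormChains.hom_ext fun x => ?_
    simp only [LinearMap.comp_apply]
    rw [map_mk, map_mk, sh_mk, sh_mk, map_sum, map_sum]
    refine Finset.sum_congr rfl fun π _ => ?_
    rw [map_zsmul, map_zsmul, SimplicialChains.map_mk, SimplicialChains.map_mk]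
    congr 2
    exact (triangulationMk_pullback x.2 _).symm
  rw [cubeProj_mk]
  have e1 := aw_nat k (Y.pullbacksSnd y) (n := n) ⟨(y, ⟨OrderHom.id⟩), .id y⟩ u
  have e2 := aw_nat k (Y.pullbacksFst y) (n := n) ⟨(y, ⟨OrderHom.id⟩), .id y⟩ u
  change aw k n (mapsToCube n) (m := m) ⟨OrderHom.id⟩ u = _ at e1
  change aw k n Y y u = _ at e2
  rw [e1, e2]
  exact LinearMap.congr_fun h _

theorem evalMap_sh_aw_zero {p n : ℕ} : ∀ (f : (mapsToCube.{u} p).cube n)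
    (u : Fin 1 →o (Fin n → Fin 2)),
    SimplicialChains.map k (evalMap p) 0 (sh k (mapsToCube.{u} p) 0
      (aw k n (mapsToCube.{u} p) f u)) = NormChains.mk k _ (cubeNerveMk (f.down.comp u)) := by
  induction n with
  | zero =>
    intro f u
    rw [aw, sh_mk, Fintype.sum_unique, map_zsmul, SimplicialChains.map_mk,
      Subsingleton.elim (default : Equiv.Perm (Fin 0)) 1, Equiv.Perm.sign_one, Units.val_one,
      one_smul, show u = permSimplex 1 from
        OrderHom.ext _ _ (funext fun _ => Subsingleton.elim _ _)]
    rfl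
  | succ n ih =>
    intro f u
    rw [aw_succ_zero, ih]
    have e : (CubeMap.δ (u 0 0) 0).comp (tailSimplex u) = u := by
      ext b : 2
      rw [Subsingleton.elim (α := Fin 1) b 0]
      exact Fin.insertNth_self_removeNth 0 (u 0)
    exact congrArg (fun g => NormChains.mk k ((cubeNerve p).degenerate 0)
      (cubeNerveMk (f.down.comp g))) e

theorem cubeProj_zero (n : ℕ) (c : NormChains k ((cubeNerve.{u} n).degenerate 0)) :
    cubeProj k n 0 c = c := by
  suffices h : cubeProj k n 0 = LinearMap.id from LinearMap.congr_fun h c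
  refine NormChains.hom_ext fun x => ?_
  obtain ⟨u⟩ := x
  change cubeProj k n 0 (NormChains.mk k _ (cubeNerveMk u)) = NormChains.mk k _ (cubeNerveMk u)
  rw [cubeProj_mk, evalMap_sh_aw_zero]
  rfl

end CubicalChains

/-! ### The contraction of a simplicial cube -/

namespace CubicalChains

open CubicalSet Simplicial

variable (k : Type v) [CommRing k]

/-- The simplex `(u₀ ⊓ v, …, u_m ⊓ v, v)`. -/
def coneSimplex {m n : ℕ} (v : Fin n → Fin 2) (u : Fin (m + 1) →o (Fin n → Fin 2)) :
    Fin (m + 2) →o (Fin n → Fin 2) where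
  toFun := Fin.snoc (α := fun _ => Fin n → Fin 2) (fun i => u i ⊓ v) v
  monotone' i j h := by
    induction j using Fin.lastCases with
    | last =>
      rw [Fin.snoc_last]
      induction i using Fin.lastCases with
      | last => rw [Fin.snoc_last]
      | cast i => rw [Fin.snoc_castSucc]; exact inf_le_right
    | cast j =>
      induction i using Fin.lastCases with
      | last => exact absurd h (Fin.castSucc_lt_last j).not_ge
      | cast i =>
        rw [Fin.snoc_castSucc, Fin.snoc_castSucc]
        exact inf_le_inf_right v (u.monotone (Fin.castSucc_le_castSucc_iff.1 h))

theorem coneSimplex_castSucc {m n : ℕ} (v : Fin n → Fin 2) (u : Fin (m + 1) →o (Fin n → Fin 2))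
    (i : Fin (m + 1)) : coneSimplex v u i.castSucc = u i ⊓ v :=
  Fin.snoc_castSucc (n := m + 1) (α := fun _ => Fin n → Fin 2) v (fun i => u i ⊓ v) i

theorem coneSimplex_last {m n : ℕ} (v : Fin n → Fin 2) (u : Fin (m + 1) →o (Fin n → Fin 2)) :
    coneSimplex v u (Fin.last (m + 1)) = v :=
  Fin.snoc_last (n := m + 1) (α := fun _ => Fin n → Fin 2) v (fun i => u i ⊓ v)

theorem comp_coneSimplex {l m n : ℕ} {f : (Fin l → Fin 2) →o (Fin n → Fin 2)} (hf : IsCubeMap f)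
    (v : Fin l → Fin 2) (u : Fin (m + 1) →o (Fin l → Fin 2)) :
    f.comp (coneSimplex v u) = coneSimplex (f v) (f.comp u) := by
  ext i : 2
  rw [OrderHom.comp_coe, Function.comp_apply]
  induction i using Fin.lastCases with
  | last => rw [coneSimplex_last, coneSimplex_last]
  | cast i => rw [coneSimplex_castSucc, coneSimplex_castSucc, hf.map_inf]; rfl

theorem faceSimplex_last_coneSimplex {m n : ℕ} (v : Fin n → Fin 2)
    (u : Fin (m + 1) →o (Fin n → Fin 2)) :
    faceSimplex (Fin.last (m + 1)) (coneSimplex v u) = (meetMap v).comp u := by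
  ext i : 2
  change coneSimplex v u ((Fin.last (m + 1)).succAbove i) = u i ⊓ v
  rw [Fin.succAbove_last, coneSimplex_castSucc]

theorem faceSimplex_castSucc_coneSimplex {m n : ℕ} (v : Fin n → Fin 2)
    (u : Fin (m + 2) →o (Fin n → Fin 2)) (j : Fin (m + 2)) :
    faceSimplex j.castSucc (coneSimplex v u) = coneSimplex v (faceSimplex j u) := by
  ext i : 2
  change coneSimplex v u (j.castSucc.succAbove i) = _
  induction i using Fin.lastCases with
  | last => rw [Fin.succAbove_castSucc_of_le _ _ (Fin.le_last j), Fin.succ_last, coneSimplex_last,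
      coneSimplex_last]
  | cast i =>
    rw [Fin.castSucc_succAbove_castSucc, coneSimplex_castSucc, coneSimplex_castSucc]
    rfl

theorem cubeNerveMk_mem_degenerate {m n : ℕ} (u : Fin (m + 2) →o (Fin n → Fin 2))
    (i : Fin (m + 1)) (h : u i.castSucc = u i.succ) :
    cubeNerveMk.{u} u ∈ (cubeNerve.{u} n).degenerate (m + 1) := by
  have e : cubeNerveMk.{u} u =
      (cubeNerve.{u} n).σ i (cubeNerveMk (faceSimplex i.castSucc u)) :=
    congrArg cubeNerveMk (eq_faceSimplex_comp_σ u i h)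
  rw [e]
  exact (cubeNerve.{u} n).σ_mem_degenerate i _

/-- The projection to the face of `2^n` below the vertex `v`, followed by the contraction of this
face to `v`. The contraction appends the vertex `v` to an `m`-simplex, with the sign
`(-1)^(m + 1)`. -/
noncomputable def cone (n m : ℕ) (v : Fin n → Fin 2) :
    NormChains k ((cubeNerve.{u} n).degenerate m) →ₗ[k]
      NormChains k ((cubeNerve.{u} n).degenerate (m + 1)) :=
  NormChains.desc (fun x => (-1 : ℤ) ^ (m + 1) •
    NormChains.mk k _ (cubeNerveMk (coneSimplex v (ULift.down x)))) (by
      intro x hx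
      cases m with
      | zero => simp at hx
      | succ m =>
        obtain ⟨i, ⟨u⟩, rfl⟩ := SimplicialChains.exists_eq_σ hx
        rw [NormChains.mk_eq_zero, smul_zero]
        refine cubeNerveMk_mem_degenerate _ i.castSucc ?_
        rw [Fin.succ_castSucc, coneSimplex_castSucc, coneSimplex_castSucc]
        change u (Fin.predAbove i i.castSucc) ⊓ v = u (Fin.predAbove i i.succ) ⊓ v
        simp)

theorem cone_mk {n m : ℕ} (v : Fin n → Fin 2) (u : Fin (m + 1) →o (Fin n → Fin 2)) :
    cone k n m v (NormChains.mk k _ (cubeNerveMk.{u} u)) =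
      (-1 : ℤ) ^ (m + 1) • NormChains.mk k _ (cubeNerveMk (coneSimplex v u)) :=
  NormChains.desc_mk _ _ _

theorem map_cubeNerveMap_mk {l n m : ℕ} (f : (Fin l → Fin 2) →o (Fin n → Fin 2))
    (u : Fin (m + 1) →o (Fin l → Fin 2)) :
    SimplicialChains.map k (cubeNerveMap f) m (NormChains.mk k _ (cubeNerveMk.{u} u)) =
      NormChains.mk k _ (cubeNerveMk (f.comp u)) :=
  SimplicialChains.map_mk _ _ _ _

theorem d_cubeNerveMk {n m : ℕ} (u : Fin (m + 2) →o (Fin n → Fin 2)) :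
    SimplicialChains.d k (cubeNerve.{u} n) m (NormChains.mk k _ (cubeNerveMk u)) =
      ∑ j : Fin (m + 2), (-1 : ℤ) ^ (j : ℕ) •
        NormChains.mk k _ (cubeNerveMk.{u} (faceSimplex j u)) :=
  simplicial_d_mk k _ _ _

theorem cubeNerve_hom_ext {n m : ℕ} {M : Type*} [AddCommGroup M] [Module k M]
    {f g : NormChains k ((cubeNerve.{u} n).degenerate m) →ₗ[k] M}
    (h : ∀ u, f (NormChains.mk k _ (cubeNerveMk u)) = g (NormChains.mk k _ (cubeNerveMk u))) :
    f = g :=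
  NormChains.hom_ext fun x => h x.down

/-- The contraction is natural because the morphisms of the cube category preserve minima. -/
theorem cone_map {l n m : ℕ} {f : (Fin l → Fin 2) →o (Fin n → Fin 2)} (hf : IsCubeMap f)
    (v : Fin l → Fin 2) (c : NormChains k ((cubeNerve.{u} l).degenerate m)) :
    cone k n m (f v) (SimplicialChains.map k (cubeNerveMap f) m c) =
      SimplicialChains.map k (cubeNerveMap f) (m + 1) (cone k l m v c) := by
  suffices h : cone k n m (f v) ∘ₗ SimplicialChains.map k (cubeNerveMap f) m =
      SimplicialChains.map k (cubeNerveMap f) (m + 1) ∘ₗ cone k l m v from LinearMap.congr_fun h c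
  refine cubeNerve_hom_ext k fun u => ?_
  rw [LinearMap.comp_apply, LinearMap.comp_apply, map_cubeNerveMap_mk, cone_mk, cone_mk, map_zsmul,
    map_cubeNerveMap_mk, comp_coneSimplex hf]

theorem d_cone {n m : ℕ} (v : Fin n → Fin 2)
    (c : NormChains k ((cubeNerve.{u} n).degenerate (m + 1))) :
    SimplicialChains.d k _ (m + 1) (cone k n (m + 1) v c) =
      SimplicialChains.map k (cubeNerveMap (meetMap v)) (m + 1) c -
        cone k n m v (SimplicialChains.d k _ m c) := by
  suffices h : SimplicialChains.d k _ (m + 1) ∘ₗ cone k n (m + 1) v =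
      SimplicialChains.map k (cubeNerveMap.{u} (meetMap v)) (m + 1) -
        cone k n m v ∘ₗ SimplicialChains.d k _ m from LinearMap.congr_fun h c
  refine cubeNerve_hom_ext k fun u => ?_
  rw [LinearMap.sub_apply, LinearMap.comp_apply, LinearMap.comp_apply, map_cubeNerveMap_mk, cone_mk,
    map_zsmul, d_cubeNerveMk, d_cubeNerveMk, map_sum, Fin.sum_univ_castSucc, smul_add,
    faceSimplex_last_coneSimplex, smul_smul, Fin.val_last, ← mul_pow, neg_mul_neg, one_mul, one_pow,
    one_smul, sub_eq_add_neg, Finset.smul_sum, ← Finset.sum_neg_distrib]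
  refine (add_comm _ _).trans (congrArg _ ?_)
  refine Finset.sum_congr rfl fun j _ => ?_
  rw [faceSimplex_castSucc_coneSimplex, map_zsmul, cone_mk, smul_smul, smul_smul, ← neg_smul,
    Fin.val_castSucc]
  congr 1
  ring

/-! ### The homotopy from the shuffle map composed with its left inverse to the identity -/

/-- The natural homotopy between the identity and `cubeProj`. On a simplex `u` with top vertex `v`,
it is the contraction to `v` of the chain `u - cubeProj u - h (d u)`, which lies below `v`. -/
noncomputable def cubeHomotopy (n m : ℕ) :
    NormChains k ((cubeNerve.{u} n).degenerate m) →ₗ[k]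
      NormChains k ((cubeNerve.{u} n).degenerate (m + 1)) :=
  match m with
  | 0 => 0
  | m + 1 => NormChains.desc (fun x =>
      cone k n (m + 1) (ULift.down x (Fin.last (m + 1))) (NormChains.mk k _ x -
        cubeProj k n (m + 1) (NormChains.mk k _ x) -
          cubeHomotopy n m (SimplicialChains.d k _ m (NormChains.mk k _ x)))) (by
      intro x hx
      simp only [NormChains.mk_eq_zero hx, map_zero, sub_zero])

theorem cubeHomotopy_succ_mk {n m : ℕ} (u : Fin (m + 2) →o (Fin n → Fin 2)) :
    cubeHomotopy k n (m + 1) (NormChains.mk k _ (cubeNerveMk.{u} u)) =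
      cone k n (m + 1) (u (Fin.last (m + 1))) (NormChains.mk k _ (cubeNerveMk u) -
        cubeProj k n (m + 1) (NormChains.mk k _ (cubeNerveMk u)) -
          cubeHomotopy k n m (SimplicialChains.d k _ m (NormChains.mk k _ (cubeNerveMk u)))) :=
  NormChains.desc_mk _ _ _

theorem cubeHomotopy_map {l n : ℕ} {f : (Fin l → Fin 2) →o (Fin n → Fin 2)} (hf : IsCubeMap f)
    (m : ℕ) (c : NormChains k ((cubeNerve.{u} l).degenerate m)) :
    cubeHomotopy k n m (SimplicialChains.map k (cubeNerveMap f) m c) =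
      SimplicialChains.map k (cubeNerveMap f) (m + 1) (cubeHomotopy k l m c) := by
  induction m with
  | zero => simp only [cubeHomotopy, LinearMap.zero_apply, map_zero]
  | succ m ih =>
    suffices h : cubeHomotopy k n (m + 1) ∘ₗ SimplicialChains.map k (cubeNerveMap f) (m + 1) =
        SimplicialChains.map k (cubeNerveMap f) (m + 2) ∘ₗ cubeHomotopy k l (m + 1) from
      LinearMap.congr_fun h c
    refine cubeNerve_hom_ext k fun u => ?_
    rw [LinearMap.comp_apply, LinearMap.comp_apply, cubeHomotopy_succ_mk, ← cone_map k hf,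
      map_sub (SimplicialChains.map k (cubeNerveMap f) (m + 1)),
      map_sub (SimplicialChains.map k (cubeNerveMap f) (m + 1)), ← cubeProj_map k hf, ← ih,
      SimplicialChains.map_d, map_cubeNerveMap_mk, cubeHomotopy_succ_mk]
    rfl

/-- The chain `w = u - cubeProj u - h (d u)` lies below the top vertex of `u`. Hence it is the
boundary of its contraction as soon as it is a cycle. -/
theorem d_cubeHomotopy_of_cycle {n m : ℕ} (u : Fin (m + 2) →o (Fin n → Fin 2))
    {w : NormChains k ((cubeNerve.{u} n).degenerate (m + 1))}
    (hw : w = NormChains.mk k _ (cubeNerveMk.{u} u) -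
      cubeProj k n (m + 1) (NormChains.mk k _ (cubeNerveMk u)) -
        cubeHomotopy k n m (SimplicialChains.d k _ m (NormChains.mk k _ (cubeNerveMk u))))
    (hd : SimplicialChains.d k _ m w = 0) :
    SimplicialChains.d k _ (m + 1)
      (cubeHomotopy k n (m + 1) (NormChains.mk k _ (cubeNerveMk u))) = w := by
  have hu : (meetMap (u (Fin.last (m + 1)))).comp u = u := by
    ext i : 2
    exact inf_eq_left.2 (u.monotone (Fin.le_last i))
  have hf := isCubeMap_meetMap (u (Fin.last (m + 1)))
  rw [cubeHomotopy_succ_mk, ← hw, d_cone, hd, map_zero, sub_zero, hw, map_sub, map_sub,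
    ← cubeProj_map k hf, ← cubeHomotopy_map k hf, SimplicialChains.map_d, map_cubeNerveMap_mk, hu]

/-- In positive degrees, `cubeHomotopy` is a homotopy between the identity and `cubeProj`. In degree
`0`, both it and the difference of these two maps vanish. -/
theorem d_cubeHomotopy (n m : ℕ) (c : NormChains k ((cubeNerve.{u} n).degenerate (m + 1))) :
    SimplicialChains.d k _ (m + 1) (cubeHomotopy k n (m + 1) c) +
      cubeHomotopy k n m (SimplicialChains.d k _ m c) = c - cubeProj k n (m + 1) c := by
  have hd : ∀ (m : ℕ) (c : NormChains k ((cubeNerve.{u} n).degenerate (m + 2))),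
      SimplicialChains.d k _ m (SimplicialChains.d k _ (m + 1) c) = 0 := fun m c =>
    LinearMap.congr_fun (SimplicialChains.d_comp_d k (cubeNerve.{u} n) m) c
  induction m with
  | zero =>
    suffices h : SimplicialChains.d k _ 1 ∘ₗ cubeHomotopy k n 1 +
        cubeHomotopy k n 0 ∘ₗ SimplicialChains.d k _ 0 = LinearMap.id - cubeProj.{u} k n 1 from
      LinearMap.congr_fun h c
    refine cubeNerve_hom_ext k fun u => ?_
    rw [LinearMap.add_apply, LinearMap.sub_apply, LinearMap.comp_apply, LinearMap.comp_apply,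
      d_cubeHomotopy_of_cycle k u rfl]
    · exact sub_add_cancel _ _
    -- in degree `0` there is no difference between the identity and `cubeProj`
    · rw [map_sub, map_sub, cubeProj_d, cubeProj_zero, sub_self, zero_sub, cubeHomotopy,
        LinearMap.zero_apply, map_zero, neg_zero]
  | succ m ih =>
    suffices h : SimplicialChains.d k _ (m + 2) ∘ₗ cubeHomotopy k n (m + 2) +
        cubeHomotopy k n (m + 1) ∘ₗ SimplicialChains.d k _ (m + 1) =
          LinearMap.id - cubeProj.{u} k n (m + 2) from LinearMap.congr_fun h c
    refine cubeNerve_hom_ext k fun u => ?_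
    rw [LinearMap.add_apply, LinearMap.sub_apply, LinearMap.comp_apply, LinearMap.comp_apply,
      d_cubeHomotopy_of_cycle k u rfl]
    · exact sub_add_cancel _ _
    · have h := ih (SimplicialChains.d k _ (m + 1) (NormChains.mk k _ (cubeNerveMk.{u} u)))
      rw [hd, map_zero, add_zero] at h
      rw [map_sub, map_sub, cubeProj_d, h, sub_self]

end CubicalChains

namespace CubicalChains

open CubicalSet Simplicial

variable (k : Type v) [CommRing k]

/-- The homotopy on the chains of a triangulation whose restriction to every simplicial cube is
`cubeHomotopy`. -/
noncomputable def triHomotopy (Y : CubicalSet.{u}) (m : ℕ) :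
    NormChains k (Y.triangulation.degenerate m) →ₗ[k]
      NormChains k (Y.triangulation.degenerate (m + 1)) :=
  NormChains.desc (Quot.lift (fun x => SimplicialChains.map k (charMap x.2.1) (m + 1)
    (cubeHomotopy k x.1 m (NormChains.mk k _ (cubeNerveMk x.2.2)))) (by
      rintro _ _ ⟨h, u⟩
      rw [charMap_pullback h, SimplicialChains.map_comp_apply, ← cubeHomotopy_map k h.isCubeMap,
        map_cubeNerveMap_mk])) (by
    intro x hx
    cases m with
    | zero => simp at hx
    | succ m =>
      obtain ⟨i, z, rfl⟩ := SimplicialChains.exists_eq_σ hx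
      obtain ⟨⟨n, y, u⟩, rfl⟩ := Quot.exists_rep z
      change SimplicialChains.map k (charMap y) (m + 2) (cubeHomotopy k n (m + 1)
        (NormChains.mk k _ (cubeNerveMk (u.comp (SimplexCategory.σ i).toOrderHom)))) = 0
      rw [NormChains.mk_eq_zero, map_zero, map_zero]
      exact (cubeNerve n).σ_mem_degenerate i (cubeNerveMk u))

theorem charMap_mk {Y : CubicalSet.{u}} {m n : ℕ} (y : Y.cube n)
    (u : Fin (m + 1) →o (Fin n → Fin 2)) :
    SimplicialChains.map k (charMap y) m (NormChains.mk k _ (cubeNerveMk u)) =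
      NormChains.mk k _ (Y.triangulationMk y u) :=
  SimplicialChains.map_mk _ _ _ _

theorem triHomotopy_map_charMap {Y : CubicalSet.{u}} {n : ℕ} (y : Y.cube n) (m : ℕ)
    (c : NormChains k ((cubeNerve.{u} n).degenerate m)) :
    triHomotopy k Y m (SimplicialChains.map k (charMap y) m c) =
      SimplicialChains.map k (charMap y) (m + 1) (cubeHomotopy k n m c) := by
  suffices h : triHomotopy k Y m ∘ₗ SimplicialChains.map k (charMap y) m =
      SimplicialChains.map k (charMap y) (m + 1) ∘ₗ cubeHomotopy k n m from LinearMap.congr_fun h c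
  refine cubeNerve_hom_ext k fun u => ?_
  rw [LinearMap.comp_apply, LinearMap.comp_apply, charMap_mk]
  exact NormChains.desc_mk _ _ _

theorem charMap_hom_ext {Y : CubicalSet.{u}} {m : ℕ} {M : Type*} [AddCommGroup M] [Module k M]
    {f g : NormChains k (Y.triangulation.degenerate m) →ₗ[k] M}
    (h : ∀ (n : ℕ) (y : Y.cube n) (u : Fin (m + 1) →o (Fin n → Fin 2)),
      f (SimplicialChains.map k (charMap y) m (NormChains.mk k _ (cubeNerveMk u))) =
        g (SimplicialChains.map k (charMap y) m (NormChains.mk k _ (cubeNerveMk u)))) :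
    f = g := by
  refine NormChains.hom_ext fun x => ?_
  obtain ⟨n, y, u, rfl⟩ := exists_triangulationMk Y x
  rw [← charMap_mk]
  exact h n y u

theorem sh_awMap_charMap {Y : CubicalSet.{u}} {m n : ℕ} (y : Y.cube n)
    (u : Fin (m + 1) →o (Fin n → Fin 2)) :
    sh k Y m (awMap k Y m (SimplicialChains.map k (charMap y) m
      (NormChains.mk k _ (cubeNerveMk u)))) = SimplicialChains.map k (charMap y) m
        (cubeProj k n m (NormChains.mk k _ (cubeNerveMk u))) := by
  rw [charMap_mk, awMap_mk, charMap_cubeProj]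

theorem sh_awMap_zero (Y : CubicalSet.{u}) : sh k Y 0 ∘ₗ awMap k Y 0 = LinearMap.id := by
  refine charMap_hom_ext k fun n y u => ?_
  rw [LinearMap.comp_apply, sh_awMap_charMap, cubeProj_zero]
  rfl

theorem triHomotopy_zero (Y : CubicalSet.{u}) : triHomotopy k Y 0 = 0 := by
  refine charMap_hom_ext k fun n y u => ?_
  rw [triHomotopy_map_charMap, cubeHomotopy, LinearMap.zero_apply, map_zero, LinearMap.zero_apply]

/-- The shuffle map composed with the Alexander–Whitney map is homotopic to the identity. -/
theorem d_triHomotopy (Y : CubicalSet.{u}) (m : ℕ) :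
    SimplicialChains.d k _ (m + 1) ∘ₗ triHomotopy k Y (m + 1) +
      triHomotopy k Y m ∘ₗ SimplicialChains.d k _ m =
        LinearMap.id - sh k Y (m + 1) ∘ₗ awMap k Y (m + 1) := by
  refine charMap_hom_ext k fun n y u => ?_
  rw [LinearMap.add_apply, LinearMap.sub_apply, LinearMap.comp_apply, LinearMap.comp_apply,
    LinearMap.comp_apply, sh_awMap_charMap, triHomotopy_map_charMap, ← SimplicialChains.map_d,
    ← SimplicialChains.map_d, triHomotopy_map_charMap, ← map_add, d_cubeHomotopy, map_sub]
  rfl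

end CubicalChains

/-! ### The shuffle map is a quasi-isomorphism -/

/-- A morphism `f` of differential graded coalgebras is a quasi-isomorphism if it has a left inverse
`r` that is a chain map and also a right inverse up to a homotopy `h`. The map `r` need not be
compatible with the diagonals. -/
theorem DGCoalgebra.isQuasiIso_of_homotopy {k : Type v} [CommRing k] {C D : DGCoalgebra.{v, w} k}
    (f : C ⟶ D) (r : ∀ n, D.X n →ₗ[k] C.X n) (hr : ∀ n, r n ∘ₗ D.d n = C.d n ∘ₗ r (n + 1))
    (hrf : ∀ n, r n ∘ₗ Hom.f f n = LinearMap.id) (h : ∀ n, D.X n →ₗ[k] D.X (n + 1))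
    (h_zero : D.d 0 ∘ₗ h 0 = LinearMap.id - Hom.f f 0 ∘ₗ r 0)
    (h_succ : ∀ n, D.d (n + 1) ∘ₗ h (n + 1) + h n ∘ₗ D.d n =
      LinearMap.id - Hom.f f (n + 1) ∘ₗ r (n + 1)) :
    IsQuasiIso f := by
  let g : D.toChainComplex ⟶ C.toChainComplex :=
    ChainComplex.ofHom (fun n => ModuleCat.ofHom (r n)) (fun n => by
      rw [toChainComplex_d, toChainComplex_d]
      exact congrArg ModuleCat.ofHom (hr n).symm)
  let s : ∀ i j, (ComplexShape.down ℕ).Rel j i → (D.toChainComplex.X i ⟶ D.toChainComplex.X j) :=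
    fun i _ hij => hij ▸ ModuleCat.ofHom (h i)
  have hs : Homotopy.nullHomotopicMap' s = 𝟙 _ - g ≫ toChainMap f := by
    ext n : 1
    cases n with
    | zero =>
      rw [Homotopy.nullHomotopicMap'_f_of_not_rel_left (k₁ := 1) (k₀ := 0) rfl (by simp)]
      change ModuleCat.ofHom (h 0) ≫ D.toChainComplex.d 1 0 = _
      rw [toChainComplex_d]
      exact congrArg ModuleCat.ofHom h_zero
    | succ n =>
      rw [Homotopy.nullHomotopicMap'_f (k₂ := n + 2) (k₁ := n + 1) (k₀ := n) rfl rfl]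
      rw [toChainComplex_d, toChainComplex_d]
      exact congrArg ModuleCat.ofHom ((add_comm _ _).trans (h_succ n))
  let e : HomotopyEquiv C.toChainComplex D.toChainComplex :=
    { hom := toChainMap f
      inv := g
      homotopyHomInvId := .ofEq (by
        ext n : 1
        exact congrArg ModuleCat.ofHom (hrf n))
      homotopyInvHomId := (Homotopy.equivSubZero.symm
        ((Homotopy.ofEq hs.symm).trans (Homotopy.nullHomotopy' s))).symm }
  exact e.quasiIso_hom

namespace CubicalChains

variable (k : Type v) [CommRing k]

/-- The shuffle map as a morphism of differential graded coalgebras. -/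
noncomputable def shHom (Y : CubicalSet.{u}) :
    DGCoalgebra.Hom (coalgebra k Y) (SimplicialChains.coalgebra k Y.triangulation) where
  f := sh k Y
  f_d n := (d_sh k Y n).symm
  comul_f p q n h := comul_sh k Y p q n h
  counit_f := counit_sh k Y

theorem isQuasiIso_shHom (Y : CubicalSet.{u}) :
    DGCoalgebra.IsQuasiIso (C := coalgebra k Y) (D := SimplicialChains.coalgebra k Y.triangulation)
      (shHom k Y) := by
  refine DGCoalgebra.isQuasiIso_of_homotopy _ (awMap k Y) (awMap_d k Y) (awMap_sh k Y)
    (triHomotopy k Y) ?_ (d_triHomotopy k Y)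
  have h : SimplicialChains.d k Y.triangulation 0 ∘ₗ triHomotopy k Y 0 =
      LinearMap.id - sh k Y 0 ∘ₗ awMap k Y 0 := by
    rw [triHomotopy_zero, sh_awMap_zero, LinearMap.comp_zero, sub_self]
  exact h

end CubicalChains

theorem mainTheorem3 (k : Type v) [CommRing k] :
    ∃ t : CubicalChains.functor.{u, v} k ⟶
        CubicalSet.triangulationFunctor.{u} ⋙ SimplicialChains.functor.{u, v} k,
      (∀ (Y : CubicalSet.{u}) (n : ℕ) (y : Y.cube n),
        DGCoalgebra.Hom.f (t.app Y) n (NormChains.mk k (Y.thin n) y) =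
          ∑ π : Equiv.Perm (Fin n), (Equiv.Perm.sign π : ℤ) •
            NormChains.mk k (Y.triangulation.degenerate n)
              (Y.triangulationMk y (permSimplex π))) ∧
      ∀ Y : CubicalSet.{u}, DGCoalgebra.IsQuasiIso (t.app Y) := by
  refine ⟨{ app := CubicalChains.shHom k, naturality := fun Y Z f => ?_ }, ?_, ?_⟩
  · refine DGCoalgebra.Hom.ext (funext fun n => LinearMap.ext fun c => ?_)
    exact CubicalChains.sh_map k f n c
  · exact fun Y n y => CubicalChains.sh_mk k y
  · exact CubicalChains.isQuasiIso_shHom k
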